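/- **Setting.** For $k\mid n$ let $G_{n,k}$ be the graph on $n$ nodes consisting of $n/k$ cliques $C_1,\dots,C_{n/k}$ of size $k$, in which any two consecutive cliques are joined by a perfect matching, so that the matchings form $k$ disjoint paths from $C_1$ to $C_{n/k}$. Each node $u$ initially holds one message $m_u$. Time proceeds in synchronous rounds $0,1,2,\dots$; in each round a working node may send one message, the same to all its neighbours. Nodes fail independently: each node fails in each round with probability $q$ and never recovers (from the round in which it fails, it neither sends nor receives); links are reliable. **Algorithm.** Let $\alpha,d>0$ and $0<\hat c\le\frac12$ be constants, $\tau=\lceil\alpha\log_2 n\rceil$, $\tau'=\lceil 8d\,\tau\log_2^2 n\rceil$, $T=\tau/2$. A node $u$ keeps the set $R_u$ of messages it knows (initially $\{m_u\}$), the set $S_u$ of messages it has sent outside shuffle phases, $B_u=R_u\setminus S_u$, and counters $\mathrm{cnt}_{u,v}$ of the receptions of $m_v$ outside shuffle phases (initially $1$ for $v=u$ and $0$ otherwise). A message $m_v\in R_u$ is *fresh* for $u$ if $\mathrm{cnt}_{u,v}<T$. * Round 0: $u$ sends $m_u$. * Random phase ($\tau$ rounds): a buffer $\hat B_u$ is set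 to $B_u$ at the start; in each round $u$ removes a uniformly random message from $\hat B_u$ and sends it. * Then, for $p=1,2,\dots$, ranking phase $p$ is followed by shuffle phase $p$. * Ranking phase ($\tau'$ rounds): at the start, $\hat B_u$ is set to $B_u$ in the first ranking phase, and in later ranking phases to the messages of $B_u$ that were selected at the end of the preceding shuffle phase or are not fresh. $\hat B_u$ is sorted with the selected messages first and then by increasing $\mathrm{cnt}$, ties being broken arbitrarily; the message of rank $r$ gets weight $1/r$. In each round $u$ draws a message from $\hat B_u$ with probability proportional to its weight among the messages that remain there, removes it and sends it. In the random phase and in ranking phases a node with $\hat B_u=\emptyset$ sends nothing. * Shuffle phase ($8\tau$ rounds): at the start, $\hat B_u$ is set to the fresh messages of $B_u$, and $\mathrm{phasecnt}_{u,v}$ to $1$ for these and $0$ for the others. In each round $u$ removes an arbitrary message from $\hat B_u$ and sends it (it sends $m_u$ if $\hat B_u=\emptyset$), and increases $\mathrm{phasecnt}_{u,v}$ by one for each reception of $m_v$; $R_u$, $S_u$ and $\mathrm{cnt}$ do not change. At the end, let $Q_u$ be the set of messages with $\mathrm{phasecnt}_{u,v}\ge\hat cT$, $\mathrm{phasecnt}_{u,v}>0$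 and $\mathrm{cnt}_{u,v}<T$. The node adds $Q_u$ to $R_u$ and selects a uniformly random subset of $\min(4\tau,|Q_u|)$ messages of $Q_u$. All random choices are independent across nodes and of the failures. The choices left arbitrary may depend on the node, the round and the node's local state. Let $\tau_e=1+\tau+(\frac nk-1)(\tau'+8\tau)+\tau'$ be the number of rounds up to the end of ranking phase $n/k$. **Theorem.** For every $c\ge1$ there are $\alpha_0,d_0$ such that for all constants $\alpha\ge\alpha_0$, $d\ge d_0$ and $0<\hat c\le\frac12$ there is a constant $C>0$ with the following property. Let $k=k(n)=\omega(\log^3 n)$. Then for all sufficiently large $n$ with $k\mid n$: 1. $\tau_e\le C\,\dfrac{n\log^3 n}{k}$ (so $\frac1{32\tau_e}\ge \frac{1}{32C}\cdot\frac{k}{n\log^3 n}$); 2. for every failure probability $0\le q\le\frac{1}{32\tau_e}$ and however the arbitrary choices are made, the algorithm on $G_{n,k}$ completes information spreading within $\tau_e$ rounds with probability at least $1-n^{-c}$; that is, after $\tau_e$ rounds every node that has not failed knows $m_v$ for every node $v$ that did not fail before sending $m_v$ in round 0. -/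

import Mathlib

open Filter
open scoped ENNReal Topology

namespace VertexCongest

noncomputable section

/-! ### Finite product distributions -/

/-- Independent choices: the coordinate `x v` of a sample `x` has law `f v`, and the coordinates
are independent. -/
def pmfPi {ι β : Type*} [Fintype ι] [DecidableEq ι] [Fintype β] (f : ι → PMF β) :
    PMF (ι → β) :=
  PMF.ofFintype (fun x => ∏ i, f i (x i)) (by
    rw [← Fintype.prod_sum]
    refine Finset.prod_eq_one fun i _ => ?_
    have h := (f i).tsum_coe
    rwa [tsum_fintype] at h)

/-- A coin that shows `true` with probability `q`. -/
def coin (q : unitInterval) : PMF Bool :=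
  PMF.ofFintype (fun b => cond b (ENNReal.ofReal (q : ℝ)) (ENNReal.ofReal (1 - (q : ℝ)))) (by
    rw [Fintype.sum_bool, cond_true, cond_false,
      ← ENNReal.ofReal_add q.2.1 (sub_nonneg.2 q.2.2)]
    simp)

/-- Run the random transition `f` `N` times. -/
def iterate {α : Type*} (f : α → PMF α) : ℕ → α → PMF α
  | 0, a => PMF.pure a
  | N + 1, a => (f a).bind (iterate f N)

/-! ### Local states -/

/-- The parameters of the algorithm. -/
structure Params where
  /-- the length `τ` of the random phase -/
  tau : ℕ
  /-- the length `τ'` of a ranking phase -/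
  tau' : ℕ
  /-- the constant `ĉ` of the filter of the shuffle phases -/
  cHat : ℝ

/-- The freshness threshold `T = τ / 2`. -/
def Params.T (P : Params) : ℝ := (P.tau : ℝ) / 2

/-- `τ = α log n`, `τ' = 8 d τ log² n` (binary logarithms, rounded up). -/
def params (α d cHat : ℝ) (n : ℕ) : Params where
  tau := ⌈α * Real.logb 2 n⌉₊
  tau' := ⌈8 * d * (⌈α * Real.logb 2 n⌉₊ : ℝ) * (Real.logb 2 n) ^ 2⌉₊
  cHat := cHat

/-- The local state of a node. The message `m_v` is identified with its origin `v`. -/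
structure NodeState (V : Type*) where
  /-- `R_u`: the known messages -/
  R : Finset V
  /-- `S_u`: the messages sent in round 0, in the random phase and in ranking phases -/
  S : Finset V
  /-- `cnt_{u,v}`: how often `m_v` was received (shuffle phases use `phasecnt` instead) -/
  cnt : V → ℕ
  /-- the working buffer of the current phase -/
  hatB : Finset V
  /-- the message `m` has weight `1 / (pos m + 1)` in the current phase -/
  pos : V → ℕ
  /-- `phasecnt_{u,v}`: the counters of the current shuffle phase -/
  phasecnt : V → ℕ
  /-- the messages selected at the end of the last shuffle phase (`none` before the first one) -/
  sel : Option (Finset V)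

/-- How the choices are made that the algorithm leaves open: ties in the sorting step are broken,
and the next message of a shuffle phase is popped, in the increasing order of an arbitrary
injective key. The key may depend on the node, the round, and the whole local state. -/
structure Rules (V : Type*) where
  tie : V → ℕ → NodeState V → (V ↪ ℕ)
  pop : V → ℕ → NodeState V → (V ↪ ℕ)

section Algorithm

variable {V : Type*} [Fintype V] [DecidableEq V]

/-- The initial state of node `u`. -/
def initState (u : V) : NodeState V where
  R := {u}
  S := ∅
  cnt := fun v => if v = u then 1 else 0
  hatB := ∅
  pos := fun _ => 0
  phasecnt := fun _ => 0
  sel := none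

/-- `B_u = R_u - S_u`. -/
def NodeState.B (s : NodeState V) : Finset V := s.R \ s.S

/-- Start of the random phase: the buffer is `B_u`, and all weights are equal. -/
def NodeState.startRandom (s : NodeState V) : NodeState V :=
  { s with hatB := s.B, pos := fun _ => 0 }

open Classical in
/-- The buffer at the start of a ranking phase. The first ranking phase starts with all of `B_u`.
After a shuffle phase, the only fresh messages to start with are the selected ones. -/
def NodeState.rankingBuffer (P : Params) (s : NodeState V) : Finset V :=
  match s.sel with
  | none => s.B
  | some A => s.B.filter fun m => m ∈ A ∨ P.T ≤ (s.cnt m : ℝ)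

/-- The order of the ranking list: selected messages first, then by increasing `cnt`,
ties being broken by `key`. -/
def NodeState.Precedes (s : NodeState V) (key : V ↪ ℕ) (m m' : V) : Prop :=
  let a : V → ℕ := fun x => if x ∈ s.sel.getD ∅ then 0 else 1
  a m < a m' ∨ (a m = a m' ∧
    (s.cnt m < s.cnt m' ∨ (s.cnt m = s.cnt m' ∧ key m < key m')))

open Classical in
/-- Start of a ranking phase: `pos m + 1` is the position of `m` in the sorted buffer, so the
message of rank `r` gets probability `1 / (r H_b)`, where `b` is the size of the buffer. -/
def NodeState.startRanking (P : Params) (key : V ↪ ℕ) (s : NodeState V) : NodeState V :=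
  { s with
    hatB := s.rankingBuffer P
    pos := fun m => ((s.rankingBuffer P).filter fun m' => s.Precedes key m' m).card }

open Classical in
/-- Start of a shuffle phase: the buffer consists of the fresh messages of `B_u`,
that is, those with `cnt < T`. -/
def NodeState.startShuffle (P : Params) (s : NodeState V) : NodeState V :=
  let F := s.B.filter fun m => (s.cnt m : ℝ) < P.T
  { s with hatB := F, phasecnt := fun m => if m ∈ F then 1 else 0 }

/-- Pick a message from `B` with probability proportional to `1 / (pos m + 1)`;
nothing is picked from the empty buffer. -/
def draw (B : Finset V) (pos : V → ℕ) : PMF (Option V) :=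
  if h : B.Nonempty then
    (PMF.normalize (fun m => if m ∈ B then ((pos m + 1 : ℕ) : ℝ≥0∞)⁻¹ else 0)
      (by
        obtain ⟨m, hm⟩ := h
        refine fun h0 => ?_
        have h1 := ENNReal.tsum_eq_zero.1 h0 m
        rw [if_pos hm] at h1
        exact ENNReal.natCast_ne_top _ (ENNReal.inv_eq_zero.1 h1))
      (by
        rw [tsum_fintype]
        refine (ENNReal.sum_lt_top.2 fun m _ => ?_).ne
        split_ifs
        · exact ENNReal.inv_lt_top.2 (by exact_mod_cast Nat.succ_pos _)
        · exact ENNReal.zero_lt_top)).map some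
  else PMF.pure none

open Classical in
/-- How many neighbours of `u` send `m_v`, when `out w` is the message sent by `w`. -/
def received (G : SimpleGraph V) (out : V → Option V) (u v : V) : ℕ :=
  (Finset.univ.filter fun w => G.Adj u w ∧ out w = some v).card

open Classical in
/-- The update of the state of `u` in a round of the random phase or of a ranking phase
(and in round 0). -/
def NodeState.sync (G : SimpleGraph V) (out : V → Option V) (u : V) (s : NodeState V) :
    NodeState V :=
  { s with
    R := s.R ∪ Finset.univ.filter fun v => 0 < received G out u v
    S := s.S ∪ (out u).toFinset
    cnt := fun v => s.cnt v + received G out u v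
    hatB := s.hatB \ (out u).toFinset }

/-- The update of the state of `u` in a round of a shuffle phase. -/
def NodeState.syncShuffle (G : SimpleGraph V) (out : V → Option V) (u : V)
    (s : NodeState V) : NodeState V :=
  { s with
    phasecnt := fun v => s.phasecnt v + received G out u v
    hatB := s.hatB \ (out u).toFinset }

open Classical in
/-- The message that `u` sends in a round of a shuffle phase: a message popped from its buffer,
and its own message if the buffer is empty. -/
def shuffleMessage (key : V ↪ ℕ) (u : V) (s : NodeState V) : V :=
  if h : s.hatB.Nonempty then (s.hatB.exists_min_image key h).choose else u

open Classical in
/-- The set `R` that remains at the end of a shuffle phase, after the messages with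
`phasecnt < ĉ T` and those that were already non-fresh before the phase are filtered out. -/
def NodeState.filtered (P : Params) (s : NodeState V) : Finset V :=
  Finset.univ.filter fun m =>
    0 < s.phasecnt m ∧ P.cHat * P.T ≤ (s.phasecnt m : ℝ) ∧ (s.cnt m : ℝ) < P.T

/-- A uniformly random selection of `4 τ` of the remaining messages
(of all of them, if there are fewer). -/
def selection (P : Params) (s : NodeState V) : PMF (Finset V) :=
  PMF.uniformOfFinset
    ((s.filtered P).powersetCard (min (4 * P.tau) (s.filtered P).card))
    (Finset.powersetCard_nonempty.2 (min_le_right _ _))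

/-- The end of a shuffle phase, in which the set `A` was selected. -/
def NodeState.endShuffle (P : Params) (A : Finset V) (s : NodeState V) : NodeState V :=
  { s with R := s.R ∪ s.filtered P, sel := some A }

/-! ### Executions with crash failures -/

/-- A failure schedule for `N` rounds: `F u s = true` means that the failure coin of node `u` in
round `s` shows a failure. -/
abbrev Schedule (V : Type*) (N : ℕ) := V → Fin N → Bool

/-- Node `u` works in round `t`: it failed in none of the rounds `0, …, t`. A node that fails in
round `t` neither sends nor receives from round `t` on. -/
def Alive {N : ℕ} (F : Schedule V N) (u : V) (t : ℕ) : Prop :=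
  ∀ s : Fin N, (s : ℕ) ≤ t → F u s = false

/-- Nodes fail independently, with probability `q` per round. -/
def failures (V : Type*) [Fintype V] [DecidableEq V] (q : unitInterval) (N : ℕ) :
    PMF (Schedule V N) :=
  pmfPi fun _ => pmfPi fun _ => coin q

/-- A configuration: the number of rounds executed so far, and all local states. -/
structure Config (V : Type*) where
  time : ℕ
  st : V → NodeState V

/-- A local computation of every node, which takes no communication round. -/
def Config.locally (f : V → ℕ → NodeState V → NodeState V) (c : Config V) : Config V :=
  { c with st := fun u => f u c.time (c.st u) }

open Classical in
/-- One communication round: the working nodes send the messages `msg` to all their neighbours,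
and the working nodes update their states. -/
def Config.round {N : ℕ} (F : Schedule V N)
    (update : (V → Option V) → V → NodeState V → NodeState V)
    (msg : V → Option V) (c : Config V) : Config V where
  time := c.time + 1
  st := fun u =>
    if Alive F u c.time then
      update (fun w => if Alive F w c.time then msg w else none) u (c.st u)
    else c.st u

variable (G : SimpleGraph V) (P : Params) (ρ : Rules V) {N : ℕ} (F : Schedule V N)

/-- The configuration after round 0, in which every node `u` sends `m_u`. -/
def afterRoundZero : Config V :=
  Config.round F (NodeState.sync G) some ⟨0, initState⟩

/-- A round in which every node independently draws its message from its buffer. -/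
def drawRound (c : Config V) : PMF (Config V) :=
  (pmfPi fun u => draw (c.st u).hatB (c.st u).pos).map fun msg =>
    c.round F (NodeState.sync G) msg

/-- A round of a shuffle phase. -/
def shuffleRound (c : Config V) : Config V :=
  c.round F (NodeState.syncShuffle G) fun u =>
    some (shuffleMessage (ρ.pop u c.time (c.st u)) u (c.st u))

/-- The random phase: `τ` rounds. -/
def randomPhase (c : Config V) : PMF (Config V) :=
  iterate (drawRound G F) P.tau (c.locally fun _ _ => NodeState.startRandom)

/-- A ranking phase: `τ'` rounds. -/
def rankingPhase (c : Config V) : PMF (Config V) :=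
  iterate (drawRound G F) P.tau'
    (c.locally fun u t s => s.startRanking P (ρ.tie u t s))

/-- A shuffle phase: `8 τ` rounds, followed by the independent selections of the nodes. -/
def shufflePhase (c : Config V) : PMF (Config V) :=
  let c' := (shuffleRound G ρ F)^[8 * P.tau] (c.locally fun _ _ => NodeState.startShuffle P)
  (pmfPi fun u => selection P (c'.st u)).map fun A =>
    c'.locally fun u _ s => s.endShuffle P (A u)

/-- Round 0, the random phase, and `p` times a ranking phase followed by a shuffle phase. -/
def beforeRanking : ℕ → PMF (Config V)
  | 0 => randomPhase G P F (afterRoundZero G F)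
  | p + 1 => ((beforeRanking p).bind (rankingPhase G P ρ F)).bind (shufflePhase G P ρ F)

/-- The execution up to the end of ranking phase `p`, for `p ≥ 1`. -/
def execution (p : ℕ) : PMF (Config V) :=
  (beforeRanking G P ρ F (p - 1)).bind (rankingPhase G P ρ F)

end Algorithm

/-- The round number at the end of ranking phase `p`, for `p ≥ 1`. -/
def endTime (P : Params) (p : ℕ) : ℕ :=
  1 + P.tau + (p - 1) * (P.tau' + 8 * P.tau) + P.tau'

/-- The joint law of the failures and of the execution up to the end of ranking phase `p`,
for nodes that fail with probability `q` per round. -/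
def faultyExecution {V : Type*} [Fintype V] [DecidableEq V] (G : SimpleGraph V) (P : Params)
    (ρ : Rules V) (q : unitInterval) (p : ℕ) :
    PMF (Schedule V (endTime P p) × Config V) :=
  (failures V q (endTime P p)).bind fun F => (execution G P ρ F p).map fun c => (F, c)

/-- Information spreading is complete: every node `u` that has not failed knows the message of
every node `v` that did not fail before sending its message in round 0. -/
def SpreadComplete {V : Type*} {N : ℕ} (F : Schedule V N) (c : Config V) : Prop :=
  ∀ u v : V, Alive F u c.time → Alive F v 0 → v ∈ (c.st u).R

/-- The graph `G_{n,k}` for `n = m k`: the node `(i, a)` is the `a`-th node of the `i`-th clique,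
and the matchings join `(i, a)` to `(i + 1, a)`. -/
def cliquePath (m k : ℕ) : SimpleGraph (Fin m × Fin k) where
  Adj x y := (x.1 = y.1 ∧ x.2 ≠ y.2) ∨
    (x.2 = y.2 ∧ ((x.1 : ℕ) + 1 = y.1 ∨ (y.1 : ℕ) + 1 = x.1))
  symm := by
    constructor
    rintro x y (⟨h, h'⟩ | ⟨h, h' | h'⟩)
    · exact Or.inl ⟨h.symm, h'.symm⟩
    · exact Or.inr ⟨h.symm, Or.inr h'⟩
    · exact Or.inr ⟨h.symm, Or.inl h'⟩
  loopless := by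
    constructor
    rintro x (⟨-, h⟩ | ⟨-, h | h⟩)
    · exact h rfl
    · omega
    · omega

/-! ### The number of rounds -/

section Time

variable {V : Type*} [Fintype V] [DecidableEq V] (G : SimpleGraph V) (P : Params)
  (ρ : Rules V) {N : ℕ} (F : Schedule V N)

theorem time_drawRounds (r : ℕ) : ∀ c : Config V,
    ∀ c' ∈ (iterate (drawRound G F) r c).support, c'.time = c.time + r := by
  induction r with
  | zero =>
    intro c c' h
    simp only [iterate, PMF.support_pure, Set.mem_singleton_iff] at h
    simp [h]
  | succ r ih =>
    intro c c' h
    simp only [iterate, PMF.mem_support_bind_iff] at h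
    obtain ⟨c₁, h₁, h₂⟩ := h
    rw [ih c₁ c' h₂]
    simp only [drawRound, PMF.support_map, Set.mem_image] at h₁
    obtain ⟨msg, -, rfl⟩ := h₁
    simp only [Config.round]
    omega

theorem time_shuffleRounds (r : ℕ) : ∀ c : Config V,
    ((shuffleRound G ρ F)^[r] c).time = c.time + r := by
  induction r with
  | zero => intro c; rfl
  | succ r ih =>
    intro c
    rw [Function.iterate_succ_apply, ih]
    simp only [shuffleRound, Config.round]
    omega

theorem time_beforeRanking (p : ℕ) : ∀ c ∈ (beforeRanking G P ρ F p).support,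
    c.time = 1 + P.tau + p * (P.tau' + 8 * P.tau) := by
  induction p with
  | zero =>
    intro c h
    simp only [beforeRanking, randomPhase] at h
    rw [time_drawRounds G F _ _ c h]
    simp [Config.locally, afterRoundZero, Config.round]
  | succ p ih =>
    intro c h
    simp only [beforeRanking, PMF.mem_support_bind_iff] at h
    obtain ⟨c₂, ⟨c₁, h₁, h₂⟩, h₃⟩ := h
    simp only [shufflePhase, PMF.support_map, Set.mem_image] at h₃
    obtain ⟨A, -, rfl⟩ := h₃
    have e₂ := time_drawRounds G F _ _ c₂ h₂
    have e₁ := ih c₁ h₁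
    simp only [Config.locally] at e₂
    have e₃ := time_shuffleRounds G ρ F (8 * P.tau)
      (c₂.locally fun _ _ => NodeState.startShuffle P)
    simp only [Config.locally] at e₃ ⊢
    rw [e₃, e₂, e₁]
    ring

/-- Every execution up to the end of ranking phase `p` has exactly `endTime P p` rounds. -/
theorem time_execution (p : ℕ) : ∀ c ∈ (execution G P ρ F p).support,
    c.time = endTime P p := by
  intro c h
  simp only [execution, PMF.mem_support_bind_iff] at h
  obtain ⟨c₁, h₁, h₂⟩ := h
  have e₂ := time_drawRounds G F _ _ c h₂
  simp only [Config.locally] at e₂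
  rw [e₂, time_beforeRanking G P ρ F _ c₁ h₁, endTime]

end Time

end

end VertexCongest

namespace VertexCongest

set_option linter.unusedSectionVars false

/-! Condition on the failure schedule. A node fails within `τ_e` rounds with probability at most
`1/32`, so with overwhelming probability at most `k/20` nodes of each clique ever fail
(`prob_not_fewFailures`). The rest of the analysis is carried out for a fixed schedule with this
property.

Messages then advance by one clique in each direction per ranking phase. Put `s = ⌊τ/2⌋ + 2`. If `s`
nodes of a clique have sent a message, every working node of the clique counts at least `s - 1 ≥ T`
receptions, so the message is known and no longer fresh there (`Sound.le_cnt`). A message that has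
not yet been spread in a clique has been sent there at most by the node in the column of its origin,
so it is counted at most three times (`Sound.cnt_le_three`). Freshness thus separates new messages
from those already spread.

In the random phase every message is sent by `s` nodes of its own clique, while at most `2τ` nodes
of a clique send the message of their partner in a given adjacent clique (`prob_randomPhase`). In
each ranking phase the messages that matter number at most `8τ` and form the top of the list. Each
is therefore drawn with probability at least `1/(8τ H_n)` per round as long as it remains, and `τ'`
rounds suffice to send them all (`prob_rankingPhase_missing`). Since `s` surviving columns send a
message, `s` nodes of the next clique receive it. In shuffle phase `p` these holders announce it to
their whole clique. A message from beyond distance `p + 1` is known only in the column of its origin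
and is counted at most four times, which is less than `ĉT`. So exactly the messages from distance `p
+ 1` pass the filter, at most `2k` of them, and each is selected by a given node with probability at
least `min(1, 2τ/k)`. As at least `3k/4` columns are good, at least `s` good nodes select it
(`prob_shufflePhase`).

The deterministic content is in the invariants `PostRandom`, `Spread` and `Shuffled`. The first
ranking phase can push messages one clique too far along their own column. This contaminates a set
`X` of at most `4τ` nodes per clique, and `X` does not change afterwards.

For the tail bounds, the buffer of a node changes within a random or ranking phase only through the
node's own draws. Exponential moments of the number of nodes that have sent a message are therefore
bounded by products of local potentials (`expect_draws_prod_le`). After ranking phase `m = n/k`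
every distance is covered. The union bound has fewer than `n^5` terms, each at most `n^{-(c+5)}`. -/

/-! ### Expectations and failure probabilities -/

/-- The expectation of a nonnegative function. -/
noncomputable def expect {α : Type*} (p : PMF α) (f : α → ℝ≥0∞) : ℝ≥0∞ := ∑' x, p x * f x

theorem expect_pure {α : Type*} (a : α) (f : α → ℝ≥0∞) : expect (PMF.pure a) f = f a := by
  unfold expect
  rw [tsum_eq_single a]
  · simp
  · intro b hb
    simp [PMF.pure_apply, hb]

theorem expect_bind {α β : Type*} (p : PMF α) (g : α → PMF β) (f : β → ℝ≥0∞) :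
    expect (p.bind g) f = expect p fun a => expect (g a) f := by
  unfold expect
  simp only [PMF.bind_apply, ← ENNReal.tsum_mul_right, ← ENNReal.tsum_mul_left]
  rw [ENNReal.tsum_comm]
  simp only [mul_assoc]

theorem expect_map {α β : Type*} (p : PMF α) (g : α → β) (f : β → ℝ≥0∞) :
    expect (p.map g) f = expect p fun a => f (g a) := by
  rw [PMF.map, expect_bind]
  simp [expect_pure]

theorem expect_mono {α : Type*} (p : PMF α) {f g : α → ℝ≥0∞} (h : ∀ a ∈ p.support, f a ≤ g a) :
    expect p f ≤ expect p g := by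
  refine ENNReal.tsum_le_tsum fun a => ?_
  by_cases ha : p a = 0
  · simp [ha]
  · gcongr
    exact h a ((PMF.mem_support_iff _ _).2 ha)

theorem expect_const {α : Type*} (p : PMF α) (r : ℝ≥0∞) : expect p (fun _ => r) = r := by
  unfold expect
  rw [ENNReal.tsum_mul_right, p.tsum_coe, one_mul]

theorem pmfPi_apply {ι β : Type*} [Fintype ι] [DecidableEq ι] [Fintype β] (p : ι → PMF β)
    (x : ι → β) : pmfPi p x = ∏ i, p i (x i) := rfl

theorem expect_pmfPi_prod {ι β : Type*} [Fintype ι] [DecidableEq ι] [Fintype β] (p : ι → PMF β)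
    (g : ι → β → ℝ≥0∞) :
    expect (pmfPi p) (fun x => ∏ i, g i (x i)) = ∏ i, expect (p i) (g i) := by
  unfold expect
  simp only [tsum_fintype, pmfPi_apply, ← Finset.prod_mul_distrib]
  rw [← Fintype.prod_sum (fun i b => p i b * g i b)]

theorem mem_support_of_mem_support_pmfPi {ι β : Type*} [Fintype ι] [DecidableEq ι] [Fintype β]
    {p : ι → PMF β} {x : ι → β} (hx : x ∈ (pmfPi p).support) (i : ι) : x i ∈ (p i).support := by
  rw [PMF.mem_support_iff, pmfPi_apply] at hx
  rw [PMF.mem_support_iff]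
  exact fun h => hx (Finset.prod_eq_zero (Finset.mem_univ i) h)

theorem prob_le_expect {α : Type*} (p : PMF α) (s : Set α) (f : α → ℝ≥0∞)
    (h : ∀ a ∈ p.support, a ∈ s → 1 ≤ f a) : p.toOuterMeasure s ≤ expect p f := by
  rw [PMF.toOuterMeasure_apply]
  refine ENNReal.tsum_le_tsum fun a => ?_
  by_cases hs : a ∈ s
  · rw [Set.indicator_of_mem hs]
    by_cases ha : p a = 0
    · simp [ha]
    · calc p a = p a * 1 := (mul_one _).symm
        _ ≤ _ := by
          gcongr
          exact h a ((PMF.mem_support_iff _ _).2 ha) hs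
  · rw [Set.indicator_of_notMem hs]
    exact zero_le

theorem markov {α : Type*} (p : PMF α) (s : Set α) (f : α → ℝ≥0∞) (r : ℝ≥0∞)
    (h0 : r ≠ 0) (ht : r ≠ ∞) (h : ∀ a ∈ p.support, a ∈ s → r ≤ f a) :
    p.toOuterMeasure s ≤ r⁻¹ * expect p f := by
  have : r⁻¹ * expect p f = expect p fun a => r⁻¹ * f a := by
    unfold expect
    rw [← ENNReal.tsum_mul_left]
    congr 1
    ext a
    ring
  rw [this]
  refine prob_le_expect p s _ fun a ha hs => ?_
  rw [← ENNReal.inv_mul_cancel h0 ht]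
  gcongr
  exact h a ha hs

/-- This chains the phases: a bad start is charged its own probability, and every other start fails
with probability at most `δ`. No independence between phases is needed. -/
theorem prob_bind_le {α β : Type*} (p : PMF α) (f : α → PMF β) (b : Set α) (s : Set β) (δ : ℝ≥0∞)
    (h : ∀ a ∈ p.support, a ∉ b → (f a).toOuterMeasure s ≤ δ) :
    (p.bind f).toOuterMeasure s ≤ p.toOuterMeasure b + δ := by
  rw [PMF.toOuterMeasure_bind_apply, PMF.toOuterMeasure_apply]
  calc ∑' a, p a * (f a).toOuterMeasure s ≤ ∑' a, (b.indicator p a + p a * δ) := by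
        refine ENNReal.tsum_le_tsum fun a => ?_
        by_cases hb : a ∈ b
        · rw [Set.indicator_of_mem hb]
          refine le_add_right ?_
          calc p a * (f a).toOuterMeasure s ≤ p a * 1 := by
                gcongr
                rw [← PMF.toOuterMeasure_apply_eq_one_iff (p := f a) (s := Set.univ) |>.2
                  (Set.subset_univ _)]
                exact (f a).toOuterMeasure.mono (Set.subset_univ _)
            _ = p a := mul_one _
        · refine le_add_left ?_
          by_cases ha : p a = 0
          · simp [ha]
          · gcongr
            exact h a ((PMF.mem_support_iff _ _).2 ha) hb
    _ = _ := by rw [ENNReal.tsum_add, ENNReal.tsum_mul_right, p.tsum_coe, one_mul]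

theorem prob_exists_le {α ι : Type*} [Fintype ι] (p : PMF α) (s : ι → Set α) (N : ℕ) (e : ℝ≥0∞)
    (hN : Fintype.card ι ≤ N) (h : ∀ i, p.toOuterMeasure (s i) ≤ e) :
    p.toOuterMeasure {a | ∃ i, a ∈ s i} ≤ N * e := by
  have : {a | ∃ i, a ∈ s i} = ⋃ i, s i := by ext; simp
  rw [this]
  calc _ ≤ ∑ i, p.toOuterMeasure (s i) := MeasureTheory.measure_iUnion_fintype_le _ _
    _ ≤ ∑ _i : ι, e := Finset.sum_le_sum fun i _ => h i
    _ = Fintype.card ι * e := by simp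
    _ ≤ _ := by gcongr

theorem prob_mono {α : Type*} (p : PMF α) {s t : Set α} (h : ∀ a ∈ p.support, a ∈ s → a ∈ t) :
    p.toOuterMeasure s ≤ p.toOuterMeasure t :=
  PMF.toOuterMeasure_mono p fun a ha => h a ha.2 ha.1

theorem prob_le_of_compl_le {α : Type*} (p : PMF α) (s : Set α) (ε : ℝ) (hε : 0 ≤ ε)
    (h : p.toOuterMeasure sᶜ ≤ ENNReal.ofReal ε) :
    ENNReal.ofReal (1 - ε) ≤ p.toOuterMeasure s := by
  have h1 : 1 ≤ p.toOuterMeasure s + p.toOuterMeasure sᶜ := by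
    rw [← PMF.toOuterMeasure_apply_eq_one_iff (p := p) (s := Set.univ) |>.2
      (Set.subset_univ _), ← Set.union_compl_self s]
    exact MeasureTheory.measure_union_le _ _
  rw [ENNReal.ofReal_sub _ hε, ENNReal.ofReal_one]
  exact tsub_le_iff_right.2 (h1.trans (by gcongr))

theorem iterate_invariant {α : Type*} (f : α → PMF α) (I : ℕ → α → Prop)
    (h : ∀ r a, I r a → ∀ b ∈ (f a).support, I (r + 1) b) (N : ℕ) :
    ∀ r a, I r a → ∀ b ∈ (iterate f N a).support, I (r + N) b := by
  induction N with
  | zero =>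
    intro r a ha b hb
    simp only [iterate, PMF.support_pure, Set.mem_singleton_iff] at hb
    exact hb ▸ ha
  | succ N ih =>
    intro r a ha b hb
    simp only [iterate, PMF.mem_support_bind_iff] at hb
    obtain ⟨a', h₁, h₂⟩ := hb
    have := ih (r + 1) a' (h r a ha a' h₁) b h₂
    rwa [add_assoc, add_comm 1 N] at this

/-- A supermartingale argument in which the index of `Φ` is the number of rounds still to come. -/
theorem expect_iterate_le {α : Type*} (f : α → PMF α) (Φ : ℕ → α → ℝ≥0∞)
    (h : ∀ r a, expect (f a) (Φ r) ≤ Φ (r + 1) a) (N : ℕ) :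
    ∀ a, expect (iterate f N a) (Φ 0) ≤ Φ N a := by
  induction N with
  | zero => intro a; simp [iterate, expect_pure]
  | succ N ih =>
    intro a
    simp only [iterate, expect_bind]
    exact (expect_mono _ fun b _ => ih b).trans (h N a)

/-! ### Random and ranking phases: what happens surely -/

section Draw

theorem Alive.mono {V : Type*} {N : ℕ} {F : Schedule V N} {u : V} {s t : ℕ} (h : Alive F u t)
    (hst : s ≤ t) : Alive F u s := fun r hr => h r (hr.trans hst)

variable {V : Type*} [Fintype V] [DecidableEq V] (G : SimpleGraph V) {N : ℕ} (F : Schedule V N)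

theorem mem_of_some_mem_support_draw {B : Finset V} {pos : V → ℕ} {m : V}
    (h : some m ∈ (draw B pos).support) : m ∈ B := by
  unfold draw at h
  split_ifs at h with hB
  · simp only [PMF.support_map, Set.mem_image, Option.some.injEq, exists_eq_right,
      PMF.mem_support_normalize_iff] at h
    by_contra hm
    simp [hm] at h
  · simp at h

open Classical in
/-- The invariants that hold at all times: the counters of a working node count the neighbours
that have sent a message, and only messages that were sent in round 0 are around. -/
structure Sound (c : Config V) : Prop where
  cnt : ∀ u, Alive F u c.time → ∀ v, (c.st u).cnt v =
    (if v = u then 1 else 0) + (Finset.univ.filter fun w => G.Adj u w ∧ v ∈ (c.st w).S).card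
  known : ∀ u, Alive F u c.time → ∀ w, G.Adj u w → (c.st w).S ⊆ (c.st u).R
  self : ∀ u, u ∈ (c.st u).R
  origin : ∀ u, Alive F u c.time → ∀ v ∈ (c.st u).R, Alive F v 0
  sent : ∀ u, ∀ v ∈ (c.st u).S, Alive F v 0
  own : ∀ u, Alive F u 0 → u ∈ (c.st u).S

/-- The relation between the start `c₀` of a random or ranking phase and a later configuration
of the same phase. -/
structure DrawInv (c₀ c : Config V) : Prop where
  sound : Sound G F c
  time_le : c₀.time ≤ c.time
  S_mono : ∀ u, (c₀.st u).S ⊆ (c.st u).S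
  S_le : ∀ u, ∀ v ∈ (c.st u).S, v ∈ (c₀.st u).S ∨ (Alive F u c₀.time ∧ v ∈ (c₀.st u).hatB)
  S_card : ∀ u, (c.st u).S.card + c₀.time ≤ (c₀.st u).S.card + c.time
  hatB_eq : ∀ u, (c.st u).hatB = (c₀.st u).hatB \ (c.st u).S
  pos_eq : ∀ u, (c.st u).pos = (c₀.st u).pos
  sel_eq : ∀ u, (c.st u).sel = (c₀.st u).sel
  R_mono : ∀ u, (c₀.st u).R ⊆ (c.st u).R
  R_le : ∀ u, ∀ v ∈ (c.st u).R, v ∈ (c₀.st u).R ∨ ∃ w, G.Adj u w ∧ v ∈ (c.st w).S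

/-- Here `out` is what is really transmitted, with failed nodes silent. All sure statements about a
draw round depend only on these properties. -/
theorem exists_out_of_mem_support_drawRound {c c' : Config V}
    (h : c' ∈ (drawRound G F c).support) :
    ∃ out : V → Option V,
      (∀ u m, out u = some m → Alive F u c.time ∧ m ∈ (c.st u).hatB) ∧
      c'.time = c.time + 1 ∧
      (∀ u, (c'.st u).S = (c.st u).S ∪ (out u).toFinset) ∧
      (∀ u, (c'.st u).hatB = (c.st u).hatB \ (out u).toFinset) ∧
      (∀ u, (c'.st u).pos = (c.st u).pos) ∧
      (∀ u, (c'.st u).sel = (c.st u).sel) ∧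
      (∀ u, (c.st u).R ⊆ (c'.st u).R) ∧
      (∀ u, ∀ v ∈ (c'.st u).R, v ∈ (c.st u).R ∨ ∃ w, G.Adj u w ∧ out w = some v) ∧
      (∀ u, Alive F u c.time →
        (∀ w v, G.Adj u w → out w = some v → v ∈ (c'.st u).R) ∧
        ∀ v, (c'.st u).cnt v = (c.st u).cnt v + received G out u v) := by
  classical
  simp only [drawRound, PMF.support_map, Set.mem_image] at h
  obtain ⟨msg, hmsg, rfl⟩ := h
  have hnone : ∀ u, ¬ Alive F u c.time →
      (if Alive F u c.time then msg u else none) = none := fun u hu => if_neg hu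
  refine ⟨fun w => if Alive F w c.time then msg w else none, ?_, rfl, ?_, ?_, ?_, ?_, ?_, ?_, ?_⟩
  · intro u m hu
    simp only at hu
    split_ifs at hu with ha
    exact ⟨ha, mem_of_some_mem_support_draw (hu ▸ mem_support_of_mem_support_pmfPi hmsg u)⟩
  all_goals intro u
  all_goals by_cases ha : Alive F u c.time
  all_goals simp [Config.round, NodeState.sync, ha]
  · intro v hv
    rcases hv with hv | hv
    · exact Or.inl hv
    · right
      simp only [received, Finset.card_pos] at hv
      obtain ⟨w, hw⟩ := hv
      simp only [Finset.mem_filter, Finset.mem_univ, true_and] at hw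
      exact ⟨w, hw.1, by simpa using hw.2⟩
  · exact fun v hv => Or.inl hv
  · intro w v hw hal hm
    right
    simp only [received, Finset.card_pos]
    exact ⟨w, by simp [hw, hal, hm]⟩

variable {G F}

theorem DrawInv.refl {c₀ : Config V} (h : Sound G F c₀)
    (hd : ∀ u, Disjoint (c₀.st u).hatB (c₀.st u).S) : DrawInv G F c₀ c₀ where
  sound := h
  time_le := le_rfl
  S_mono _ := subset_rfl
  S_le _ _ hv := Or.inl hv
  S_card _ := le_rfl
  hatB_eq u := (Finset.sdiff_eq_self_of_disjoint (hd u)).symm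
  pos_eq _ := rfl
  sel_eq _ := rfl
  R_mono _ := subset_rfl
  R_le _ _ hv := Or.inl hv

/-- The buffer always avoids the messages already sent, so outside shuffle phases no node sends a
message twice. This is why `cnt` counts senders and not merely transmissions. -/
theorem DrawInv.step {c₀ c c' : Config V}
    (hR : ∀ u, Alive F u c₀.time → (c₀.st u).hatB ⊆ (c₀.st u).R)
    (h : DrawInv G F c₀ c) (hc : c' ∈ (drawRound G F c).support) : DrawInv G F c₀ c' := by
  classical
  obtain ⟨out, hout, ht, hS, hB, hpos, hsel, hR0, hR1, hal⟩ :=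
    exists_out_of_mem_support_drawRound G F hc
  have hnew : ∀ u m, out u = some m →
      Alive F u c.time ∧ m ∈ (c₀.st u).hatB ∧ m ∉ (c.st u).S := by
    intro u m hm
    obtain ⟨h1, h2⟩ := hout u m hm
    rw [h.hatB_eq, Finset.mem_sdiff] at h2
    exact ⟨h1, h2⟩
  have horig : ∀ u m, out u = some m → Alive F m 0 := by
    intro u m hm
    obtain ⟨h1, h2, -⟩ := hnew u m hm
    exact h.sound.origin u h1 m (h.R_mono u (hR u (h1.mono h.time_le) h2))
  have hmemS : ∀ u v, v ∈ (c'.st u).S ↔ v ∈ (c.st u).S ∨ out u = some v := by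
    intro u v
    rw [hS, Finset.mem_union, Option.mem_toFinset, Option.mem_def]
  have hpast : ∀ u, Alive F u c'.time → Alive F u c.time := fun u hu => hu.mono (by omega)
  refine ⟨⟨?_, ?_, ?_, ?_, ?_, ?_⟩, ?_, ?_, ?_, ?_, ?_, ?_, ?_, ?_, ?_⟩
  · intro u hu v
    rw [(hal u (hpast u hu)).2 v, h.sound.cnt u (hpast u hu) v, add_assoc, received,
      ← Finset.card_union_of_disjoint]
    · congr 2
      ext w
      simp only [Finset.mem_union, Finset.mem_filter, Finset.mem_univ, true_and, hmemS]
      tauto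
    · rw [Finset.disjoint_left]
      intro w hw hw'
      simp only [Finset.mem_filter, Finset.mem_univ, true_and] at hw hw'
      exact (hnew w v hw'.2).2.2 hw.2
  · intro u hu w hw v hv
    rcases (hmemS w v).1 hv with hv | hv
    · exact hR0 u (h.sound.known u (hpast u hu) w hw hv)
    · exact (hal u (hpast u hu)).1 w v hw hv
  · exact fun u => hR0 u (h.sound.self u)
  · intro u hu v hv
    rcases hR1 u v hv with hv | ⟨w, -, hw⟩
    · exact h.sound.origin u (hpast u hu) v hv
    · exact horig w v hw
  · intro u v hv
    rcases (hmemS u v).1 hv with hv | hv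
    · exact h.sound.sent u v hv
    · exact horig u v hv
  · exact fun u hu => (hmemS u u).2 (Or.inl (h.sound.own u hu))
  · have := h.time_le
    omega
  · exact fun u v hv => (hmemS u v).2 (Or.inl (h.S_mono u hv))
  · intro u v hv
    rcases (hmemS u v).1 hv with hv | hv
    · exact h.S_le u v hv
    · obtain ⟨h1, h2, -⟩ := hnew u v hv
      exact Or.inr ⟨h1.mono h.time_le, h2⟩
  · intro u
    have h1 := Finset.card_union_le (c.st u).S (out u).toFinset
    have h2 : (out u).toFinset.card ≤ 1 := by
      rw [Option.card_toFinset]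
      cases out u <;> simp
    have h3 := h.S_card u
    rw [hS]
    omega
  · intro u
    rw [hB, hS, h.hatB_eq, sdiff_sdiff_left]
    rfl
  · exact fun u => (hpos u).trans (h.pos_eq u)
  · exact fun u => (hsel u).trans (h.sel_eq u)
  · exact fun u => (h.R_mono u).trans (hR0 u)
  · intro u v hv
    rcases hR1 u v hv with hv | ⟨w, hw, hv⟩
    · rcases h.R_le u v hv with hv | ⟨w, hw, hv⟩
      · exact Or.inl hv
      · exact Or.inr ⟨w, hw, (hmemS w v).2 (Or.inl hv)⟩
    · exact Or.inr ⟨w, hw, (hmemS w v).2 (Or.inr hv)⟩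

theorem drawInv_of_mem_support {c₀ c : Config V} {r : ℕ} (h : Sound G F c₀)
    (hd : ∀ u, Disjoint (c₀.st u).hatB (c₀.st u).S)
    (hR : ∀ u, Alive F u c₀.time → (c₀.st u).hatB ⊆ (c₀.st u).R)
    (hc : c ∈ (iterate (drawRound G F) r c₀).support) : DrawInv G F c₀ c :=
  iterate_invariant (drawRound G F) (fun _ a => DrawInv G F c₀ a)
    (fun _ _ ha _ hb => ha.step hR hb) r 0 c₀ (DrawInv.refl h hd) c hc

end Draw

/-! ### Random and ranking phases: potentials -/

section Potential

variable {V : Type*} [Fintype V] [DecidableEq V] (G : SimpleGraph V) {N : ℕ} (F : Schedule V N)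

theorem draw_apply_some {B : Finset V} (pos : V → ℕ) {v : V} (hv : v ∈ B) :
    draw B pos (some v) =
      ((pos v + 1 : ℕ) : ℝ≥0∞)⁻¹ * (∑ m ∈ B, ((pos m + 1 : ℕ) : ℝ≥0∞)⁻¹)⁻¹ := by
  classical
  rw [draw, dif_pos ⟨v, hv⟩, PMF.map_apply, tsum_eq_single v]
  · rw [if_pos rfl, PMF.normalize_apply, if_pos hv, tsum_fintype, Finset.sum_ite_mem,
      Finset.univ_inter]
  · intro m hm
    rw [if_neg]
    simpa using hm.symm

theorem expect_ne_some {V : Type*} [DecidableEq V] (p : PMF (Option V)) (v : V) :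
    expect p (fun o => if o = some v then 0 else 1) = 1 - p (some v) := by
  have h : expect p (fun o => if o = some v then 0 else 1) + p (some v) = 1 := by
    have h1 : p (some v) = ∑' o, if o = some v then p o else 0 := by
      rw [tsum_ite_eq]
    rw [h1, expect, ← ENNReal.tsum_add]
    conv_rhs => rw [← p.tsum_coe]
    congr 1
    ext o
    split_ifs <;> simp
  exact ENNReal.eq_sub_of_add_eq (p.apply_ne_top _) h

/-- Receptions never touch `hatB` or `pos`, and a node's buffer depends only on its own draw. So a
product of functions of these local data integrates factor by factor. -/
theorem expect_drawRound_prod_le (φ φ' : V → Finset V → (V → ℕ) → ℝ≥0∞) (c : Config V)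
    (halive : ∀ u, Alive F u c.time →
      expect (draw (c.st u).hatB (c.st u).pos)
        (fun o => φ u ((c.st u).hatB \ o.toFinset) (c.st u).pos)
        ≤ φ' u (c.st u).hatB (c.st u).pos)
    (hdead : ∀ u, ¬ Alive F u c.time →
      φ u (c.st u).hatB (c.st u).pos ≤ φ' u (c.st u).hatB (c.st u).pos) :
    expect (drawRound G F c) (fun c' => ∏ u, φ u (c'.st u).hatB (c'.st u).pos)
      ≤ ∏ u, φ' u (c.st u).hatB (c.st u).pos := by
  classical
  rw [drawRound, expect_map]
  have : (fun msg : V → Option V => ∏ u,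
      φ u ((c.round F (NodeState.sync G) msg).st u).hatB
        ((c.round F (NodeState.sync G) msg).st u).pos) =
      fun msg => ∏ u, (fun u (o : Option V) => if Alive F u c.time then
        φ u ((c.st u).hatB \ o.toFinset) (c.st u).pos else φ u (c.st u).hatB (c.st u).pos)
          u (msg u) := by
    ext msg
    refine Finset.prod_congr rfl fun u _ => ?_
    by_cases h : Alive F u c.time <;> simp [Config.round, NodeState.sync, h]
  rw [this]
  refine (expect_pmfPi_prod _ (fun u (o : Option V) => if Alive F u c.time then
        φ u ((c.st u).hatB \ o.toFinset) (c.st u).pos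
      else φ u (c.st u).hatB (c.st u).pos)).le.trans ?_
  refine Finset.prod_le_prod' fun u _ => ?_
  by_cases h : Alive F u c.time
  · simpa only [if_pos h] using halive u h
  · simpa only [if_neg h, expect_const] using hdead u h

theorem expect_draws_prod_le (φ : ℕ → V → Finset V → (V → ℕ) → ℝ≥0∞)
    (halive : ∀ r u B pos,
      expect (draw B pos) (fun o => φ r u (B \ o.toFinset) pos) ≤ φ (r + 1) u B pos)
    (hdead : ∀ r u B pos, ¬ (∀ t, Alive F u t) → φ r u B pos ≤ φ (r + 1) u B pos)
    (r : ℕ) (c : Config V) :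
    expect (iterate (drawRound G F) r c) (fun c' => ∏ u, φ 0 u (c'.st u).hatB (c'.st u).pos)
      ≤ ∏ u, φ r u (c.st u).hatB (c.st u).pos :=
  expect_iterate_le (drawRound G F)
    (fun r c' => ∏ u, φ r u (c'.st u).hatB (c'.st u).pos)
    (fun r c' => expect_drawRound_prod_le G F _ _ c' (fun u _ => halive r u _ _)
      fun u hu => hdead r u _ _ fun h => hu (h _)) r c

/-- The buffers of the nodes of `K` rarely keep their targets. -/
theorem expect_draws_lower (K : Finset V) (hK : ∀ u ∈ K, ∀ t, Alive F u t) (v : V → V)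
    (L H w w' : ℝ≥0∞) (hw : w + w' = 1) (r : ℕ) (c : Config V)
    (hv : ∀ u ∈ K, v u ∈ (c.st u).hatB ∧ (((c.st u).pos (v u) + 1 : ℕ) : ℝ≥0∞) ≤ L ∧
      ∑ m ∈ (c.st u).hatB, (((c.st u).pos m + 1 : ℕ) : ℝ≥0∞)⁻¹ ≤ H) :
    expect (iterate (drawRound G F) r c)
        (fun c' => ∏ u ∈ K, if v u ∈ (c'.st u).hatB then 1 else w)
      ≤ (w + w' * (1 - L⁻¹ * H⁻¹) ^ r) ^ K.card := by
  classical
  set θ := 1 - L⁻¹ * H⁻¹ with hθ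
  have hθ1 : θ ≤ 1 := tsub_le_self
  -- With `r` rounds left, a remaining target stays for all of them with probability at most `θ ^
  -- r`. The value `⊤` where the bounds fail makes the one-round inequality trivial there. The
  -- bounds themselves persist, since removing a message only lowers the total weight.
  let φ : ℕ → V → Finset V → (V → ℕ) → ℝ≥0∞ := fun r u B pos =>
    if u ∈ K then
      if v u ∈ B then
        if ((pos (v u) + 1 : ℕ) : ℝ≥0∞) ≤ L ∧ ∑ m ∈ B, ((pos m + 1 : ℕ) : ℝ≥0∞)⁻¹ ≤ H then
          w + w' * θ ^ r
        else ⊤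
      else w
    else 1
  have key := expect_draws_prod_le G F φ ?_ ?_ r c
  · calc _ ≤ expect (iterate (drawRound G F) r c)
          (fun c' => ∏ u, φ 0 u (c'.st u).hatB (c'.st u).pos) := by
          refine expect_mono _ fun c' _ => ?_
          rw [← Finset.prod_subset (Finset.subset_univ K)]
          · refine Finset.prod_le_prod' fun u hu => ?_
            simp only [φ, if_pos hu, pow_zero, mul_one, hw]
            split_ifs <;> simp
          · intro u _ hu
            simp [φ, hu]
      _ ≤ _ := key
      _ = _ := by
          rw [← Finset.prod_subset (Finset.subset_univ K), ← Finset.prod_const]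
          · refine Finset.prod_congr rfl fun u hu => ?_
            obtain ⟨h1, h2, h3⟩ := hv u hu
            simp only [φ, if_pos hu, if_pos h1, if_pos (And.intro h2 h3)]
          · intro u _ hu
            simp [φ, hu]
  · intro r u B pos
    by_cases hu : u ∈ K
    swap
    · simp [φ, hu, expect_const]
    by_cases hB : v u ∈ B
    swap
    · simp [φ, hu, hB, expect_const]
    by_cases hc : ((pos (v u) + 1 : ℕ) : ℝ≥0∞) ≤ L ∧ ∑ m ∈ B, ((pos m + 1 : ℕ) : ℝ≥0∞)⁻¹ ≤ H
    swap
    · simp only [φ, if_pos hu, if_pos hB, if_neg hc]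
      exact le_top
    have h1 : ∀ o, φ r u (B \ o.toFinset) pos ≤
        w + w' * θ ^ r * (if o = some (v u) then 0 else 1) := by
      intro o
      by_cases ho : o = some (v u)
      · simp [φ, hu, ho]
      · have hB' : v u ∈ B \ o.toFinset := by
          simp only [Finset.mem_sdiff, Option.mem_toFinset, Option.mem_def]
          exact ⟨hB, ho⟩
        have hc' : ∑ m ∈ B \ o.toFinset, ((pos m + 1 : ℕ) : ℝ≥0∞)⁻¹ ≤ H :=
          (Finset.sum_le_sum_of_subset Finset.sdiff_subset).trans hc.2
        simp only [φ, if_pos hu, if_pos hB', if_neg ho, if_pos (And.intro hc.1 hc'), mul_one]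
        exact le_rfl
    have h2 : draw B pos (some (v u)) ≥ L⁻¹ * H⁻¹ := by
      rw [draw_apply_some pos hB]
      exact mul_le_mul' (ENNReal.inv_le_inv.2 hc.1) (ENNReal.inv_le_inv.2 hc.2)
    calc _ ≤ expect (draw B pos)
          (fun o => w + w' * θ ^ r * (if o = some (v u) then 0 else 1)) :=
          expect_mono _ fun o _ => h1 o
      _ = w + w' * θ ^ r * (1 - draw B pos (some (v u))) := by
          rw [← expect_ne_some]
          unfold expect
          simp only [mul_add, mul_left_comm (draw B pos _) (w' * θ ^ r)]
          rw [ENNReal.tsum_add, ENNReal.tsum_mul_right, ENNReal.tsum_mul_left, PMF.tsum_coe,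
            one_mul]
      _ ≤ w + w' * θ ^ r * θ := by
          gcongr
          exact tsub_le_tsub_left h2 1
      _ = _ := by
          simp only [φ, if_pos hu, if_pos hB, if_pos hc]
          ring
  · intro r u B pos hd
    have hu : u ∉ K := fun hu => hd (hK u hu)
    simp [φ, hu]

/-- With uniform weights, each target is rarely drawn from a large buffer. -/
theorem expect_draws_upper (K : Finset V) (v : V → V) (r : ℕ) (c : Config V)
    (hv : ∀ u ∈ K, v u ∈ (c.st u).hatB ∧ (c.st u).pos = fun _ => 0) :
    expect (iterate (drawRound G F) r c)
        (fun c' => ∏ u ∈ K, if v u ∈ (c'.st u).hatB then 1 else 2)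
      ≤ ∏ u ∈ K, (1 + r * ((c.st u).hatB.card : ℝ≥0∞)⁻¹) := by
  classical
  -- A fixed message among `b` is hit by `r` uniform draws without replacement with probability at
  -- most `r / b`. The recursion closes because `(1 - 1/(b+1)) · r/b ≤ r/(b+1)`.
  let φ : ℕ → V → Finset V → (V → ℕ) → ℝ≥0∞ := fun r u B pos =>
    if u ∈ K then
      if v u ∈ B then if pos = fun _ => 0 then 1 + r * (B.card : ℝ≥0∞)⁻¹ else ⊤ else 2
    else 1
  have key := expect_draws_prod_le G F φ ?_ ?_ r c
  · calc _ ≤ expect (iterate (drawRound G F) r c)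
          (fun c' => ∏ u, φ 0 u (c'.st u).hatB (c'.st u).pos) := by
          refine expect_mono _ fun c' _ => ?_
          rw [← Finset.prod_subset (Finset.subset_univ K)]
          · refine Finset.prod_le_prod' fun u hu => ?_
            simp only [φ, if_pos hu, Nat.cast_zero, zero_mul, add_zero]
            split_ifs <;> simp
          · intro u _ hu
            simp [φ, hu]
      _ ≤ _ := key
      _ = _ := by
          rw [← Finset.prod_subset (Finset.subset_univ K)]
          · refine Finset.prod_congr rfl fun u hu => ?_
            obtain ⟨h1, h2⟩ := hv u hu
            simp only [φ, if_pos hu, if_pos h1, if_pos h2]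
          · intro u _ hu
            simp [φ, hu]
  · intro r u B pos
    by_cases hu : u ∈ K
    swap
    · simp [φ, hu, expect_const]
    by_cases hB : v u ∈ B
    swap
    · simp [φ, hu, hB, expect_const]
    by_cases hc : pos = fun _ => 0
    swap
    · simp only [φ, if_pos hu, if_pos hB, if_neg hc]
      exact le_top
    obtain ⟨b, hb⟩ : ∃ b, B.card = b + 1 :=
      ⟨B.card - 1, (Nat.succ_pred_eq_of_pos (Finset.card_pos.2 ⟨_, hB⟩)).symm⟩
    have hp : draw B pos (some (v u)) = ((b + 1 : ℕ) : ℝ≥0∞)⁻¹ := by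
      rw [draw_apply_some pos hB]
      simp [hc, hb]
    have hsub : 1 - ((b + 1 : ℕ) : ℝ≥0∞)⁻¹ = b * ((b + 1 : ℕ) : ℝ≥0∞)⁻¹ := by
      refine ENNReal.sub_eq_of_eq_add_rev ?_ ?_
      · simp
      · rw [← one_add_mul, ← Nat.cast_one, ← Nat.cast_add, Nat.add_comm,
          ENNReal.mul_inv_cancel] <;> simp
    have h1 : ∀ o ∈ (draw B pos).support, φ r u (B \ o.toFinset) pos ≤
        (if o = some (v u) then 1 else 0) + 1 +
          (r * (b : ℝ≥0∞)⁻¹) * (if o = some (v u) then 0 else 1) := by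
      intro o hos
      by_cases ho : o = some (v u)
      · simp [φ, hu, ho, one_add_one_eq_two]
      · have hB' : v u ∈ B \ o.toFinset := by
          simp only [Finset.mem_sdiff, Option.mem_toFinset, Option.mem_def]
          exact ⟨hB, ho⟩
        have hcard : b ≤ (B \ o.toFinset).card := by
          have h2 : o.toFinset.card ≤ 1 := by
            rw [Option.card_toFinset]
            cases o <;> simp
          have := Finset.le_card_sdiff o.toFinset B
          omega
        simp only [φ, if_pos hu, if_pos hB', if_neg ho, if_pos hc, mul_one, zero_add]
        gcongr
    calc _ ≤ expect (draw B pos) (fun o => (if o = some (v u) then 1 else 0) + 1 +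
          (r * (b : ℝ≥0∞)⁻¹) * (if o = some (v u) then 0 else 1)) :=
          expect_mono _ h1
      _ = draw B pos (some (v u)) + 1 + r * (b : ℝ≥0∞)⁻¹ * (1 - draw B pos (some (v u))) := by
          rw [← expect_ne_some]
          unfold expect
          simp only [mul_add, mul_ite, mul_one, mul_zero]
          rw [ENNReal.tsum_add, ENNReal.tsum_add, PMF.tsum_coe, tsum_ite_eq,
            ← ENNReal.tsum_mul_left]
          simp only [mul_ite, mul_zero, mul_comm]
      _ ≤ 1 + (r + 1 : ℕ) * ((b + 1 : ℕ) : ℝ≥0∞)⁻¹ := by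
          rw [hp, hsub]
          have : (r : ℝ≥0∞) * (b : ℝ≥0∞)⁻¹ * (b * ((b + 1 : ℕ) : ℝ≥0∞)⁻¹) ≤
              r * ((b + 1 : ℕ) : ℝ≥0∞)⁻¹ := by
            rw [mul_assoc, ← mul_assoc (b : ℝ≥0∞)⁻¹]
            gcongr
            calc _ ≤ 1 * ((b + 1 : ℕ) : ℝ≥0∞)⁻¹ := by
                  gcongr
                  exact ENNReal.inv_mul_le_one _
              _ = _ := one_mul _
          calc _ ≤ ((b + 1 : ℕ) : ℝ≥0∞)⁻¹ + 1 + r * ((b + 1 : ℕ) : ℝ≥0∞)⁻¹ := by gcongr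
            _ = _ := by push_cast; ring
      _ = _ := by
          simp only [φ, if_pos hu, if_pos hB, if_pos hc, hb]
  -- A failed node keeps its buffer, and the potential grows with the number of remaining rounds.
  · intro r u B pos _
    simp only [φ]
    split_ifs
    · gcongr
      simp
    all_goals exact le_rfl

end Potential

/-! ### Tail bounds -/

section Tails

/-- At least `s` indices satisfy `q`. -/
def AtLeast {ι : Type*} (s : ℕ) (q : ι → Prop) : Prop :=
  ∃ D : Finset ι, s ≤ D.card ∧ ∀ i ∈ D, q i

theorem AtLeast.mono {ι : Type*} {s : ℕ} {q q' : ι → Prop} (h : AtLeast s q)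
    (hq : ∀ i, q i → q' i) : AtLeast s q' := by
  obtain ⟨D, hs, hD⟩ := h
  exact ⟨D, hs, fun i hi => hq i (hD i hi)⟩

theorem AtLeast.map {ι κ : Type*} {s : ℕ} {q : ι → Prop} {q' : κ → Prop} (h : AtLeast s q)
    (f : ι → κ) (hf : ∀ i j, q i → q j → f i = f j → i = j) (hq : ∀ i, q i → q' (f i)) :
    AtLeast s q' := by
  classical
  obtain ⟨D, hs, hD⟩ := h
  refine ⟨D.image f, ?_, fun i hi => ?_⟩
  · rwa [Finset.card_image_of_injOn fun i hi j hj => hf i j (hD i hi) (hD j hj)]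
  · obtain ⟨j, hj, rfl⟩ := Finset.mem_image.1 hi
    exact hq j (hD j hj)

theorem atLeast_mem_iff {ι : Type*} {s : ℕ} {K : Finset ι} {q : ι → Prop} [DecidablePred q] :
    AtLeast s (fun i => i ∈ K ∧ q i) ↔ s ≤ (K.filter q).card := by
  constructor
  · rintro ⟨D, hs, hD⟩
    exact hs.trans (Finset.card_le_card fun i hi => Finset.mem_filter.2 (hD i hi))
  · exact fun h => ⟨_, h, fun i hi => Finset.mem_filter.1 hi⟩

theorem toOuterMeasure_eq_expect {α : Type*} (p : PMF α) (s : Set α) [DecidablePred (· ∈ s)] :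
    p.toOuterMeasure s = expect p fun a => if a ∈ s then 1 else 0 := by
  rw [PMF.toOuterMeasure_apply, expect]
  congr 1
  ext a
  by_cases h : a ∈ s <;> simp [h]

theorem prod_ite_two {ι : Type*} (K : Finset ι) (q : ι → Prop) [DecidablePred q] :
    ∏ i ∈ K, (if q i then 2 else 1 : ℝ≥0∞) = 2 ^ (K.filter q).card := by
  rw [Finset.prod_ite, Finset.prod_const, Finset.prod_const_one, mul_one]

theorem prod_ite_half {ι : Type*} (K : Finset ι) (q : ι → Prop) [DecidablePred q] :
    ∏ i ∈ K, (if q i then 2⁻¹ else 1 : ℝ≥0∞) = (2 ^ (K.filter q).card)⁻¹ := by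
  rw [Finset.prod_ite, Finset.prod_const, Finset.prod_const_one, mul_one, ENNReal.inv_pow]

-- Markov's inequality for `2 ^ (-count)`; the product form is what the potentials bound.
open Classical in
theorem prob_not_atLeast {α ι : Type*} (p : PMF α) (K : Finset ι) (q : ι → α → Prop) (s : ℕ) :
    p.toOuterMeasure {a | ¬ AtLeast s fun i => i ∈ K ∧ q i a} ≤
      2 ^ s * expect p fun a => ∏ i ∈ K, if q i a then 2⁻¹ else 1 := by
  have := markov p {a | ¬ AtLeast s fun i => i ∈ K ∧ q i a}
    (fun a => ∏ i ∈ K, if q i a then 2⁻¹ else 1) (2 ^ s)⁻¹ (by simp) (by simp) ?_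
  · simpa only [inv_inv] using this
  · intro a _ ha
    have ha : ¬ AtLeast s fun i => i ∈ K ∧ q i a := ha
    rw [atLeast_mem_iff, not_le] at ha
    rw [prod_ite_half K (fun i => q i a)]
    exact ENNReal.inv_le_inv.2 (pow_le_pow_right₀ (by norm_num) ha.le)

-- Markov's inequality for `2 ^ count`.
open Classical in
theorem prob_atLeast {α ι : Type*} (p : PMF α) (K : Finset ι) (q : ι → α → Prop) (s : ℕ) :
    p.toOuterMeasure {a | AtLeast s fun i => i ∈ K ∧ q i a} ≤
      (2 ^ s)⁻¹ * expect p fun a => ∏ i ∈ K, if q i a then 2 else 1 := by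
  refine markov p _ (fun a => ∏ i ∈ K, if q i a then 2 else 1) (2 ^ s) (by simp) (by simp) ?_
  intro a _ ha
  have ha : AtLeast s fun i => i ∈ K ∧ q i a := ha
  rw [atLeast_mem_iff] at ha
  rw [prod_ite_two K (fun i => q i a)]
  exact pow_le_pow_right₀ (by norm_num) ha

theorem prob_pmfPi_not_atLeast {ι β : Type*} [Fintype ι] [DecidableEq ι] [Fintype β] (p : ι → PMF β)
    (K : Finset ι) (E : ι → Set β) (θ : ℝ≥0∞)
    (h : ∀ i ∈ K, (p i).toOuterMeasure (E i)ᶜ ≤ θ) (s : ℕ) :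
    (pmfPi p).toOuterMeasure {x | ¬ AtLeast s fun i => i ∈ K ∧ x i ∈ E i} ≤
      2 ^ s * (2⁻¹ + 2⁻¹ * θ) ^ K.card := by
  classical
  refine (prob_not_atLeast (pmfPi p) K (fun i x => x i ∈ E i) s).trans ?_
  gcongr
  have : (fun x : ι → β => ∏ i ∈ K, if x i ∈ E i then (2⁻¹ : ℝ≥0∞) else 1) =
      fun x => ∏ i, (fun i (b : β) => if i ∈ K then if b ∈ E i then (2⁻¹ : ℝ≥0∞) else 1 else 1)
        i (x i) := by
    ext x
    simp only [Finset.prod_ite_mem, Finset.univ_inter]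
  rw [this]
  refine (expect_pmfPi_prod p (fun i (b : β) =>
    if i ∈ K then if b ∈ E i then (2⁻¹ : ℝ≥0∞) else 1 else 1)).le.trans ?_
  rw [← Finset.prod_subset (Finset.subset_univ K), ← Finset.prod_const]
  · refine Finset.prod_le_prod' fun i hi => ?_
    have h1 := h i hi
    rw [toOuterMeasure_eq_expect] at h1
    calc expect (p i) (fun b => if i ∈ K then if b ∈ E i then (2⁻¹ : ℝ≥0∞) else 1 else 1)
        = expect (p i) (fun b => 2⁻¹ + 2⁻¹ * if b ∈ (E i)ᶜ then 1 else 0) := by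
          congr 1
          ext b
          by_cases hb : b ∈ E i <;> simp [hi, hb, ENNReal.inv_two_add_inv_two]
      _ = 2⁻¹ + 2⁻¹ * expect (p i) (fun b => if b ∈ (E i)ᶜ then 1 else 0) := by
          unfold expect
          simp only [mul_add, mul_left_comm _ (2⁻¹ : ℝ≥0∞)]
          rw [ENNReal.tsum_add, ENNReal.tsum_mul_right, PMF.tsum_coe, one_mul,
            ENNReal.tsum_mul_left]
      _ ≤ _ := by gcongr
  · intro i _ hi
    simp [hi, expect_const]

theorem prob_pmfPi_atLeast {ι β : Type*} [Fintype ι] [DecidableEq ι] [Fintype β] (p : ι → PMF β)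
    (K : Finset ι) (E : ι → Set β) (θ : ℝ≥0∞)
    (h : ∀ i ∈ K, (p i).toOuterMeasure (E i) ≤ θ) (s : ℕ) :
    (pmfPi p).toOuterMeasure {x | AtLeast s fun i => i ∈ K ∧ x i ∈ E i} ≤
      (2 ^ s)⁻¹ * (1 + θ) ^ K.card := by
  classical
  refine (prob_atLeast (pmfPi p) K (fun i x => x i ∈ E i) s).trans ?_
  gcongr
  have : (fun x : ι → β => ∏ i ∈ K, if x i ∈ E i then (2 : ℝ≥0∞) else 1) =
      fun x => ∏ i, (fun i (b : β) => if i ∈ K then if b ∈ E i then (2 : ℝ≥0∞) else 1 else 1)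
        i (x i) := by
    ext x
    simp only [Finset.prod_ite_mem, Finset.univ_inter]
  rw [this]
  refine (expect_pmfPi_prod p (fun i (b : β) =>
    if i ∈ K then if b ∈ E i then (2 : ℝ≥0∞) else 1 else 1)).le.trans ?_
  rw [← Finset.prod_subset (Finset.subset_univ K), ← Finset.prod_const]
  · refine Finset.prod_le_prod' fun i hi => ?_
    have h1 := h i hi
    rw [toOuterMeasure_eq_expect] at h1
    calc expect (p i) (fun b => if i ∈ K then if b ∈ E i then (2 : ℝ≥0∞) else 1 else 1)
        = expect (p i) (fun b => 1 + if b ∈ E i then 1 else 0) := by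
          congr 1
          ext b
          by_cases hb : b ∈ E i <;> simp [hi, hb, one_add_one_eq_two]
      _ = 1 + expect (p i) (fun b => if b ∈ E i then 1 else 0) := by
          unfold expect
          simp only [mul_add, mul_one]
          rw [ENNReal.tsum_add, PMF.tsum_coe]
      _ ≤ _ := by gcongr
  · intro i _ hi
    simp [hi, expect_const]

theorem prob_pmfPi_coord {ι β : Type*} [Fintype ι] [DecidableEq ι] [Fintype β] (p : ι → PMF β)
    (i : ι) (E : Set β) :
    (pmfPi p).toOuterMeasure {x | x i ∈ E} = (p i).toOuterMeasure E := by
  classical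
  rw [toOuterMeasure_eq_expect, toOuterMeasure_eq_expect]
  have : (fun x : ι → β => if x ∈ {x : ι → β | x i ∈ E} then (1 : ℝ≥0∞) else 0) =
      fun x => ∏ j, (fun j (b : β) => if j = i then if b ∈ E then (1 : ℝ≥0∞) else 0 else 1)
        j (x j) := by
    ext x
    rw [Finset.prod_eq_single i]
    · simp
    · intro j _ hj
      simp [hj]
    · simp
  rw [this]
  refine (expect_pmfPi_prod p (fun j (b : β) =>
    if j = i then if b ∈ E then (1 : ℝ≥0∞) else 0 else 1)).trans ?_
  rw [Finset.prod_eq_single i]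
  · simp
  · intro j _ hj
    simp [hj, expect_const]
  · simp

/-- Most nodes of a large set survive. -/
theorem prob_many_failures {V : Type*} [Fintype V] [DecidableEq V] (q : unitInterval) (N : ℕ)
    (θ : ℝ≥0∞) (hθ : N * ENNReal.ofReal q ≤ θ) (K : Finset V) (s : ℕ) :
    (failures V q N).toOuterMeasure {F | AtLeast s fun u => u ∈ K ∧ ∃ t, F u t = true} ≤
      (2 ^ s)⁻¹ * (1 + θ) ^ K.card := by
  classical
  refine le_trans ?_ (prob_pmfPi_atLeast (fun _ : V => pmfPi fun _ : Fin N => coin q) K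
    (fun _ => {x | ∃ t, x ∈ {x | x t ∈ ({true} : Set Bool)}}) θ ?_ s)
  · exact prob_mono _ fun F _ hF => AtLeast.mono hF fun u hu => hu
  · intro i _
    refine (prob_exists_le _ _ N (ENNReal.ofReal q) (by simp) fun t => ?_).trans hθ
    rw [prob_pmfPi_coord]
    refine le_of_eq ?_
    rw [PMF.toOuterMeasure_apply_singleton]
    rfl

/-- The sets that avoid `v` are the `s`-subsets of `Q.erase v`, and `C(q, s) / C(q+1, s) =
(q+1-s)/(q+1)`. -/
theorem prob_notMem_uniform_powersetCard {V : Type*} [DecidableEq V] (Q : Finset V) (s : ℕ)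
    (hs : s ≤ Q.card) {v : V} (hv : v ∈ Q) :
    (PMF.uniformOfFinset (Q.powersetCard s) (Finset.powersetCard_nonempty.2 hs)).toOuterMeasure
      {A | v ∈ A}ᶜ = 1 - s / Q.card := by
  classical
  have hcard : 0 < Q.card := Finset.card_pos.2 ⟨v, hv⟩
  obtain ⟨q, hq⟩ : ∃ q, Q.card = q + 1 := ⟨Q.card - 1, by omega⟩
  have hfil : ((Q.powersetCard s).filter fun A => A ∈ ({A | v ∈ A}ᶜ : Set (Finset V))) =
      (Q.erase v).powersetCard s := by
    ext A
    simp only [Finset.mem_filter, Finset.mem_powersetCard, Set.mem_compl_iff, Set.mem_ofPred_eq,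
      Finset.subset_erase]
    tauto
  have hch : (q.choose s : ℝ≥0∞) * (q + 1 : ℕ) = ((q + 1).choose s) * (q + 1 - s : ℕ) := by
    exact_mod_cast Nat.choose_mul_succ_eq q s
  have h0 : (((q + 1).choose s : ℕ) : ℝ≥0∞) ≠ 0 := by
    exact_mod_cast (Nat.choose_pos (hq ▸ hs)).ne'
  have h1 : (((q + 1 : ℕ)) : ℝ≥0∞) ≠ 0 := by exact_mod_cast Nat.succ_ne_zero q
  rw [PMF.toOuterMeasure_uniformOfFinset_apply]
  have : (Finset.filter (· ∈ ({A | v ∈ A}ᶜ : Set (Finset V))) (Q.powersetCard s)) =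
      (Q.erase v).powersetCard s := by
    rw [← hfil]
  calc _ = (((q + 1 - s : ℕ) : ℝ≥0∞)) / (q + 1 : ℕ) := by
        convert_to ((((Q.erase v).powersetCard s).card : ℝ≥0∞)) / (Q.powersetCard s).card = _
        · rw [← hfil]
          congr!
        rw [Finset.card_powersetCard, Finset.card_powersetCard, Finset.card_erase_of_mem hv, hq,
          Nat.add_sub_cancel, ENNReal.div_eq_div_iff h1 (by simp) h0 (by simp), mul_comm, hch,
          mul_comm]
    _ = _ := by
        rw [hq, ENNReal.natCast_sub, ENNReal.sub_div (by simp), ENNReal.div_self h1 (by simp)]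

/-- A node selects `v` surely if at most `4τ` messages pass its filter, and otherwise with
probability `4τ / |Q_u| ≥ 4τ / M`, independently of the other nodes. -/
theorem prob_few_selected {V : Type*} [Fintype V] [DecidableEq V] (P : Params)
    (st : V → NodeState V) (K : Finset V) (v : V) (M : ℕ)
    (hK : ∀ u ∈ K, v ∈ (st u).filtered P ∧ ((st u).filtered P).card ≤ M) (s : ℕ) :
    (pmfPi fun u => selection P (st u)).toOuterMeasure
        {A | ¬ AtLeast s fun u => u ∈ K ∧ v ∈ A u} ≤
      2 ^ s * (2⁻¹ + 2⁻¹ * (1 - (4 * P.tau : ℕ) / M)) ^ K.card := by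
  refine prob_pmfPi_not_atLeast _ K (fun _ => {A | v ∈ A}) _ (fun u hu => ?_) s
  obtain ⟨h1, h2⟩ := hK u hu
  rw [selection, prob_notMem_uniform_powersetCard _ _ (min_le_right _ _) h1]
  have hpos : 0 < ((st u).filtered P).card := Finset.card_pos.2 ⟨v, h1⟩
  rcases le_total (4 * P.tau) ((st u).filtered P).card with h | h
  · rw [min_eq_left h]
    refine tsub_le_tsub_left ?_ 1
    gcongr
  · rw [min_eq_right h, ENNReal.div_self (by exact_mod_cast hpos.ne') (by simp), tsub_self]
    exact zero_le

variable {V : Type*} [Fintype V] [DecidableEq V] (G : SimpleGraph V) {N : ℕ} (F : Schedule V N)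

/-- `L` bounds the rank of `v` and `H` the total weight, so each round draws a remaining `v` with
probability at least `1/(LH)`. The weight `w = 1/2` yields the moment needed for the lower tail. -/
theorem prob_few_draws (K : Finset V) (hK : ∀ u ∈ K, ∀ t, Alive F u t) (v : V)
    (L H : ℝ≥0∞) (r : ℕ) (c : Config V)
    (hv : ∀ u ∈ K, v ∈ (c.st u).hatB ∧ (((c.st u).pos v + 1 : ℕ) : ℝ≥0∞) ≤ L ∧
      ∑ m ∈ (c.st u).hatB, (((c.st u).pos m + 1 : ℕ) : ℝ≥0∞)⁻¹ ≤ H) (s : ℕ) :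
    (iterate (drawRound G F) r c).toOuterMeasure
        {c' | ¬ AtLeast s fun u => u ∈ K ∧ v ∉ (c'.st u).hatB} ≤
      2 ^ s * (2⁻¹ + 2⁻¹ * (1 - L⁻¹ * H⁻¹) ^ r) ^ K.card := by
  refine (prob_not_atLeast _ K (fun u (c' : Config V) => v ∉ (c'.st u).hatB) s).trans ?_
  gcongr
  refine le_trans (le_of_eq ?_) (expect_draws_lower G F K hK (fun _ => v) L H 2⁻¹ 2⁻¹
    ENNReal.inv_two_add_inv_two r c hv)
  congr 1
  ext c'
  refine Finset.prod_congr rfl fun u _ => ?_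
  by_cases h : v ∈ (c'.st u).hatB <;> simp [h]

/-- The same potential with a single node and `w = 0`, where the moment is the probability itself.
-/
theorem prob_no_draw (u : V) (hu : ∀ t, Alive F u t) (v : V) (L H : ℝ≥0∞) (r : ℕ) (c : Config V)
    (hv : v ∈ (c.st u).hatB ∧ (((c.st u).pos v + 1 : ℕ) : ℝ≥0∞) ≤ L ∧
      ∑ m ∈ (c.st u).hatB, (((c.st u).pos m + 1 : ℕ) : ℝ≥0∞)⁻¹ ≤ H) :
    (iterate (drawRound G F) r c).toOuterMeasure {c' | v ∈ (c'.st u).hatB} ≤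
      (1 - L⁻¹ * H⁻¹) ^ r := by
  have := expect_draws_lower G F {u} (by simpa using hu) (fun _ => v) L H 0 1 (zero_add 1) r c
    (by simpa using hv)
  simp only [Finset.prod_singleton, zero_add, one_mul, Finset.card_singleton, pow_one] at this
  refine le_trans (prob_le_expect _ _ _ fun c' _ hc' => ?_) this
  exact (if_pos (show v ∈ (c'.st u).hatB from hc')).ge

/-- The target varies with the node, because it is applied to each node's partner across a matching.
-/
theorem prob_many_draws (K : Finset V) (v : V → V) (r : ℕ) (c : Config V) (b : ℝ≥0∞)
    (hv : ∀ u ∈ K, v u ∈ (c.st u).hatB ∧ ((c.st u).pos = fun _ => 0) ∧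
      b ≤ ((c.st u).hatB.card : ℝ≥0∞)) (s : ℕ) :
    (iterate (drawRound G F) r c).toOuterMeasure
        {c' | AtLeast s fun u => u ∈ K ∧ v u ∉ (c'.st u).hatB} ≤
      (2 ^ s)⁻¹ * (1 + r * b⁻¹) ^ K.card := by
  refine (prob_atLeast _ K (fun u (c' : Config V) => v u ∉ (c'.st u).hatB) s).trans ?_
  gcongr
  refine le_trans (le_of_eq ?_) ((expect_draws_upper G F K v r c
    fun u hu => ⟨(hv u hu).1, (hv u hu).2.1⟩).trans ?_)
  · congr 1
    ext c'
    refine Finset.prod_congr rfl fun u _ => ?_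
    by_cases h : v u ∈ (c'.st u).hatB <;> simp [h]
  · refine (Finset.prod_le_prod' fun u hu => ?_).trans (Finset.prod_const _).le
    gcongr
    exact (hv u hu).2.2

end Tails

/-! ### The start of the execution, and the ranking lists -/

section Start

variable {V : Type*} [Fintype V] [DecidableEq V] {G : SimpleGraph V} {N : ℕ} {F : Schedule V N}

/-- Local steps that change `S` and `cnt` nowhere and only add admissible messages to `R`
preserve soundness. -/
theorem Sound.of_eq {c c' : Config V} (h : Sound G F c) (ht : c.time ≤ c'.time)
    (hS : ∀ u, (c'.st u).S = (c.st u).S) (hcnt : ∀ u, (c'.st u).cnt = (c.st u).cnt)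
    (hR : ∀ u, (c.st u).R ⊆ (c'.st u).R)
    (ho : ∀ u, Alive F u c'.time → ∀ v ∈ (c'.st u).R, Alive F v 0) : Sound G F c' where
  cnt u hu v := by
    rw [hcnt, h.cnt u (hu.mono ht) v]
    congr 2
    ext w
    simp [hS]
  known u hu w hw := by
    rw [hS]
    exact (h.known u (hu.mono ht) w hw).trans (hR u)
  self u := hR u (h.self u)
  origin := ho
  sent u := by
    rw [hS]
    exact h.sent u
  own u := by
    rw [hS]
    exact h.own u

open Classical in
theorem afterRoundZero_S (u : V) :
    ((afterRoundZero G F).st u).S = if Alive F u 0 then {u} else ∅ := by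
  by_cases h : Alive F u 0
  · simp [afterRoundZero, Config.round, NodeState.sync, initState, h]
  · simp [afterRoundZero, Config.round, initState, h]

theorem afterRoundZero_R {u v : V} (h : v ∈ ((afterRoundZero G F).st u).R) :
    v = u ∨ (G.Adj u v ∧ Alive F v 0) := by
  classical
  by_cases hu : Alive F u 0
  · simp only [afterRoundZero, Config.round, NodeState.sync, initState, hu, if_true,
      Finset.mem_union, Finset.mem_singleton, Finset.mem_filter, Finset.mem_univ, true_and,
      received, Finset.card_pos] at h
    rcases h with h | ⟨w, hw⟩
    · exact Or.inl h
    · right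
      simp only [Finset.mem_filter, Finset.mem_univ, true_and] at hw
      obtain ⟨h1, h2⟩ := hw
      split_ifs at h2 with h3
      cases h2
      exact ⟨h1, h3⟩
  · left
    simpa [afterRoundZero, Config.round, initState, hu] using h

theorem afterRoundZero_sel (u : V) : ((afterRoundZero G F).st u).sel = none := by
  by_cases hu : Alive F u 0 <;>
    simp [afterRoundZero, Config.round, NodeState.sync, initState, hu]

theorem sound_afterRoundZero : Sound G F (afterRoundZero G F) := by
  classical
  have hself : ∀ u, u ∈ ((afterRoundZero G F).st u).R := by
    intro u
    by_cases hu : Alive F u 0 <;>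
      simp [afterRoundZero, Config.round, NodeState.sync, initState, hu]
  have h01 : ∀ u, Alive F u (afterRoundZero G F).time → Alive F u 0 :=
    fun u hu => hu.mono (Nat.zero_le _)
  have hout : ∀ w v, ((if Alive F w 0 then some w else none) = some v) ↔
      v ∈ ((afterRoundZero G F).st w).S := by
    intro w v
    rw [afterRoundZero_S]
    split_ifs <;> simp [eq_comm]
  refine ⟨?_, ?_, hself, ?_, ?_, ?_⟩
  · intro u hu v
    have hu0 := h01 u hu
    have : ((afterRoundZero G F).st u).cnt v = (if v = u then 1 else 0) +
        received G (fun w => if Alive F w 0 then some w else none) u v := by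
      simp [afterRoundZero, Config.round, NodeState.sync, initState, hu0]
    rw [this, received]
    simp only [hout]
  · intro u hu w hw v hv
    have hu0 := h01 u hu
    have : ((afterRoundZero G F).st u).R = {u} ∪ Finset.univ.filter fun v =>
        0 < received G (fun w => if Alive F w 0 then some w else none) u v := by
      simp [afterRoundZero, Config.round, NodeState.sync, initState, hu0]
    rw [this, Finset.mem_union, Finset.mem_filter]
    refine Or.inr ⟨Finset.mem_univ _, ?_⟩
    rw [received, Finset.card_pos]
    exact ⟨w, Finset.mem_filter.2 ⟨Finset.mem_univ _, hw, (hout w v).2 hv⟩⟩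
  · intro u hu v hv
    rcases afterRoundZero_R hv with rfl | h
    · exact h01 v hu
    · exact h.2
  · intro u v hv
    rw [afterRoundZero_S] at hv
    split_ifs at hv with h
    · rwa [Finset.mem_singleton.1 hv]
    · simp at hv
  · intro u hu
    rw [afterRoundZero_S, if_pos hu]
    exact Finset.mem_singleton_self u

theorem Sound.startRandom {c : Config V} (h : Sound G F c) :
    Sound G F (c.locally fun _ _ => NodeState.startRandom) :=
  h.of_eq le_rfl (fun _ => rfl) (fun _ => rfl) (fun _ => subset_rfl) h.origin

/-- What surely holds after the random phase. -/
theorem drawInv_randomPhase {P : Params} {c : Config V}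
    (hc : c ∈ (randomPhase G P F (afterRoundZero G F)).support) :
    DrawInv G F ((afterRoundZero G F).locally fun _ _ => NodeState.startRandom) c := by
  refine drawInv_of_mem_support sound_afterRoundZero.startRandom (fun u => ?_) (fun u _ => ?_) hc
  · exact Finset.sdiff_disjoint
  · exact Finset.sdiff_subset

theorem NodeState.rankingBuffer_subset_B (P : Params) (s : NodeState V) :
    s.rankingBuffer P ⊆ s.B := by
  unfold NodeState.rankingBuffer
  split
  · exact subset_rfl
  · exact Finset.filter_subset _ _

theorem Sound.startRanking {P : Params} {ρ : Rules V} {c : Config V} (h : Sound G F c) :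
    Sound G F (c.locally fun u t s => s.startRanking P (ρ.tie u t s)) :=
  h.of_eq le_rfl (fun _ => rfl) (fun _ => rfl) (fun _ => subset_rfl) h.origin

theorem drawInv_rankingPhase {P : Params} {ρ : Rules V} {c c' : Config V} (h : Sound G F c)
    (hc : c' ∈ (rankingPhase G P ρ F c).support) :
    DrawInv G F (c.locally fun u t s => s.startRanking P (ρ.tie u t s)) c' := by
  refine drawInv_of_mem_support h.startRanking (fun u => ?_) (fun u _ => ?_) hc
  · exact Finset.disjoint_of_subset_left ((c.st u).rankingBuffer_subset_B P)
      Finset.sdiff_disjoint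
  · exact ((c.st u).rankingBuffer_subset_B P).trans Finset.sdiff_subset

/-- The order of the ranking list compares these keys lexicographically. -/
def NodeState.rankKey (s : NodeState V) (key : V ↪ ℕ) (m : V) : ℕ ×ₗ (ℕ ×ₗ ℕ) :=
  toLex (if m ∈ s.sel.getD ∅ then 0 else 1, toLex (s.cnt m, key m))

theorem NodeState.precedes_iff (s : NodeState V) (key : V ↪ ℕ) (m m' : V) :
    s.Precedes key m m' ↔ s.rankKey key m < s.rankKey key m' := by
  simp only [NodeState.Precedes, NodeState.rankKey, Prod.Lex.lt_iff, ofLex_toLex]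

theorem NodeState.rankKey_injective (s : NodeState V) (key : V ↪ ℕ) :
    (s.rankKey key).Injective := by
  intro m m' h
  simp only [NodeState.rankKey, EmbeddingLike.apply_eq_iff_eq, Prod.mk.injEq] at h
  exact h.2.2

/-- Everything that precedes `m` lies in `Z` without `m`. An initial segment of the list thus bounds
the ranks of its members by its size. -/
theorem NodeState.startRanking_pos_lt {P : Params} {key : V ↪ ℕ} {s : NodeState V} {m : V}
    {Z : Finset V} (hm : m ∈ Z)
    (hZ : ∀ m' ∈ s.rankingBuffer P, s.Precedes key m' m → m' ∈ Z) :
    (s.startRanking P key).pos m < Z.card := by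
  classical
  refine Finset.card_lt_card ((Finset.ssubset_iff_of_subset fun m' hm' => ?_).2 ⟨m, hm, ?_⟩)
  · rw [Finset.mem_filter] at hm'
    exact hZ m' hm'.1 hm'.2
  · intro h
    rw [Finset.mem_filter, NodeState.precedes_iff] at h
    exact lt_irrefl _ h.2

theorem NodeState.startRanking_pos_lt_pos {P : Params} {key : V ↪ ℕ} {s : NodeState V} {m m' : V}
    (hm : m ∈ s.rankingBuffer P) (h : s.rankKey key m < s.rankKey key m') :
    (s.startRanking P key).pos m < (s.startRanking P key).pos m' := by
  classical
  refine NodeState.startRanking_pos_lt (Finset.mem_filter.2 ⟨hm, (s.precedes_iff key _ _).2 h⟩)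
    fun x hx hxm => Finset.mem_filter.2 ⟨hx, ?_⟩
  rw [NodeState.precedes_iff] at hxm ⊢
  exact hxm.trans h

theorem NodeState.startRanking_pos_injOn {P : Params} {key : V ↪ ℕ} {s : NodeState V} :
    Set.InjOn (s.startRanking P key).pos (s.rankingBuffer P) := by
  intro m hm m' hm' h
  rcases lt_trichotomy (s.rankKey key m) (s.rankKey key m') with h1 | h1 | h1
  · exact absurd h (NodeState.startRanking_pos_lt_pos hm h1).ne
  · exact s.rankKey_injective key h1
  · exact absurd h (NodeState.startRanking_pos_lt_pos hm' h1).ne'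

/-- The harmonic numbers. -/
noncomputable def harmonicSum (n : ℕ) : ℝ≥0∞ := ∑ i ∈ Finset.range n, ((i + 1 : ℕ) : ℝ≥0∞)⁻¹

/-- The positions are distinct, so the weights are distinct terms of the harmonic series. -/
theorem sum_inv_startRanking_le (P : Params) (key : V ↪ ℕ) (s : NodeState V) :
    ∑ m ∈ (s.startRanking P key).hatB, (((s.startRanking P key).pos m + 1 : ℕ) : ℝ≥0∞)⁻¹
      ≤ harmonicSum (Fintype.card V) := by
  classical
  have h := Finset.sum_image (f := fun i : ℕ => ((i + 1 : ℕ) : ℝ≥0∞)⁻¹)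
    (NodeState.startRanking_pos_injOn (P := P) (key := key) (s := s))
  change ∑ m ∈ s.rankingBuffer P, _ ≤ _
  rw [← h]
  refine Finset.sum_le_sum_of_subset fun i hi => ?_
  obtain ⟨m, hm, rfl⟩ := Finset.mem_image.1 hi
  rw [Finset.mem_range]
  refine (NodeState.startRanking_pos_lt hm fun m' hm' _ => hm').trans_le ?_
  exact Finset.card_le_univ _

/-- Surviving nodes send all messages from the top of their ranking lists. -/
theorem prob_rankingPhase_missing (P : Params) (ρ : Rules V) (c : Config V) (Z : V → Finset V)
    (L : ℕ) (e : ℝ≥0∞) (U : Finset V) (hU : ∀ u ∈ U, ∀ t, Alive F u t)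
    (hZ : ∀ u ∈ U, Z u ⊆ (c.st u).rankingBuffer P ∧ (Z u).card ≤ L ∧
      ∀ key : V ↪ ℕ, ∀ m ∈ Z u, ∀ m' ∈ (c.st u).rankingBuffer P,
        (c.st u).Precedes key m' m → m' ∈ Z u)
    (hsound : Sound G F c)
    (he : (1 - (L : ℝ≥0∞)⁻¹ * (harmonicSum (Fintype.card V))⁻¹) ^ P.tau' ≤ e) :
    (rankingPhase G P ρ F c).toOuterMeasure {c' | ∃ u ∈ U, ¬ Z u ⊆ (c'.st u).S} ≤
      (Fintype.card V * Fintype.card V : ℕ) * e := by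
  have h1 := prob_exists_le (ι := V × V) (rankingPhase G P ρ F c)
    (fun x => {c' | x.1 ∈ U ∧ x.2 ∈ Z x.1 ∧ x.2 ∈ (c'.st x.1).hatB})
    (Fintype.card V * Fintype.card V) e (Fintype.card_prod V V).le ?_
  · refine le_trans (prob_mono _ fun c' hc' h => ?_) h1
    obtain ⟨u, hu, h⟩ := h
    obtain ⟨v, hv, hvS⟩ := Finset.not_subset.1 h
    refine ⟨(u, v), hu, hv, ?_⟩
    change v ∈ (c'.st u).hatB
    rw [(drawInv_rankingPhase hsound hc').hatB_eq u, Finset.mem_sdiff]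
    exact ⟨(hZ u hu).1 hv, hvS⟩
  · rintro ⟨u, v⟩
    by_cases hv : u ∈ U ∧ v ∈ Z u
    · refine le_trans (prob_mono _ fun c' _ h => h.2.2)
        ((prob_no_draw G F u (hU u hv.1) v L (harmonicSum (Fintype.card V)) P.tau' _
          ⟨(hZ u hv.1).1 hv.2, ?_, ?_⟩).trans he)
      · have := NodeState.startRanking_pos_lt hv.2
          ((hZ u hv.1).2.2 (ρ.tie u c.time (c.st u)) v hv.2)
        exact_mod_cast (Nat.succ_le_of_lt this).trans (hZ u hv.1).2.1
      · exact sum_inv_startRanking_le P _ _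
    · refine le_trans (prob_mono _ (t := ∅) fun c' _ h => hv ⟨h.1, h.2.1⟩) ?_
      simp

end Start

/-! ### Shuffle phases -/

section Shuffle

variable {V : Type*} [Fintype V] [DecidableEq V] {G : SimpleGraph V} {N : ℕ} {F : Schedule V N}
  {ρ : Rules V}

theorem shuffleMessage_mem {key : V ↪ ℕ} {u : V} {s : NodeState V} (h : s.hatB.Nonempty) :
    shuffleMessage key u s ∈ s.hatB := by
  rw [shuffleMessage, dif_pos h]
  exact (s.hatB.exists_min_image key h).choose_spec.1

open Classical in
/-- The relation between the start `c₀` of a shuffle phase and the configuration after `r` rounds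
of this phase. -/
structure ShuffleInv (G : SimpleGraph V) (F : Schedule V N) (c₀ : Config V) (r : ℕ)
    (c : Config V) : Prop where
  time : c.time = c₀.time + r
  R_eq : ∀ u, (c.st u).R = (c₀.st u).R
  S_eq : ∀ u, (c.st u).S = (c₀.st u).S
  cnt_eq : ∀ u, (c.st u).cnt = (c₀.st u).cnt
  hatB_sub : ∀ u, (c.st u).hatB ⊆ (c₀.st u).hatB
  hatB_card : ∀ u, (∀ t, Alive F u t) → (c.st u).hatB.card ≤ (c₀.st u).hatB.card - r
  alive : ∀ u, ∀ v ∈ (c₀.st u).hatB, v ∉ (c.st u).hatB → Alive F u c₀.time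
  lower : ∀ w, Alive F w c.time → ∀ v, (c₀.st w).phasecnt v +
    (Finset.univ.filter fun u => G.Adj w u ∧ v ∈ (c₀.st u).hatB ∧ v ∉ (c.st u).hatB).card
      ≤ (c.st w).phasecnt v
  upper : ∀ w v, (c.st w).phasecnt v ≤ (c₀.st w).phasecnt v +
    (Finset.univ.filter fun u => G.Adj w u ∧ v ∈ (c₀.st u).hatB ∧ v ∉ (c.st u).hatB).card +
      if G.Adj w v ∧ Alive F v c₀.time then r else 0

/-- Each buffered message is popped at most once, so `phasecnt` counts the neighbours that have
popped it. The only repeated transmissions are those of a node with empty buffer, which sends its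
own message; they account for the last summand of `upper`. -/
theorem ShuffleInv.step {c₀ c : Config V} {r : ℕ} (h : ShuffleInv G F c₀ r c) :
    ShuffleInv G F c₀ (r + 1) (shuffleRound G ρ F c) := by
  classical
  obtain ⟨out, hout, hS, hB, halive, hdead⟩ : ∃ out : V → Option V,
      (∀ u, if Alive F u c.time then
        ∃ m, out u = some m ∧ ((c.st u).hatB.Nonempty → m ∈ (c.st u).hatB) ∧
          (¬ (c.st u).hatB.Nonempty → m = u) else out u = none) ∧
      (∀ u, ((shuffleRound G ρ F c).st u).R = (c.st u).R ∧
        ((shuffleRound G ρ F c).st u).S = (c.st u).S ∧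
        ((shuffleRound G ρ F c).st u).cnt = (c.st u).cnt) ∧
      (∀ u, ((shuffleRound G ρ F c).st u).hatB = (c.st u).hatB \ (out u).toFinset) ∧
      (∀ u, Alive F u c.time → ∀ v, ((shuffleRound G ρ F c).st u).phasecnt v =
        (c.st u).phasecnt v + received G out u v) ∧
      (∀ u, ¬ Alive F u c.time → ((shuffleRound G ρ F c).st u).phasecnt = (c.st u).phasecnt) := by
    refine ⟨fun w => if Alive F w c.time then
      some (shuffleMessage (ρ.pop w c.time (c.st w)) w (c.st w)) else none, ?_, ?_, ?_, ?_, ?_⟩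
    · intro u
      split_ifs with ha
      · refine ⟨_, if_pos ha, shuffleMessage_mem, fun h => ?_⟩
        rw [shuffleMessage, dif_neg h]
      · exact if_neg ha
    all_goals intro u
    all_goals by_cases ha : Alive F u c.time
    all_goals simp [shuffleRound, Config.round, NodeState.syncShuffle, ha]
  have hsome : ∀ u v, out u = some v → Alive F u c.time ∧
      ((v ∈ (c.st u).hatB ∧ v ∈ (c₀.st u).hatB) ∨ v = u) := by
    intro u v huv
    have := hout u
    split_ifs at this with ha
    · obtain ⟨m, h1, h2, h3⟩ := this
      have : m = v := Option.some_injective _ (h1.symm.trans huv)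
      subst this
      refine ⟨ha, ?_⟩
      by_cases hn : (c.st u).hatB.Nonempty
      · exact Or.inl ⟨h2 hn, h.hatB_sub u (h2 hn)⟩
      · exact Or.inr (h3 hn)
    · rw [this] at huv
      cases huv
  have hmem : ∀ u v, v ∈ ((shuffleRound G ρ F c).st u).hatB ↔
      v ∈ (c.st u).hatB ∧ ¬ out u = some v := by
    intro u v
    rw [hB, Finset.mem_sdiff, Option.mem_toFinset, Option.mem_def]
  have ht : (shuffleRound G ρ F c).time = c.time + 1 := rfl
  have hc0 : ∀ u, Alive F u c.time → Alive F u c₀.time :=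
    fun u hu => hu.mono (by have := h.time; omega)
  refine ⟨?_, fun u => ((hS u).1).trans (h.R_eq u), fun u => ((hS u).2.1).trans (h.S_eq u),
    fun u => ((hS u).2.2).trans (h.cnt_eq u), ?_, ?_, ?_, ?_, ?_⟩
  · rw [ht, h.time, add_assoc]
  · exact fun u v hv => h.hatB_sub u ((hmem u v).1 hv).1
  · intro u hu
    have h1 := h.hatB_card u hu
    have h2 := hout u
    rw [if_pos (hu _)] at h2
    obtain ⟨m, hm, h2, -⟩ := h2
    by_cases hn : (c.st u).hatB.Nonempty
    · have h3 : ((shuffleRound G ρ F c).st u).hatB.card < (c.st u).hatB.card := by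
        refine Finset.card_lt_card ((Finset.ssubset_iff_of_subset fun v hv => ?_).2
          ⟨m, h2 hn, fun hm' => ?_⟩)
        · exact ((hmem u v).1 hv).1
        · exact ((hmem u m).1 hm').2 hm
      omega
    · rw [Finset.not_nonempty_iff_eq_empty] at hn
      rw [hB, hn]
      simp
  · intro u v hv hv'
    by_cases h1 : v ∈ (c.st u).hatB
    · rw [hmem] at hv'
      exact hc0 u (hsome u v (by tauto)).1
    · exact h.alive u v hv h1
  · intro w hw v
    have hw' : Alive F w c.time := hw.mono (by omega)
    rw [halive w hw' v]
    refine le_trans ?_ (Nat.add_le_add_right (h.lower w hw' v) _)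
    rw [add_assoc, received]
    refine Nat.add_le_add_left (le_trans (Finset.card_le_card ?_) (Finset.card_union_le _ _)) _
    intro u hu
    simp only [Finset.mem_union, Finset.mem_filter, Finset.mem_univ, true_and, hmem] at hu ⊢
    tauto
  · intro w v
    by_cases hw : Alive F w c.time
    · rw [halive w hw v]
      have h1 := h.upper w v
      have h2 : (Finset.univ.filter fun u => G.Adj w u ∧ v ∈ (c₀.st u).hatB ∧
            v ∉ (c.st u).hatB).card + received G out w v ≤
          (Finset.univ.filter fun u => G.Adj w u ∧ v ∈ (c₀.st u).hatB ∧
            v ∉ ((shuffleRound G ρ F c).st u).hatB).card +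
          if G.Adj w v ∧ Alive F v c₀.time then 1 else 0 := by
        -- Only `v` itself can send `v` without having it in its buffer.
        have h3 : received G out w v ≤ (Finset.univ.filter fun u => G.Adj w u ∧
            (v ∈ (c.st u).hatB ∧ v ∈ (c₀.st u).hatB) ∧ out u = some v).card +
            if G.Adj w v ∧ Alive F v c₀.time then 1 else 0 := by
          have h4 : (if G.Adj w v ∧ Alive F v c₀.time then 1 else 0) =
              (if G.Adj w v ∧ Alive F v c₀.time then {v} else ∅ : Finset V).card := by
            split_ifs <;> simp
          rw [h4, received]
          refine le_trans (Finset.card_le_card ?_) (Finset.card_union_le _ _)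
          intro u hu
          simp only [Finset.mem_filter, Finset.mem_univ, true_and] at hu
          obtain ⟨ha, h5⟩ := hsome u v hu.2
          rw [Finset.mem_union]
          rcases h5 with h5 | rfl
          · left
            simp only [Finset.mem_filter, Finset.mem_univ, true_and]
            exact ⟨hu.1, h5, hu.2⟩
          · right
            rw [if_pos ⟨hu.1, hc0 _ ha⟩]
            exact Finset.mem_singleton_self _
        refine (Nat.add_le_add_left h3 _).trans ?_
        rw [← add_assoc, ← Finset.card_union_of_disjoint]
        · refine Nat.add_le_add_right (Finset.card_le_card fun u hu => ?_) _
          simp only [Finset.mem_union, Finset.mem_filter, Finset.mem_univ, true_and, hmem] at hu ⊢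
          tauto
        · rw [Finset.disjoint_left]
          intro u hu hu'
          simp only [Finset.mem_filter, Finset.mem_univ, true_and] at hu hu'
          tauto
      split_ifs at h1 h2 ⊢ <;> omega
    · rw [hdead w hw]
      refine (h.upper w v).trans (Nat.add_le_add (Nat.add_le_add_left
        (Finset.card_le_card fun u hu => ?_) _) ?_)
      · simp only [Finset.mem_filter, Finset.mem_univ, true_and, hmem] at hu ⊢
        tauto
      · split_ifs <;> omega

theorem shuffleInv_iterate (c₀ : Config V) (r : ℕ) :
    ShuffleInv G F c₀ r ((shuffleRound G ρ F)^[r] c₀) := by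
  induction r with
  | zero =>
    refine ⟨rfl, fun _ => rfl, fun _ => rfl, fun _ => rfl, fun _ => subset_rfl,
      fun _ _ => le_rfl, fun u v h h' => absurd h h', fun w _ v => ?_, fun w v => ?_⟩
    · simp
    · simp
  | succ r ih =>
    rw [Function.iterate_succ_apply']
    exact ih.step

open Classical in
/-- The fresh messages of `B_u`. -/
noncomputable def NodeState.fresh (P : Params) (s : NodeState V) : Finset V :=
  s.B.filter fun m => (s.cnt m : ℝ) < P.T

open Classical in
/-- What surely holds at the end of the rounds of a shuffle phase. -/
structure ShuffleEnd (G : SimpleGraph V) (F : Schedule V N) (P : Params) (c c' : Config V) :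
    Prop where
  time : c'.time = c.time + 8 * P.tau
  R_eq : ∀ u, (c'.st u).R = (c.st u).R
  S_eq : ∀ u, (c'.st u).S = (c.st u).S
  cnt_eq : ∀ u, (c'.st u).cnt = (c.st u).cnt
  lower : ∀ w, Alive F w c'.time → ∀ v, ∀ D : Finset V,
    (∀ u ∈ D, (u = w ∨ G.Adj w u) ∧ (∀ t, Alive F u t) ∧ v ∈ (c.st u).fresh P ∧
      ((c.st u).fresh P).card ≤ 8 * P.tau) → D.card ≤ (c'.st w).phasecnt v
  upper : ∀ w v, ¬ (G.Adj w v ∧ Alive F v c.time) → (c'.st w).phasecnt v ≤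
    (if v ∈ (c.st w).fresh P then 1 else 0) +
    (Finset.univ.filter fun u => G.Adj w u ∧ Alive F u c.time ∧ v ∈ (c.st u).fresh P).card

/-- A survivor with at most `8τ` fresh messages empties its buffer in the `8τ` rounds, so all of
them are announced. -/
theorem shuffleEnd_of_iterate (P : Params) (c : Config V) :
    ShuffleEnd G F P c
      ((shuffleRound G ρ F)^[8 * P.tau] (c.locally fun _ _ => NodeState.startShuffle P)) := by
  classical
  have h := shuffleInv_iterate (G := G) (F := F) (ρ := ρ)
    (c.locally fun _ _ => NodeState.startShuffle P) (8 * P.tau)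
  set c' := (shuffleRound G ρ F)^[8 * P.tau] (c.locally fun _ _ => NodeState.startShuffle P)
  have hB : ∀ u, ((c.locally fun _ _ => NodeState.startShuffle P).st u).hatB =
      (c.st u).fresh P := fun u => rfl
  have hp : ∀ u v, ((c.locally fun _ _ => NodeState.startShuffle P).st u).phasecnt v =
      if v ∈ (c.st u).fresh P then 1 else 0 := fun u v => rfl
  refine ⟨h.time, h.R_eq, h.S_eq, h.cnt_eq, ?_, ?_⟩
  · intro w hw v D hD
    refine le_trans ?_ (h.lower w hw v)
    have hempty : ∀ u ∈ D, v ∉ (c'.st u).hatB := by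
      intro u hu hv
      obtain ⟨-, h1, -, h2⟩ := hD u hu
      have h3 := h.hatB_card u h1
      rw [hB, Nat.sub_eq_zero_of_le h2] at h3
      have := Finset.card_pos.2 ⟨v, hv⟩
      omega
    have h1 : (D.erase w).card ≤ (Finset.univ.filter fun u => G.Adj w u ∧
        v ∈ ((c.locally fun _ _ => NodeState.startShuffle P).st u).hatB ∧
        v ∉ (c'.st u).hatB).card := by
      refine Finset.card_le_card fun u hu => ?_
      obtain ⟨hne, hu⟩ := Finset.mem_erase.1 hu
      obtain ⟨h1, h2, h3, h4⟩ := hD u hu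
      simp only [Finset.mem_filter, Finset.mem_univ, true_and]
      exact ⟨h1.resolve_left hne, h3, hempty u hu⟩
    refine le_trans ?_ (Nat.add_le_add_left h1 _)
    -- The node's own copy is not received; the initial value 1 of `phasecnt` stands for it.
    by_cases hwD : w ∈ D
    · rw [hp, if_pos (hD w hwD).2.2.1, Finset.card_erase_of_mem hwD]
      omega
    · rw [Finset.erase_eq_of_notMem hwD]
      omega
  · intro w v hv
    refine (h.upper w v).trans ?_
    rw [if_neg (show ¬ (G.Adj w v ∧
      Alive F v (c.locally fun _ _ => NodeState.startShuffle P).time) from hv), add_zero, hp]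
    refine Nat.add_le_add_left (Finset.card_le_card fun u hu => ?_) _
    simp only [Finset.mem_filter, Finset.mem_univ, true_and] at hu ⊢
    exact ⟨hu.1, h.alive u v hu.2.1 hu.2.2, hu.2.1⟩

theorem mem_support_selection {P : Params} {s : NodeState V} {A : Finset V}
    (h : A ∈ (selection P s).support) : A ⊆ s.filtered P ∧ A.card ≤ 4 * P.tau := by
  rw [selection, PMF.mem_support_uniformOfFinset_iff, Finset.mem_powersetCard] at h
  exact ⟨h.1, h.2.le.trans (min_le_left _ _)⟩

end Shuffle

/-! ### The path of cliques -/

section CliquePath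

/-- The distance between two cliques. -/
def sep {m : ℕ} (i j : Fin m) : ℕ := ((i : ℕ) - j) + ((j : ℕ) - i)

variable {m k : ℕ}

theorem adj_iff {x y : Fin m × Fin k} : (cliquePath m k).Adj x y ↔
    (x.1 = y.1 ∧ x.2 ≠ y.2) ∨ (x.2 = y.2 ∧ sep x.1 y.1 = 1) := by
  simp only [cliquePath, sep]
  refine or_congr Iff.rfl (and_congr Iff.rfl ?_)
  omega

theorem sep_self (i : Fin m) : sep i i = 0 := by simp [sep]

theorem eq_of_sep_eq_zero {i j : Fin m} (h : sep i j = 0) : i = j := by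
  simp only [sep] at h
  exact Fin.ext (by omega)

theorem sep_comm (i j : Fin m) : sep i j = sep j i := Nat.add_comm _ _

theorem sep_triangle (i j l : Fin m) : sep i l ≤ sep i j + sep j l := by
  simp only [sep]
  omega

/-- The clique next to `i` in the direction of `j`. -/
theorem exists_toward {i j : Fin m} {p : ℕ} (h : sep i j = p + 1) :
    ∃ l, sep i l = 1 ∧ sep l j = p := by
  rcases le_total (i : ℕ) j with hij | hij
  · simp only [sep] at h
    refine ⟨⟨i + 1, by omega⟩, ?_, ?_⟩ <;> simp only [sep] <;> omega
  · simp only [sep] at h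
    refine ⟨⟨i - 1, by omega⟩, ?_, ?_⟩ <;> simp only [sep] <;> omega

theorem toward_unique {i l l' j : Fin m} (h1 : sep i l = 1) (h2 : sep i l' = 1)
    (h : sep l j < sep i j) (h' : sep l' j < sep i j) : l' = l := by
  simp only [sep] at *
  exact Fin.ext (by omega)

theorem eq_of_toward {i l j j' : Fin m} (h : sep l j < sep i j)
    (h' : sep l j' < sep i j') (hj : sep i j = sep i j') : j = j' := by
  simp only [sep] at *
  exact Fin.ext (by omega)

open Classical in
theorem card_sep_eq_le (i : Fin m) (p : ℕ) :
    (Finset.univ.filter fun l : Fin m => sep i l = p).card ≤ 2 := by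
  refine le_trans (Finset.card_le_card_of_injOn (fun l : Fin m => (l : ℕ))
    (t := {(i : ℕ) + p, (i : ℕ) - p}) ?_ ?_) (Finset.card_le_two)
  · intro l hl
    have hl := (Finset.mem_filter.1 (Finset.mem_coe.1 hl)).2
    simp only [sep] at hl
    simp only [Finset.coe_insert, Finset.coe_singleton, Set.mem_insert_iff,
      Set.mem_singleton_iff]
    omega
  · exact fun l _ l' _ h => Fin.ext h

open Classical in
theorem card_clique_sep_eq_le (i : Fin m) (p : ℕ) :
    (Finset.univ.filter fun v : Fin m × Fin k => sep i v.1 = p).card ≤ 2 * k := by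
  have : (Finset.univ.filter fun v : Fin m × Fin k => sep i v.1 = p) =
      (Finset.univ.filter fun l : Fin m => sep i l = p) ×ˢ Finset.univ := by
    ext v
    simp
  rw [this, Finset.card_product, Finset.card_univ, Fintype.card_fin]
  exact Nat.mul_le_mul_right _ (card_sep_eq_le i p)

open Classical in
theorem card_matched_le (u : Fin m × Fin k) :
    (Finset.univ.filter fun w : Fin m × Fin k => u.2 = w.2 ∧ sep u.1 w.1 = 1).card ≤ 2 := by
  refine le_trans (Finset.card_le_card_of_injOn Prod.fst ?_ ?_) (card_sep_eq_le u.1 1)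
  · intro w hw
    simp only [Finset.coe_filter, Finset.mem_univ, true_and, Set.mem_ofPred_eq] at hw ⊢
    exact hw.2
  · intro w hw w' hw' h
    simp only [Finset.coe_filter, Finset.mem_univ, true_and, Set.mem_ofPred_eq] at hw hw'
    exact Prod.ext h (hw.1.symm.trans hw'.1)

variable {N : ℕ} {F : Schedule (Fin m × Fin k) N} {P : Params} {s : ℕ}
  {c c' : Config (Fin m × Fin k)}

/-- Node `u` never fails. -/
def Surv {V : Type*} {N : ℕ} (F : Schedule V N) (u : V) : Prop := ∀ t, F u t = false

theorem Surv.alive {V : Type*} {N : ℕ} {F : Schedule V N} {u : V} (h : Surv F u) (t : ℕ) :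
    Alive F u t := fun r _ => h r

theorem mem_fresh {V : Type*} [Fintype V] [DecidableEq V] {s : NodeState V} {v : V} :
    v ∈ s.fresh P ↔ v ∈ s.R ∧ v ∉ s.S ∧ (s.cnt v : ℝ) < P.T := by
  simp only [NodeState.fresh, NodeState.B, Finset.mem_filter, Finset.mem_sdiff, and_assoc]

/-- A message that at most one node of the clique has sent has a small counter. -/
theorem Sound.cnt_le_three (h : Sound (cliquePath m k) F c) {u v : Fin m × Fin k}
    (hu : Alive F u c.time) (hv : v ≠ u)
    (hS : ∀ w, w.1 = u.1 → v ∈ (c.st w).S → w.2 = v.2) : (c.st u).cnt v ≤ 3 := by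
  classical
  rw [h.cnt u hu v, if_neg hv, zero_add]
  -- One possible sender inside the clique and at most two across the matchings.
  refine le_trans (Finset.card_le_card (t := {(u.1, v.2)} ∪ Finset.univ.filter
    fun w : Fin m × Fin k => u.2 = w.2 ∧ sep u.1 w.1 = 1) ?_)
    ((Finset.card_union_le _ _).trans ?_)
  · intro w hw
    simp only [Finset.mem_union, Finset.mem_filter, Finset.mem_univ, true_and,
      Finset.mem_singleton, adj_iff] at hw ⊢
    rcases hw with ⟨h1 | h1, h2⟩
    · exact Or.inl (Prod.ext h1.1.symm (hS w h1.1.symm h2))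
    · exact Or.inr h1
  · have := card_matched_le u
    rw [Finset.card_singleton]
    omega

/-- A message that many nodes of a clique have sent is not fresh in this clique. -/
theorem Sound.le_cnt (h : Sound (cliquePath m k) F c) {u v : Fin m × Fin k}
    (hu : Alive F u c.time) (hs : P.T + 1 ≤ s)
    (hv : AtLeast s fun a => v ∈ (c.st (u.1, a)).S) : P.T ≤ (c.st u).cnt v := by
  classical
  obtain ⟨D, hD, hv⟩ := hv
  -- The node `u` does not hear itself, which costs one of the `s ≥ T + 1` senders.
  have h1 : (D.erase u.2).card ≤ (c.st u).cnt v := by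
    rw [h.cnt u hu v]
    refine le_add_left (Finset.card_le_card_of_injOn (fun a => (u.1, a)) ?_ ?_)
    · intro a ha
      simp only [Finset.coe_erase, Set.mem_sdiff, Finset.mem_coe, Set.mem_singleton_iff] at ha
      simp only [Finset.coe_filter, Finset.mem_univ, true_and, Set.mem_ofPred_eq, adj_iff]
      exact ⟨Or.inl fun h => ha.2 h.symm, hv a ha.1⟩
    · intro a _ b _ hab
      exact (Prod.ext_iff.1 hab).2
  have h2 := Finset.pred_card_le_card_erase (s := D) (a := u.2)
  have h3 : s ≤ (c.st u).cnt v + 1 := by omega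
  have h4 : (s : ℝ) ≤ (c.st u).cnt v + 1 := by exact_mod_cast h3
  linarith

open Classical in
/-- The state of affairs after the random phase. -/
structure PostRandom (P : Params) (s : ℕ) (F : Schedule (Fin m × Fin k) N)
    (c : Config (Fin m × Fin k)) : Prop where
  sound : Sound (cliquePath m k) F c
  sel : ∀ u, (c.st u).sel = none
  S_le : ∀ u, ∀ v ∈ (c.st u).S, v = u ∨ (cliquePath m k).Adj u v
  S_card : ∀ u, (c.st u).S.card ≤ 1 + P.tau
  R_le : ∀ u, ∀ v ∈ (c.st u).R, v = u ∨ ∃ w, (cliquePath m k).Adj u w ∧ v ∈ (c.st w).S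
  -- Distance 2 is required because the first ranking phase relays the message along the column at
  -- distance 1 and delivers it at distance 2.
  lower : ∀ v, Alive F v 0 →
    AtLeast s fun a => v ∈ (c.st (v.1, a)).S ∧ ∀ j, sep j v.1 ≤ 2 → Surv F (j, a)
  early : ∀ i j, sep i j = 1 →
    (Finset.univ.filter fun b : Fin k => (j, b) ∈ (c.st (i, b)).S).card ≤ 2 * P.tau

open Classical in
/-- The state of affairs after ranking phase `p`. The nodes of `X` hold messages that come from
too far away; those of `Y` may hold too many fresh messages. -/
structure Spread (P : Params) (s : ℕ) (F : Schedule (Fin m × Fin k) N) (p : ℕ)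
    (X Y : Finset (Fin m × Fin k)) (c : Config (Fin m × Fin k)) : Prop where
  sound : Sound (cliquePath m k) F c
  X_card : ∀ i, (Finset.univ.filter fun a : Fin k => (i, a) ∈ X).card ≤ 4 * P.tau
  -- The exception is a message that crossed two matchings in its own column, once in the random
  -- phase and once in the first ranking phase.
  S_le : ∀ u, ∀ v ∈ (c.st u).S, sep u.1 v.1 ≤ p ∨ (p = 1 ∧ v.2 = u.2 ∧ sep u.1 v.1 ≤ 2)
  R_le : ∀ u, Alive F u c.time → ∀ v ∈ (c.st u).R, sep u.1 v.1 ≤ p + 1 ∨ v.2 = u.2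
  R_le' : ∀ u, Alive F u c.time → u ∉ X → ∀ v ∈ (c.st u).R, sep u.1 v.1 ≤ p + 1
  known : ∀ i v, Alive F v 0 → sep i v.1 ≤ p → AtLeast s fun a => v ∈ (c.st (i, a)).S
  holders : ∀ i v, Alive F v 0 → sep i v.1 = p + 1 →
    AtLeast s fun a => Surv F (i, a) ∧ (i, a) ∉ Y ∧ v ∈ (c.st (i, a)).R
  fresh_card : ∀ u, Surv F u → u ∉ Y → ((c.st u).fresh P).card ≤ 8 * P.tau

open Classical in
/-- The state of affairs after shuffle phase `p`. -/
structure Shuffled (P : Params) (s : ℕ) (F : Schedule (Fin m × Fin k) N) (p : ℕ)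
    (X : Finset (Fin m × Fin k)) (c : Config (Fin m × Fin k)) : Prop where
  sound : Sound (cliquePath m k) F c
  X_card : ∀ i, (Finset.univ.filter fun a : Fin k => (i, a) ∈ X).card ≤ 4 * P.tau
  S_le : ∀ u, ∀ v ∈ (c.st u).S, sep u.1 v.1 ≤ p ∨ (p = 1 ∧ v.2 = u.2 ∧ sep u.1 v.1 ≤ 2)
  R_le : ∀ u, Alive F u c.time → ∀ v ∈ (c.st u).R, sep u.1 v.1 ≤ p + 1 ∨ v.2 = u.2
  R_le' : ∀ u, Alive F u c.time → u ∉ X → ∀ v ∈ (c.st u).R, sep u.1 v.1 ≤ p + 1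
  known : ∀ i v, Alive F v 0 → sep i v.1 ≤ p → AtLeast s fun a => v ∈ (c.st (i, a)).S
  sel : ∀ u, ∃ A, (c.st u).sel = some A ∧ A.card ≤ 4 * P.tau
  sel_sub : ∀ u, Alive F u c.time → ∀ A, (c.st u).sel = some A →
    ∀ v ∈ A, v ∈ (c.st u).R ∧ sep u.1 v.1 = p + 1
  chosen : ∀ i v, Alive F v 0 → sep i v.1 = p + 1 →
    AtLeast s fun a => (∀ j, sep i j ≤ 1 → Surv F (j, a) ∧ (j, a) ∉ X) ∧
      v ∈ (c.st (i, a)).sel.getD ∅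

end CliquePath

/-! ### The first ranking phase -/

section FirstRanking

variable {m k : ℕ} {N : ℕ} {F : Schedule (Fin m × Fin k) N} {P : Params} {s : ℕ}
  {ρ : Rules (Fin m × Fin k)} {c c' : Config (Fin m × Fin k)}

theorem PostRandom.known (h : PostRandom P s F c) {u v : Fin m × Fin k}
    (hu : Alive F u c.time) (hs : P.T + 1 ≤ s) (hv : Alive F v 0) (huv : sep u.1 v.1 = 0) :
    P.T ≤ (c.st u).cnt v := by
  refine h.sound.le_cnt hu hs ?_
  rw [eq_of_sep_eq_zero huv]
  exact (h.lower v hv).mono fun a ha => ha.1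

/-- The messages around come from the adjacent cliques, or from the two cliques behind these. -/
theorem PostRandom.reach (h : PostRandom P s F c) {u v : Fin m × Fin k}
    (hv : v ∈ (c.st u).S ∨ v ∈ (c.st u).R) (hsep : 1 < sep u.1 v.1) :
    v ∈ (c.st u).R ∧ sep u.1 v.1 = 2 ∧ v.2 = u.2 ∧
      ∃ l, sep u.1 l = 1 ∧ sep l v.1 = 1 ∧ v ∈ (c.st (l, u.2)).S := by
  rcases hv with hv | hv
  · rcases h.S_le u v hv with rfl | h1
    · rw [sep_self] at hsep
      omega
    · rw [adj_iff] at h1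
      rcases h1 with h1 | h1
      · rw [h1.1, sep_self] at hsep
        omega
      · omega
  · refine ⟨hv, ?_⟩
    rcases h.R_le u v hv with rfl | ⟨⟨l, b⟩, hw, hv⟩
    · rw [sep_self] at hsep
      omega
    · have h2 := h.S_le _ v hv
      rw [adj_iff] at hw h2
      have h3 : sep l v.1 ≤ 1 := by
        rcases h2 with rfl | h2 | h2
        · simp [sep_self]
        · have : l = v.1 := h2.1
          rw [this, sep_self]
          omega
        · exact h2.2.le
      rcases hw with hw | hw
      · have : u.1 = l := hw.1
        rw [this] at hsep
        omega
      · have hb : u.2 = b := hw.1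
        subst hb
        have hl : sep u.1 l = 1 := hw.2
        have := sep_triangle u.1 l v.1
        have h4 : sep l v.1 = 1 := by omega
        refine ⟨by omega, ?_, l, hl, h4, hv⟩
        rcases h2 with rfl | h2 | h2
        · simp [sep_self] at h4
        · have : l = v.1 := h2.1
          rw [this, sep_self] at h4
          omega
        · exact h2.1.symm

-- Messages of the own clique are no longer fresh. What remains was sent by one of two matched
-- neighbours, at most `1 + τ` messages each, or crossed early into the clique, at most `2τ` from
-- each side; in total `6τ + 2 ≤ 8τ`.
open Classical in
theorem PostRandom.card_fresh_le (h : PostRandom P s F c) (hs : P.T + 1 ≤ s) (ht : 2 ≤ P.tau)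
    {u : Fin m × Fin k} (hu : Alive F u c.time) : ((c.st u).fresh P).card ≤ 8 * P.tau := by
  have hsub : (c.st u).fresh P ⊆
      ((Finset.univ.filter fun w : Fin m × Fin k => u.2 = w.2 ∧ sep u.1 w.1 = 1).biUnion
        fun w => (c.st w).S) ∪
      ((Finset.univ.filter fun j : Fin m => sep u.1 j = 1).biUnion fun j =>
        (Finset.univ.filter fun b : Fin k => (j, b) ∈ (c.st (u.1, b)).S).image
          fun b => (j, b)) := by
    intro v hv
    rw [mem_fresh] at hv
    obtain ⟨hR, hS, hcnt⟩ := hv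
    have hv0 := h.sound.origin u hu v hR
    have hsep : sep u.1 v.1 ≠ 0 := fun h0 => (h.known hu hs hv0 h0).not_gt hcnt
    rcases h.R_le u v hR with rfl | ⟨w, hw, hv⟩
    · exact absurd (sep_self _) hsep
    · rw [adj_iff] at hw
      rw [Finset.mem_union]
      rcases hw with hw | hw
      · right
        have h1 := h.S_le w v hv
        rw [adj_iff] at h1
        rw [hw.1] at hsep
        rcases h1 with rfl | h1 | h1
        · exact absurd (sep_self _) hsep
        · rw [h1.1, sep_self] at hsep
          exact absurd rfl hsep
        · simp only [Finset.mem_biUnion, Finset.mem_filter, Finset.mem_univ, true_and,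
            Finset.mem_image]
          refine ⟨v.1, hw.1 ▸ h1.2, v.2, ?_, rfl⟩
          have hwv : w = (u.1, v.2) := Prod.ext hw.1.symm h1.1
          rw [hwv] at hv
          exact hv
      · left
        simp only [Finset.mem_biUnion, Finset.mem_filter, Finset.mem_univ, true_and]
        exact ⟨w, hw, hv⟩
  have h1 := Finset.card_biUnion_le_card_mul
    (Finset.univ.filter fun w : Fin m × Fin k => u.2 = w.2 ∧ sep u.1 w.1 = 1)
    (fun w => (c.st w).S) (1 + P.tau) fun w _ => h.S_card w
  have h2 := Finset.card_biUnion_le_card_mul (Finset.univ.filter fun j : Fin m => sep u.1 j = 1)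
    (fun j => (Finset.univ.filter fun b : Fin k => (j, b) ∈ (c.st (u.1, b)).S).image
      fun b => (j, b)) (2 * P.tau) fun j hj =>
    Finset.card_image_le.trans (h.early u.1 j (Finset.mem_filter.1 hj).2)
  have h3 := Nat.mul_le_mul_right (1 + P.tau) (card_matched_le u)
  have h4 := Nat.mul_le_mul_right (2 * P.tau) (card_sep_eq_le u.1 1)
  have h5 := (Finset.card_le_card hsub).trans (Finset.card_union_le _ _)
  omega

theorem DrawInv.mem_S_cases
    (d : DrawInv (cliquePath m k) F (c.locally fun u t s => s.startRanking P (ρ.tie u t s)) c')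
    {u v : Fin m × Fin k} (hv : v ∈ (c'.st u).S) :
    v ∈ (c.st u).S ∨ (Alive F u c.time ∧ v ∈ (c.st u).rankingBuffer P) :=
  d.S_le u v hv

theorem DrawInv.mem_S_or_R
    (d : DrawInv (cliquePath m k) F (c.locally fun u t s => s.startRanking P (ρ.tie u t s)) c')
    {u v : Fin m × Fin k} (hv : v ∈ (c'.st u).S) : v ∈ (c.st u).S ∨ v ∈ (c.st u).R := by
  rcases d.mem_S_cases hv with hv | hv
  · exact Or.inl hv
  · exact Or.inr (Finset.sdiff_subset ((c.st u).rankingBuffer_subset_B P hv.2))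

/-- In an adjacent clique only the partner of `v` can have sent `v` in the random phase. So a
survivor that receives `v` through its column still finds it fresh, and sends it. -/
theorem PostRandom.mem_S_after (h : PostRandom P s F c)
    (d : DrawInv (cliquePath m k) F (c.locally fun u t s => s.startRanking P (ρ.tie u t s)) c')
    (hT : 3 < P.T)
    (hf : ∀ u, Surv F u → (c.st u).fresh P ⊆ (c'.st u).S) {l : Fin m} {a : Fin k}
    {v : Fin m × Fin k} (hlv : sep l v.1 = 1) (hv : v ∈ (c.st (v.1, a)).S)
    (ha : Surv F (l, a)) : v ∈ (c'.st (l, a)).S := by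
  by_cases hS : v ∈ (c.st (l, a)).S
  · exact d.S_mono _ hS
  · refine hf _ ha (mem_fresh.2 ⟨?_, hS, ?_⟩)
    · refine h.sound.known _ (ha.alive _) (v.1, a) ?_ hv
      rw [adj_iff]
      exact Or.inr ⟨rfl, hlv⟩
    · have h1 : (c.st (l, a)).cnt v ≤ 3 := by
        refine h.sound.cnt_le_three (ha.alive _) ?_ ?_
        · rintro rfl
          simp [sep_self] at hlv
        · intro w hw hvw
          have hw : w.1 = l := hw
          have h2 := h.S_le w v hvw
          rw [adj_iff, hw] at h2
          rcases h2 with rfl | h2 | h2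
          · rfl
          · rw [h2.1, sep_self] at hlv
            omega
          · exact h2.1
      have h2 : ((c.st (l, a)).cnt v : ℝ) ≤ 3 := by exact_mod_cast h1
      linarith

theorem PostRandom.S_after (h : PostRandom P s F c)
    (d : DrawInv (cliquePath m k) F (c.locally fun u t s => s.startRanking P (ρ.tie u t s)) c')
    {u v : Fin m × Fin k} (hv : v ∈ (c'.st u).S) :
    sep u.1 v.1 ≤ 1 ∨ (sep u.1 v.1 = 2 ∧ v.2 = u.2) := by
  by_cases h1 : sep u.1 v.1 ≤ 1
  · exact Or.inl h1
  · obtain ⟨-, h2, h3, -⟩ := h.reach (d.mem_S_or_R hv) (not_le.1 h1)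
    exact Or.inr ⟨h2, h3⟩

/-- Where the messages that arrive from far away in the first ranking phase come from. -/
theorem PostRandom.R_after (h : PostRandom P s F c)
    (d : DrawInv (cliquePath m k) F (c.locally fun u t s => s.startRanking P (ρ.tie u t s)) c')
    {u v : Fin m × Fin k} (hv : v ∈ (c'.st u).R)
    (hsep : 1 < sep u.1 v.1) :
    (sep u.1 v.1 = 2 ∧ ∃ l, sep u.1 l = 1 ∧ sep l v.1 = 1 ∧
      (v ∈ (c.st (l, v.2)).S ∨ v ∈ (c.st (v.1, u.2)).S)) ∨
    (sep u.1 v.1 = 3 ∧ v.2 = u.2 ∧ ∃ l, sep u.1 l = 2 ∧ sep l v.1 = 1 ∧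
      v ∈ (c.st (l, u.2)).S) := by
  have hback : ∀ x y : Fin m × Fin k, sep x.1 y.1 = 1 → y ∈ (c.st x).S → y.2 = x.2 := by
    intro x y hxy hy
    have := h.S_le x y hy
    rw [adj_iff] at this
    rcases this with rfl | h1 | h1
    · rfl
    · rw [h1.1, sep_self] at hxy
      omega
    · exact h1.1.symm
  rcases d.R_le u v hv with hv | ⟨w, hw, hv⟩
  · obtain ⟨-, h1, h2, l, h3, h4, h5⟩ := h.reach (Or.inr hv) hsep
    exact Or.inl ⟨h1, l, h3, h4, Or.inl (h2 ▸ h5)⟩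
  · rw [adj_iff] at hw
    rcases hw with hw | hw
    · rw [hw.1] at hsep ⊢
      obtain ⟨-, h1, h2, l, h3, h4, h5⟩ := h.reach (d.mem_S_or_R hv) hsep
      exact Or.inl ⟨h1, l, h3, h4, Or.inl (h2 ▸ h5)⟩
    · obtain ⟨i, a⟩ := u
      obtain ⟨l, b⟩ := w
      obtain ⟨hab, hl⟩ := hw
      simp only at hab hl hsep ⊢
      subst hab
      have htri := sep_triangle i l v.1
      by_cases h1 : 1 < sep l v.1
      · obtain ⟨-, h1, h2, l', h3, h4, h5⟩ := h.reach (d.mem_S_or_R hv) h1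
        simp only at h1 h2 h3 h4 h5
        have hparity : sep i v.1 = 3 ∧ sep i l' = 2 := by
          simp only [sep] at *
          omega
        exact Or.inr ⟨hparity.1, h2, l', hparity.2, h4, h5⟩
      · have h2 : sep i v.1 = 2 ∧ sep l v.1 = 1 := by omega
        refine Or.inl ⟨h2.1, l, hl, h2.2, ?_⟩
        rcases d.mem_S_or_R hv with hv | hv
        · left
          rw [hback _ v h2.2 hv]
          exact hv
        · rcases h.R_le _ v hv with rfl | ⟨x, hx, hv⟩
          · simp [sep_self] at h2
          · rw [adj_iff] at hx
            rcases hx with ⟨hx, -⟩ | ⟨hx, hx'⟩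
            · left
              obtain ⟨l', b⟩ := x
              simp only at hx
              subst hx
              rw [hback _ v h2.2 hv]
              exact hv
            · right
              obtain ⟨j, b⟩ := x
              simp only at hx hx'
              subst hx
              have h3 := h.S_le _ v hv
              rw [adj_iff] at h3
              have h4 : sep j v.1 ≤ 1 := by
                rcases h3 with rfl | h3 | h3
                · simp [sep_self]
                · have : j = v.1 := h3.1
                  rw [this, sep_self]
                  omega
                · exact h3.2.le
              have h5 : j = v.1 := by
                simp only [sep] at *
                exact Fin.ext (by omega)
              rw [← h5]
              exact hv

-- Surviving columns carry every message to distance 1 as sent and to distance 2 as known. No set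
-- `Y` is needed yet, because the contaminated nodes also hold few fresh messages.
open Classical in
theorem PostRandom.spread (h : PostRandom P s F c)
    (d : DrawInv (cliquePath m k) F (c.locally fun u t s => s.startRanking P (ρ.tie u t s)) c')
    (hs : P.T + 1 ≤ s) (hT : 3 < P.T) (ht : 2 ≤ P.tau)
    (hf : ∀ u, Surv F u → (c.st u).fresh P ⊆ (c'.st u).S) :
    ∃ X, Spread P s F 1 X ∅ c' := by
  have htime : c.time ≤ c'.time := d.time_le
  have hknown : ∀ (i : Fin m) (v : Fin m × Fin k), Alive F v 0 → sep i v.1 ≤ 1 →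
      AtLeast s fun a => v ∈ (c'.st (i, a)).S := by
    intro i v hv hsep
    refine (h.lower v hv).mono fun a ha => ?_
    rcases Nat.lt_or_ge (sep i v.1) 1 with h0 | h1
    · have : i = v.1 := eq_of_sep_eq_zero (by omega)
      rw [this]
      exact d.S_mono _ ha.1
    · exact h.mem_S_after d hT hf (le_antisymm hsep h1) ha.1 (ha.2 i (by omega))
  -- A message reaches distance 3 only along its own column, and only if the node of that column at
  -- distance 2 from `u` sent it early. By `early` there are at most `2τ` such columns for each of
  -- two directions.
  let X : Finset (Fin m × Fin k) := Finset.univ.filter fun u =>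
    ∃ l j, sep u.1 l = 2 ∧ sep u.1 j = 3 ∧ sep l j = 1 ∧ (j, u.2) ∈ (c.st (l, u.2)).S
  refine ⟨X, d.sound, ?_, ?_, ?_, ?_, hknown, ?_, ?_⟩
  · intro i
    have hsub : (Finset.univ.filter fun a : Fin k => (i, a) ∈ X) ⊆
        (Finset.univ.filter fun j : Fin m => sep i j = 3).biUnion fun j =>
          Finset.univ.filter fun a : Fin k =>
            ∃ l, sep i l = 2 ∧ sep l j = 1 ∧ (j, a) ∈ (c.st (l, a)).S := by
      intro a ha
      simp only [X, Finset.mem_filter, Finset.mem_univ, true_and] at ha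
      obtain ⟨l, j, h1, h2, h3, h4⟩ := ha
      simp only [Finset.mem_biUnion, Finset.mem_filter, Finset.mem_univ, true_and]
      exact ⟨j, h2, l, h1, h3, h4⟩
    have h1 := (Finset.card_le_card hsub).trans (Finset.card_biUnion_le_card_mul _ _
      (2 * P.tau) ?_)
    · have h2 := Nat.mul_le_mul_right (2 * P.tau) (card_sep_eq_le i 3)
      omega
    · intro j hj
      have hj := (Finset.mem_filter.1 hj).2
      by_cases hl : ∃ l, sep i l = 2 ∧ sep l j = 1
      · obtain ⟨l, h1, h2⟩ := hl
        refine le_trans (Finset.card_le_card fun a ha => ?_) (h.early l j h2)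
        simp only [Finset.mem_filter, Finset.mem_univ, true_and] at ha ⊢
        obtain ⟨l', h3, h4, h5⟩ := ha
        have : l' = l := by
          simp only [sep] at *
          exact Fin.ext (by omega)
        rw [← this]
        exact h5
      · rw [Finset.filter_false_of_mem fun a _ ha => ?_]
        · simp
        · obtain ⟨l, h1, h2, -⟩ := ha
          exact hl ⟨l, h1, h2⟩
  · intro u v hv
    rcases h.S_after d hv with h1 | h1
    · exact Or.inl h1
    · exact Or.inr ⟨rfl, h1.2, h1.1.le⟩
  · intro u _ v hv
    by_cases h1 : 1 < sep u.1 v.1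
    · rcases h.R_after d hv h1 with h2 | h2
      · exact Or.inl h2.1.le
      · exact Or.inr h2.2.1
    · exact Or.inl (by omega)
  · intro u _ hX v hv
    by_cases h1 : 1 < sep u.1 v.1
    · rcases h.R_after d hv h1 with h2 | ⟨h2, h3, l, h4, h5, h6⟩
      · exact h2.1.le
      · refine absurd (Finset.mem_filter.2 ⟨Finset.mem_univ u, l, v.1, h4, h2, h5, ?_⟩) hX
        rw [← h3] at h6 ⊢
        exact h6
    · omega
  · intro i v hv hsep
    obtain ⟨l, h1, h2⟩ := exists_toward hsep
    refine (h.lower v hv).mono fun a ha => ?_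
    have hi : Surv F (i, a) := ha.2 i (by omega)
    refine ⟨hi, Finset.notMem_empty _, d.sound.known _ (hi.alive _) (l, a) ?_
      (h.mem_S_after d hT hf h2 ha.1 (ha.2 l (by omega)))⟩
    rw [adj_iff]
    exact Or.inr ⟨rfl, h1⟩
  · intro u hu _
    have hsub : (c'.st u).fresh P ⊆ (Finset.univ.filter fun l : Fin m => sep u.1 l = 1).biUnion
        fun l => ((c'.st u).fresh P).filter fun v => sep l v.1 < sep u.1 v.1 ∧
          1 < sep u.1 v.1 := by
      intro v hv
      have hv' := mem_fresh.1 hv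
      have hfar : 1 < sep u.1 v.1 := by
        by_contra hcon
        have := d.sound.le_cnt (hu.alive _) hs
          (hknown u.1 v (d.sound.origin u (hu.alive _) v hv'.1) (not_lt.1 hcon))
        exact this.not_gt hv'.2.2
      obtain ⟨l, h1, h2⟩ := exists_toward (p := sep u.1 v.1 - 1) (i := u.1) (j := v.1) (by omega)
      simp only [Finset.mem_biUnion, Finset.mem_filter, Finset.mem_univ, true_and]
      exact ⟨l, h1, hv, by omega, hfar⟩
    -- Per direction: `2τ` messages that crossed early, `1 + τ` sent by the node of the same column
    -- in the clique of origin, and one from distance 3. Finally `2(3τ + 2) ≤ 8τ`, since `τ ≥ 2`.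
    have h1 := (Finset.card_le_card hsub).trans (Finset.card_biUnion_le_card_mul _ _
      (3 * P.tau + 2) ?_)
    · have h2 := Nat.mul_le_mul_right (3 * P.tau + 2) (card_sep_eq_le u.1 1)
      omega
    · intro l hl
      have hl := (Finset.mem_filter.1 hl).2
      have hcases : ∀ v ∈ ((c'.st u).fresh P).filter (fun v => sep l v.1 < sep u.1 v.1 ∧
          1 < sep u.1 v.1),
          (sep u.1 v.1 = 2 ∧ sep l v.1 = 1 ∧
            (v ∈ (c.st (l, v.2)).S ∨ v ∈ (c.st (v.1, u.2)).S)) ∨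
          (sep u.1 v.1 = 3 ∧ v.2 = u.2) := by
        intro v hv
        obtain ⟨hv, h2, h3⟩ := Finset.mem_filter.1 hv
        rcases h.R_after d (mem_fresh.1 hv).1 h3 with ⟨h4, l', h5, h6, h7⟩ | h4
        · obtain rfl := toward_unique hl h5 h2 (by omega)
          exact Or.inl ⟨h4, h6, h7⟩
        · exact Or.inr ⟨h4.1, h4.2.1⟩
      have hfar : (((c'.st u).fresh P).filter fun v => (sep l v.1 < sep u.1 v.1 ∧
          1 < sep u.1 v.1) ∧ ¬ sep u.1 v.1 = 2).card ≤ 1 := by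
        rw [Finset.card_le_one]
        intro v hv v' hv'
        obtain ⟨hv, h2, h3⟩ := Finset.mem_filter.1 hv
        obtain ⟨hv', h2', h3'⟩ := Finset.mem_filter.1 hv'
        have h4 := (hcases v (Finset.mem_filter.2 ⟨hv, h2⟩)).resolve_left fun h => h3 h.1
        have h4' := (hcases v' (Finset.mem_filter.2 ⟨hv', h2'⟩)).resolve_left fun h => h3' h.1
        exact Prod.ext (eq_of_toward h2.1 h2'.1 (h4.1.trans h4'.1.symm))
          (h4.2.trans h4'.2.symm)
      have hnear : (((c'.st u).fresh P).filter fun v => (sep l v.1 < sep u.1 v.1 ∧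
          1 < sep u.1 v.1) ∧ sep u.1 v.1 = 2).card ≤ 3 * P.tau + 1 := by
        by_cases hj : ∃ j, sep l j = 1 ∧ sep u.1 j = 2
        · obtain ⟨j, hj1, hj2⟩ := hj
          have hsub2 : (((c'.st u).fresh P).filter fun v => (sep l v.1 < sep u.1 v.1 ∧
              1 < sep u.1 v.1) ∧ sep u.1 v.1 = 2) ⊆
              (Finset.univ.filter fun b : Fin k => (j, b) ∈ (c.st (l, b)).S).image
                (fun b => (j, b)) ∪ (c.st (j, u.2)).S := by
            intro v hv
            obtain ⟨hv, h2, h3⟩ := Finset.mem_filter.1 hv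
            have h4 : v.1 = j := eq_of_toward h2.1 (by omega) (h3.trans hj2.symm)
            rcases hcases v (Finset.mem_filter.2 ⟨hv, h2⟩) with ⟨-, -, h5⟩ | h5
            · rw [Finset.mem_union]
              rcases h5 with h5 | h5
              · left
                refine Finset.mem_image.2 ⟨v.2, Finset.mem_filter.2 ⟨Finset.mem_univ _, ?_⟩, ?_⟩
                · rw [← h4]
                  exact h5
                · rw [← h4]
              · right
                rw [← h4]
                exact h5
            · omega
          refine (Finset.card_le_card hsub2).trans ((Finset.card_union_le _ _).trans ?_)
          have h5 := (Finset.card_image_le (f := fun b => (j, b))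
            (s := Finset.univ.filter fun b : Fin k => (j, b) ∈ (c.st (l, b)).S)).trans
            (h.early l j hj1)
          have h6 := h.S_card (j, u.2)
          omega
        · rw [Finset.filter_false_of_mem fun v hv hc => ?_]
          · simp
          · rcases hcases v (Finset.mem_filter.2 ⟨hv, hc.1⟩) with h5 | h5
            · exact hj ⟨v.1, h5.2.1, h5.1⟩
            · omega
      rw [← Finset.card_filter_add_card_filter_not (fun v => sep u.1 v.1 = 2),
        Finset.filter_filter, Finset.filter_filter]
      omega

end FirstRanking

/-! ### The later phases -/

section LaterPhases

variable {m k : ℕ} {N : ℕ} {F : Schedule (Fin m × Fin k) N} {P : Params} {s p : ℕ}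
  {X Y : Finset (Fin m × Fin k)} {ρ : Rules (Fin m × Fin k)} {c c' : Config (Fin m × Fin k)}

/-! ### From shuffle phase `p` to ranking phase `p + 1`. -/

theorem Shuffled.cnt_le_three (h : Shuffled P s F p X c) {u v : Fin m × Fin k}
    (hu : Alive F u c.time) (hsep : p + 1 ≤ sep u.1 v.1) : (c.st u).cnt v ≤ 3 := by
  refine h.sound.cnt_le_three hu ?_ ?_
  · rintro rfl
    simp [sep_self] at hsep
  · intro w hw hv
    rcases h.S_le w v hv with h1 | h1
    · rw [hw] at h1
      omega
    · exact h1.2.1.symm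

/-- Messages from beyond distance `p` are still fresh, and the only fresh messages in the buffer are
the selected ones. This stops stray messages from running ahead. -/
theorem Shuffled.mem_sel_of_mem_buffer (h : Shuffled P s F p X c) (hT : 3 < P.T)
    {u v : Fin m × Fin k} (hu : Alive F u c.time) (hsep : p + 1 ≤ sep u.1 v.1)
    (hv : v ∈ (c.st u).rankingBuffer P) : v ∈ (c.st u).sel.getD ∅ := by
  obtain ⟨A, hA, -⟩ := h.sel u
  simp only [NodeState.rankingBuffer, hA, Finset.mem_filter] at hv
  rw [hA]
  refine hv.2.resolve_right fun h1 => ?_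
  have h2 : ((c.st u).cnt v : ℝ) ≤ 3 := by exact_mod_cast h.cnt_le_three hu hsep
  linarith

theorem Shuffled.mem_sel (h : Shuffled P s F p X c) {u v : Fin m × Fin k}
    (hu : Alive F u c.time) (hv : v ∈ (c.st u).sel.getD ∅) :
    v ∈ (c.st u).R ∧ sep u.1 v.1 = p + 1 := by
  obtain ⟨A, hA, -⟩ := h.sel u
  rw [hA] at hv
  exact h.sel_sub u hu A hA v hv

theorem Shuffled.card_sel_le (h : Shuffled P s F p X c) (u : Fin m × Fin k) :
    ((c.st u).sel.getD ∅).card ≤ 4 * P.tau := by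
  obtain ⟨A, hA, hcard⟩ := h.sel u
  rw [hA]
  exact hcard

/-- The nodes of `chosen` send `v` in their clique, and their partners, which also survive outside
`X`, become the holders one clique further. The contaminated set stays `X`, because every message
newly sent comes from within distance `p + 1`. -/
theorem Shuffled.spread (h : Shuffled P s F p X c)
    (d : DrawInv (cliquePath m k) F (c.locally fun u t s => s.startRanking P (ρ.tie u t s)) c')
    (hs : P.T + 1 ≤ s) (hT : 3 < P.T)
    (hf : ∀ u, Surv F u → (c.st u).sel.getD ∅ ∩ (c.st u).B ⊆ (c'.st u).S) :
    Spread P s F (p + 1) X X c' := by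
  classical
  have htime : c.time ≤ c'.time := d.time_le
  have hsent : ∀ u v, Surv F u → v ∈ (c.st u).sel.getD ∅ → v ∈ (c'.st u).S := by
    intro u v hu hv
    by_cases hS : v ∈ (c.st u).S
    · exact d.S_mono u hS
    · exact hf u hu (Finset.mem_inter.2
        ⟨hv, Finset.mem_sdiff.2 ⟨(h.mem_sel (hu.alive _) hv).1, hS⟩⟩)
  have hS : ∀ u, ∀ v ∈ (c'.st u).S, sep u.1 v.1 ≤ p + 1 := by
    intro u v hv
    rcases d.mem_S_cases hv with hv | ⟨hu, hv⟩
    · rcases h.S_le u v hv with h1 | h1 <;> omega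
    · by_contra hcon
      have := (h.mem_sel hu (h.mem_sel_of_mem_buffer hT hu (by omega) hv)).2
      omega
  have hR : ∀ u, ∀ v ∈ (c'.st u).R, v ∈ (c.st u).R ∨ sep u.1 v.1 ≤ p + 1 + 1 := by
    intro u v hv
    rcases d.R_le u v hv with hv | ⟨w, hw, hv⟩
    · exact Or.inl hv
    · have h1 := hS w v hv
      have h2 := sep_triangle u.1 w.1 v.1
      rw [adj_iff] at hw
      rcases hw with hw | hw
      · rw [← hw.1] at h1
        omega
      · omega
  have hknown : ∀ (i : Fin m) (v : Fin m × Fin k), Alive F v 0 → sep i v.1 ≤ p + 1 →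
      AtLeast s fun a => v ∈ (c'.st (i, a)).S := by
    intro i v hv hsep
    rcases Nat.lt_or_ge (sep i v.1) (p + 1) with h1 | h1
    · exact (h.known i v hv (by omega)).mono fun a ha => d.S_mono _ ha
    · exact (h.chosen i v hv (le_antisymm hsep h1)).mono fun a ha =>
        hsent _ _ (ha.1 i (by simp [sep_self])).1 ha.2
  refine ⟨d.sound, h.X_card, fun u v hv => Or.inl (hS u v hv), ?_, ?_, hknown, ?_, ?_⟩
  · intro u hu v hv
    rcases hR u v hv with hv | h1
    · rcases h.R_le u (hu.mono htime) v hv with h1 | h1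
      · exact Or.inl (by omega)
      · exact Or.inr h1
    · exact Or.inl h1
  · intro u hu hX v hv
    rcases hR u v hv with hv | h1
    · exact (h.R_le' u (hu.mono htime) hX v hv).trans (Nat.le_succ _)
    · exact h1
  · intro i v hv hsep
    obtain ⟨l, h1, h2⟩ := exists_toward hsep
    refine (h.chosen l v hv h2).mono fun a ha => ?_
    obtain ⟨hi, hiX⟩ := ha.1 i (by rw [sep_comm]; exact h1.le)
    refine ⟨hi, hiX, d.sound.known _ (hi.alive _) (l, a) ?_
      (hsent _ _ (ha.1 l (by simp [sep_self])).1 ha.2)⟩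
    rw [adj_iff]
    exact Or.inr ⟨rfl, h1⟩
  · intro u hu hX
    -- Outside `X`, a fresh message comes from distance `p + 2` and is new. It was therefore a
    -- selected message of one of the two matched neighbours, which gives `2 · 4τ`.
    have hsub : (c'.st u).fresh P ⊆ (Finset.univ.filter fun w : Fin m × Fin k =>
        u.2 = w.2 ∧ sep u.1 w.1 = 1).biUnion fun w => (c.st w).sel.getD ∅ := by
      intro v hv
      rw [mem_fresh] at hv
      obtain ⟨hvR, -, hcnt⟩ := hv
      have hfar : p + 1 < sep u.1 v.1 := by
        by_contra hcon
        have := d.sound.le_cnt (hu.alive _) hs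
          (hknown u.1 v (d.sound.origin u (hu.alive _) v hvR) (not_lt.1 hcon))
        exact this.not_gt hcnt
      have hnR : v ∉ (c.st u).R := fun hvR => by
        have := h.R_le' u (hu.alive _) hX v hvR
        omega
      obtain ⟨w, hw, hv⟩ := (d.R_le u v hvR).resolve_left hnR
      rcases d.mem_S_cases hv with hv | ⟨hwa, hv⟩
      · exact absurd (h.sound.known u (hu.alive _) w hw hv) hnR
      · rw [adj_iff] at hw
        have htri := sep_triangle u.1 w.1 v.1
        rcases hw with hw | hw
        · rw [hw.1] at hfar
          have := (h.mem_sel hwa (h.mem_sel_of_mem_buffer hT hwa (by omega) hv)).2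
          omega
        · simp only [Finset.mem_biUnion, Finset.mem_filter, Finset.mem_univ, true_and]
          exact ⟨w, hw, h.mem_sel_of_mem_buffer hT hwa (by omega) hv⟩
    have h1 := (Finset.card_le_card hsub).trans (Finset.card_biUnion_le_card_mul _ _
      (4 * P.tau) fun w _ => h.card_sel_le w)
    have h2 := Nat.mul_le_mul_right (4 * P.tau) (card_matched_le u)
    omega

/-! ### From ranking phase `p` through shuffle phase `p`. -/

theorem Spread.cnt_le_three (h : Spread P s F p X Y c) {u v : Fin m × Fin k}
    (hu : Alive F u c.time) (hsep : p + 1 ≤ sep u.1 v.1) : (c.st u).cnt v ≤ 3 := by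
  refine h.sound.cnt_le_three hu ?_ ?_
  · rintro rfl
    simp [sep_self] at hsep
  · intro w hw hv
    rcases h.S_le w v hv with h1 | h1
    · rw [hw] at h1
      omega
    · exact h1.2.1.symm

/-- Only messages from the next cliques pass the filter. -/
theorem Spread.of_mem_filtered (h : Spread P s F p X Y c)
    (e : ShuffleEnd (cliquePath m k) F P c c') (hp : 1 ≤ p) (hs : P.T + 1 ≤ s)
    (hc : 4 < P.cHat * P.T) {u v : Fin m × Fin k} (hu : Alive F u c'.time)
    (hv : v ∈ (c'.st u).filtered P) : Alive F v 0 ∧ sep u.1 v.1 = p + 1 := by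
  classical
  have huc : Alive F u c.time := hu.mono (by have := e.time; omega)
  simp only [NodeState.filtered, Finset.mem_filter, Finset.mem_univ, true_and, e.cnt_eq] at hv
  obtain ⟨hpos, hle, hcnt⟩ := hv
  have hv0 : Alive F v 0 := by
    by_contra hv0
    have h1 := e.upper u v fun h1 => hv0 (h1.2.mono (Nat.zero_le _))
    rw [if_neg, Finset.filter_false_of_mem] at h1
    · simp only [Finset.card_empty, add_zero, Nat.le_zero] at h1
      omega
    · exact fun w _ hw => hv0 (h.sound.origin w hw.2.1 v (mem_fresh.1 hw.2.2).1)
    · exact fun hw => hv0 (h.sound.origin u huc v (mem_fresh.1 hw).1)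
  refine ⟨hv0, ?_⟩
  have h1 : p < sep u.1 v.1 := by
    by_contra hcon
    exact (h.sound.le_cnt huc hs (h.known u.1 v hv0 (not_lt.1 hcon))).not_gt hcnt
  by_contra hne
  have h2 := e.upper u v ?_
  · have h3 : (Finset.univ.filter fun w => (cliquePath m k).Adj u w ∧ Alive F w c.time ∧
        v ∈ (c.st w).fresh P).card ≤ 3 := by
      refine le_trans (Finset.card_le_card (t := {(u.1, v.2)} ∪ Finset.univ.filter
        fun w : Fin m × Fin k => u.2 = w.2 ∧ sep u.1 w.1 = 1) ?_)
        ((Finset.card_union_le _ _).trans ?_)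
      · intro w hw
        simp only [Finset.mem_union, Finset.mem_filter, Finset.mem_univ, true_and,
          Finset.mem_singleton, adj_iff] at hw ⊢
        rcases hw with ⟨hw | hw, hwa, hwv⟩
        · left
          refine Prod.ext hw.1.symm ?_
          rcases h.R_le w hwa v (mem_fresh.1 hwv).1 with h4 | h4
          · rw [← hw.1] at h4
            omega
          · exact h4.symm
        · exact Or.inr hw
      · have := card_matched_le u
        rw [Finset.card_singleton]
        omega
    have h4 : (c'.st u).phasecnt v ≤ 4 := by
      split_ifs at h2 <;> omega
    have h5 : ((c'.st u).phasecnt v : ℝ) ≤ 4 := by exact_mod_cast h4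
    linarith
  · rintro ⟨h3, -⟩
    rw [adj_iff] at h3
    rcases h3 with h3 | h3
    · rw [h3.1, sep_self] at h1
      omega
    · omega

/-- All messages from the next cliques pass the filter. -/
theorem Spread.mem_filtered (h : Spread P s F p X Y c)
    (e : ShuffleEnd (cliquePath m k) F P c c') (hs : P.T + 1 ≤ s) (hT : 3 < P.T)
    (hc : P.cHat ≤ 1) {u v : Fin m × Fin k} (hu : Alive F u c'.time)
    (hv : Alive F v 0) (hsep : sep u.1 v.1 = p + 1) : v ∈ (c'.st u).filtered P := by
  classical
  have huc : Alive F u c.time := hu.mono (by have := e.time; omega)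
  have hfresh : ∀ w : Fin m × Fin k, w.1 = u.1 → Alive F w c.time →
      ((c.st w).cnt v : ℝ) < P.T := by
    intro w hw hwa
    have h1 : ((c.st w).cnt v : ℝ) ≤ 3 := by
      exact_mod_cast h.cnt_le_three hwa (by rw [hw]; exact hsep.ge)
    linarith
  obtain ⟨D, hD, hDv⟩ := h.holders u.1 v hv hsep
  -- The node in the column of `v` is dropped: if `p = 1` it may have sent `v` already and then does
  -- not announce it. There remain `s - 1 ≥ T ≥ ĉT` announcements.
  have h1 := e.lower u hu v ((D.erase v.2).image fun a => (u.1, a)) ?_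
  · rw [Finset.card_image_of_injective _ (Prod.mk_right_injective u.1)] at h1
    have h2 := Finset.pred_card_le_card_erase (s := D) (a := v.2)
    have h3 : s ≤ (c'.st u).phasecnt v + 1 := by omega
    have h4 : (s : ℝ) ≤ (c'.st u).phasecnt v + 1 := by exact_mod_cast h3
    have h5 : P.T ≤ (c'.st u).phasecnt v := by linarith
    simp only [NodeState.filtered, Finset.mem_filter, Finset.mem_univ, true_and, e.cnt_eq]
    refine ⟨?_, ?_, hfresh u rfl huc⟩
    · have : (0 : ℝ) < (c'.st u).phasecnt v := by linarith
      exact_mod_cast this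
    · exact (mul_le_of_le_one_left (by linarith) hc).trans h5
  · intro w hw
    obtain ⟨a, ha, rfl⟩ := Finset.mem_image.1 hw
    obtain ⟨hne, ha⟩ := Finset.mem_erase.1 ha
    obtain ⟨h2, h3, h4⟩ := hDv a ha
    refine ⟨?_, h2.alive, mem_fresh.2 ⟨h4, ?_, hfresh _ rfl (h2.alive _)⟩, h.fresh_card _ h2 h3⟩
    · by_cases hau : a = u.2
      · exact Or.inl (by rw [hau])
      · right
        rw [adj_iff]
        exact Or.inl ⟨rfl, fun h => hau h.symm⟩
    · intro hS
      rcases h.S_le _ v hS with h5 | h5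
      · have : sep u.1 v.1 ≤ p := h5
        omega
      · exact hne h5.2.1.symm

theorem Spread.card_filtered_le (h : Spread P s F p X Y c)
    (e : ShuffleEnd (cliquePath m k) F P c c') (hp : 1 ≤ p) (hs : P.T + 1 ≤ s)
    (hc : 4 < P.cHat * P.T) {u : Fin m × Fin k} (hu : Alive F u c'.time) :
    ((c'.st u).filtered P).card ≤ 2 * k := by
  classical
  exact (Finset.card_le_card fun v hv => Finset.mem_filter.2
    ⟨Finset.mem_univ v, (h.of_mem_filtered e hp hs hc hu hv).2⟩).trans
    (card_clique_sep_eq_le u.1 (p + 1))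

/-- The phase adds only messages from distance `p + 1`, so all bounds on reach survive. The random
selections enter only through `hch`. -/
theorem Spread.shuffled (h : Spread P s F p X Y c)
    (e : ShuffleEnd (cliquePath m k) F P c c') (hp : 1 ≤ p) (hs : P.T + 1 ≤ s)
    (hc : 4 < P.cHat * P.T) (A : Fin m × Fin k → Finset (Fin m × Fin k))
    (hA : ∀ u, A u ⊆ (c'.st u).filtered P ∧ (A u).card ≤ 4 * P.tau)
    (hch : ∀ i v, Alive F v 0 → sep i v.1 = p + 1 →
      AtLeast s fun a => (∀ j, sep i j ≤ 1 → Surv F (j, a) ∧ (j, a) ∉ X) ∧ v ∈ A (i, a)) :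
    Shuffled P s F p X (c'.locally fun u _ s => s.endShuffle P (A u)) := by
  classical
  have ht : c.time ≤ c'.time := by have := e.time; omega
  have hS : ∀ u, ((c'.locally fun u _ s => s.endShuffle P (A u)).st u).S = (c.st u).S := e.S_eq
  have hR : ∀ u, ((c'.locally fun u _ s => s.endShuffle P (A u)).st u).R =
      (c.st u).R ∪ (c'.st u).filtered P := by
    intro u
    rw [← e.R_eq u]
    rfl
  have hold : ∀ u, Alive F u c'.time → ∀ v ∈ (c.st u).R ∪ (c'.st u).filtered P,
      v ∈ (c.st u).R ∨ (Alive F v 0 ∧ sep u.1 v.1 = p + 1) := by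
    intro u hu v hv
    rcases Finset.mem_union.1 hv with hv | hv
    · exact Or.inl hv
    · exact Or.inr (h.of_mem_filtered e hp hs hc hu hv)
  refine ⟨h.sound.of_eq ht hS e.cnt_eq (fun u => ?_) (fun u hu v hv => ?_), h.X_card, ?_, ?_, ?_,
    ?_, fun u => ⟨A u, rfl, (hA u).2⟩, ?_, hch⟩
  · rw [hR]
    exact Finset.subset_union_left
  · rw [hR] at hv
    rcases hold u hu v hv with hv | hv
    · exact h.sound.origin u (hu.mono ht) v hv
    · exact hv.1
  · intro u v hv
    rw [hS] at hv
    exact h.S_le u v hv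
  · intro u hu v hv
    rw [hR] at hv
    rcases hold u hu v hv with hv | hv
    · exact h.R_le u (hu.mono ht) v hv
    · exact Or.inl hv.2.le
  · intro u hu hX v hv
    rw [hR] at hv
    rcases hold u hu v hv with hv | hv
    · exact h.R_le' u (hu.mono ht) hX v hv
    · exact hv.2.le
  · intro i v hv hsep
    simpa only [hS] using h.known i v hv hsep
  · intro u hu A' hA' v hv
    have : A u = A' := Option.some_injective _ hA'
    subst this
    have hv' := (hA u).1 hv
    refine ⟨?_, (h.of_mem_filtered e hp hs hc hu hv').2⟩
    rw [hR]
    exact Finset.mem_union_right _ hv'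

end LaterPhases

/-! ### The phases succeed with high probability -/

section Phases

variable {m k : ℕ} {N : ℕ} {F : Schedule (Fin m × Fin k) N} {P : Params} {s f p : ℕ} {e : ℝ≥0∞}
  {X Y : Finset (Fin m × Fin k)} {ρ : Rules (Fin m × Fin k)} {c : Config (Fin m × Fin k)}

/-- The relations between the parameters on which the analysis relies: `s` is a threshold above
`T`, `f` bounds the number of failures in a clique, and `e` the probability of the elementary
failure events of the algorithm. -/
structure Regime (m k : ℕ) (P : Params) (s f : ℕ) (e : ℝ≥0∞) : Prop where
  k_pos : 0 < k
  thr : P.T + 1 ≤ s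
  T_gt : 3 < P.T
  tau_ge : 2 ≤ P.tau
  cHat_le : P.cHat ≤ 1
  cHat_mul : 4 < P.cHat * P.T
  ranking : (1 - ((8 * P.tau : ℕ) : ℝ≥0∞)⁻¹ * (harmonicSum (m * k))⁻¹) ^ P.tau' ≤ e
  -- A good column avoids failures and `X` in three consecutive cliques. In `random` it avoids
  -- failures in five cliques, and the column of `v` itself is left out.
  selection : ∀ K, k - 3 * (f + 4 * P.tau) ≤ K →
    2 ^ s * (2⁻¹ + 2⁻¹ * (1 - (4 * P.tau : ℕ) / (2 * k : ℕ))) ^ K ≤ e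
  random : ∀ K, k - 5 * f - 1 ≤ K →
    2 ^ s * (2⁻¹ + 2⁻¹ * (1 - 1⁻¹ * ((k + 1 : ℕ) : ℝ≥0∞)⁻¹) ^ P.tau) ^ K ≤ e
  early : ∀ K ≤ k, (2 ^ (2 * P.tau + 1))⁻¹ *
    (1 + P.tau * ((k - f - 1 : ℕ) : ℝ≥0∞)⁻¹) ^ K ≤ e

open Classical in
/-- At most `f` nodes of each clique fail. -/
def FewFailures (f : ℕ) (F : Schedule (Fin m × Fin k) N) : Prop :=
  ∀ i, (Finset.univ.filter fun a : Fin k => ¬ Surv F (i, a)).card ≤ f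

open Classical in
theorem card_sep_le_le (i : Fin m) (r : ℕ) :
    (Finset.univ.filter fun l : Fin m => sep i l ≤ r).card ≤ 2 * r + 1 := by
  refine le_trans (Finset.card_le_card_of_injOn (fun l : Fin m => (l : ℕ) + r - i)
    (t := Finset.range (2 * r + 1)) ?_ ?_) (Finset.card_range _).le
  · intro l hl
    have hl := (Finset.mem_filter.1 (Finset.mem_coe.1 hl)).2
    simp only [sep] at hl
    simp only [Finset.coe_range, Set.mem_Iio]
    omega
  · intro l hl l' hl' h
    have hl := (Finset.mem_filter.1 (Finset.mem_coe.1 hl)).2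
    have hl' := (Finset.mem_filter.1 (Finset.mem_coe.1 hl')).2
    simp only [sep] at hl hl' h
    exact Fin.ext (by omega)

open Classical in
/-- Most columns are good in all cliques nearby. -/
theorem le_card_columns (i : Fin m) (r b : ℕ) (q : Fin m → Fin k → Prop)
    (hq : ∀ j, (Finset.univ.filter fun a => ¬ q j a).card ≤ b) :
    k - (2 * r + 1) * b ≤
      (Finset.univ.filter fun a => ∀ j, sep i j ≤ r → q j a).card := by
  have hsub : (Finset.univ.filter fun a => ¬ ∀ j, sep i j ≤ r → q j a) ⊆
      (Finset.univ.filter fun l : Fin m => sep i l ≤ r).biUnion fun j =>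
        Finset.univ.filter fun a => ¬ q j a := by
    intro a ha
    simp only [Finset.mem_filter, Finset.mem_univ, true_and, not_forall] at ha
    obtain ⟨j, h1, h2⟩ := ha
    simp only [Finset.mem_biUnion, Finset.mem_filter, Finset.mem_univ, true_and]
    exact ⟨j, h1, h2⟩
  have h1 := (Finset.card_le_card hsub).trans
    (Finset.card_biUnion_le_card_mul _ _ b fun j _ => hq j)
  have h2 := Nat.mul_le_mul_right b (card_sep_le_le i r)
  have h3 := Finset.card_filter_add_card_filter_not (s := (Finset.univ : Finset (Fin k)))
    (fun a => ∀ j, sep i j ≤ r → q j a)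
  rw [Finset.card_univ, Fintype.card_fin] at h3
  omega

theorem startRandom_hatB_card_le (hk : 0 < k) (u : Fin m × Fin k) :
    (((afterRoundZero (cliquePath m k) F).locally fun _ _ => NodeState.startRandom).st u).hatB.card
      ≤ k + 1 ∨ ¬ Alive F u 0 := by
  classical
  by_cases hu : Alive F u 0
  swap
  · exact Or.inr hu
  left
  have hsub : (((afterRoundZero (cliquePath m k) F).locally
      fun _ _ => NodeState.startRandom).st u).hatB ⊆
      ((Finset.univ.erase u.2).image fun a => (u.1, a)) ∪ Finset.univ.filter
        fun w : Fin m × Fin k => u.2 = w.2 ∧ sep u.1 w.1 = 1 := by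
    intro v hv
    have hv' := Finset.mem_sdiff.1 (show v ∈ ((afterRoundZero (cliquePath m k) F).st u).R \
      ((afterRoundZero (cliquePath m k) F).st u).S from hv)
    rw [afterRoundZero_S, if_pos hu, Finset.mem_singleton] at hv'
    have h1 := ((afterRoundZero_R hv'.1).resolve_left hv'.2).1
    rw [adj_iff] at h1
    rw [Finset.mem_union]
    rcases h1 with h1 | h1
    · left
      refine Finset.mem_image.2 ⟨v.2, Finset.mem_erase.2 ⟨h1.2.symm, Finset.mem_univ _⟩, ?_⟩
      rw [h1.1]
    · exact Or.inr (Finset.mem_filter.2 ⟨Finset.mem_univ _, h1⟩)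
  refine (Finset.card_le_card hsub).trans ((Finset.card_union_le _ _).trans ?_)
  have h1 := (Finset.card_image_le (s := Finset.univ.erase u.2) (f := fun a => (u.1, a)))
  rw [Finset.card_erase_of_mem (Finset.mem_univ _), Finset.card_univ, Fintype.card_fin] at h1
  have h2 := card_matched_le u
  omega

theorem mem_startRandom_hatB {u v : Fin m × Fin k} (hu : Alive F u 1) (hv : Alive F v 0)
    (h : (cliquePath m k).Adj u v) : v ∈ (((afterRoundZero (cliquePath m k) F).locally
      fun _ _ => NodeState.startRandom).st u).hatB := by
  refine Finset.mem_sdiff.2 ⟨sound_afterRoundZero.known u hu v h ?_, ?_⟩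
  · rw [afterRoundZero_S, if_pos hv]
    exact Finset.mem_singleton_self v
  · rw [afterRoundZero_S, if_pos (hu.mono zero_le_one), Finset.mem_singleton]
    exact h.ne'

/-- Each good node holds `v` in a buffer of size at most `k + 1` with equal weights, so `L = 1` and
`H = k + 1`. -/
theorem prob_random_lower (hr : Regime m k P s f e) (hF : FewFailures f F)
    (v : Fin m × Fin k) (hv : Alive F v 0) :
    (randomPhase (cliquePath m k) P F (afterRoundZero (cliquePath m k) F)).toOuterMeasure
      {c | ¬ AtLeast s fun a => v ∈ (c.st (v.1, a)).S ∧ ∀ j, sep j v.1 ≤ 2 → Surv F (j, a)} ≤ e := by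
  classical
  let K : Finset (Fin m × Fin k) := ((Finset.univ.filter
    fun a : Fin k => ∀ j, sep v.1 j ≤ 2 → Surv F (j, a)).erase v.2).image fun a => (v.1, a)
  have hK : ∀ u ∈ K, u.1 = v.1 ∧ u.2 ≠ v.2 ∧ ∀ j, sep v.1 j ≤ 2 → Surv F (j, u.2) := by
    intro u hu
    obtain ⟨a, ha, rfl⟩ := Finset.mem_image.1 hu
    obtain ⟨h1, h2⟩ := Finset.mem_erase.1 ha
    exact ⟨rfl, h1, (Finset.mem_filter.1 h2).2⟩
  have hKs : ∀ u ∈ K, Surv F u := by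
    intro u hu
    obtain ⟨h1, -, h2⟩ := hK u hu
    have := h2 u.1 (by rw [h1, sep_self]; omega)
    exact this
  refine le_trans (prob_mono _ fun c hc hbad => ?_) ((prob_few_draws (cliquePath m k) F K
    (fun u hu => (hKs u hu).alive) v 1 ((k + 1 : ℕ) : ℝ≥0∞) P.tau _ (fun u hu => ?_) s).trans
      (hr.random K.card ?_))
  · refine fun hgood => hbad (hgood.map Prod.snd ?_ ?_)
    · intro u u' hu hu' h
      exact Prod.ext ((hK u hu.1).1.trans (hK u' hu'.1).1.symm) h
    · intro u hu
      obtain ⟨h1, h2, h3⟩ := hK u hu.1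
      refine ⟨?_, fun j hj => h3 j (by rwa [sep_comm])⟩
      have h4 := hu.2
      rw [(drawInv_randomPhase hc).hatB_eq u, Finset.mem_sdiff, not_and_not_right] at h4
      rw [← h1]
      refine h4 (mem_startRandom_hatB ((hKs u hu.1).alive _) hv ?_)
      rw [adj_iff]
      exact Or.inl ⟨h1, h2⟩
  · obtain ⟨h1, h2, -⟩ := hK u hu
    refine ⟨mem_startRandom_hatB ((hKs u hu).alive _) hv ?_, ?_, ?_⟩
    · rw [adj_iff]
      exact Or.inl ⟨h1, h2⟩
    · simp [Config.locally, NodeState.startRandom]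
    · have h3 := (startRandom_hatB_card_le (F := F) hr.k_pos u).resolve_right
        (not_not_intro ((hKs u hu).alive _))
      calc _ = ((((afterRoundZero (cliquePath m k) F).locally
            fun _ _ => NodeState.startRandom).st u).hatB.card : ℝ≥0∞) := by
            simp [Config.locally, NodeState.startRandom]
        _ ≤ _ := by exact_mod_cast h3
  · have h1 := le_card_columns v.1 2 f (fun j a => Surv F (j, a)) hF
    have h2 : K.card = _ := Finset.card_image_of_injective _ (Prod.mk_right_injective v.1)
    have h3 := Finset.pred_card_le_card_erase
      (s := Finset.univ.filter fun a : Fin k => ∀ j, sep v.1 j ≤ 2 → Surv F (j, a)) (a := v.2)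
    omega

-- Each node of clique `i` has at least `k - f - 1` messages of its own clique in the buffer, so it
-- rarely draws its partner's message. About `τ` such draws are expected in the clique.
open Classical in
theorem prob_random_early (hr : Regime m k P s f e) (hF : FewFailures f F)
    (i j : Fin m) (hij : sep i j = 1) :
    (randomPhase (cliquePath m k) P F (afterRoundZero (cliquePath m k) F)).toOuterMeasure
      {c | ¬ (Finset.univ.filter fun b : Fin k => (j, b) ∈ (c.st (i, b)).S).card ≤ 2 * P.tau}
        ≤ e := by
  have hne : ∀ b : Fin k, ((j, b) : Fin m × Fin k) ≠ (i, b) := by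
    intro b hb
    have : j = i := (Prod.ext_iff.1 hb).1
    rw [this, sep_self] at hij
    omega
  let K : Finset (Fin m × Fin k) := (Finset.univ.filter fun b : Fin k => Alive F (i, b) 1 ∧
    (j, b) ∈ (((afterRoundZero (cliquePath m k) F).locally
      fun _ _ => NodeState.startRandom).st (i, b)).hatB).image fun b => (i, b)
  have hK : ∀ u ∈ K, u.1 = i ∧ Alive F u 1 ∧ (j, u.2) ∈ (((afterRoundZero (cliquePath m k)
      F).locally fun _ _ => NodeState.startRandom).st u).hatB := by
    intro u hu
    obtain ⟨b, hb, rfl⟩ := Finset.mem_image.1 hu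
    exact ⟨rfl, (Finset.mem_filter.1 hb).2⟩
  refine le_trans (prob_mono _ fun c hc hbad => ?_) ((prob_many_draws (cliquePath m k) F K
    (fun u => (j, u.2)) P.tau _ ((k - f - 1 : ℕ) : ℝ≥0∞) (fun u hu => ?_) (2 * P.tau + 1)).trans
      (hr.early K.card ?_))
  · refine ⟨(Finset.univ.filter fun b : Fin k => (j, b) ∈ (c.st (i, b)).S).image
      fun b => (i, b), ?_, ?_⟩
    · rw [Finset.card_image_of_injective _ (Prod.mk_right_injective i)]
      exact not_le.1 hbad
    · intro u hu
      obtain ⟨b, hb, rfl⟩ := Finset.mem_image.1 hu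
      have hb := (Finset.mem_filter.1 hb).2
      have d := drawInv_randomPhase hc
      refine ⟨Finset.mem_image.2 ⟨b, Finset.mem_filter.2 ⟨Finset.mem_univ _, ?_⟩, rfl⟩, ?_⟩
      · refine (d.S_le _ _ hb).resolve_left fun h0 => ?_
        have h0 : (j, b) ∈ ((afterRoundZero (cliquePath m k) F).st (i, b)).S := h0
        rw [afterRoundZero_S] at h0
        split_ifs at h0
        · exact hne b (Finset.mem_singleton.1 h0)
        · simp at h0
      · rw [d.hatB_eq, Finset.mem_sdiff]
        exact fun h => h.2 hb
  · obtain ⟨h1, h2, h3⟩ := hK u hu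
    refine ⟨h3, rfl, ?_⟩
    have h4 : ((Finset.univ.filter fun a : Fin k => Surv F (i, a)).erase u.2).image
        (fun a => (i, a)) ⊆ (((afterRoundZero (cliquePath m k) F).locally
          fun _ _ => NodeState.startRandom).st u).hatB := by
      intro w hw
      obtain ⟨a, ha, rfl⟩ := Finset.mem_image.1 hw
      obtain ⟨ha1, ha2⟩ := Finset.mem_erase.1 ha
      refine mem_startRandom_hatB h2 ((Finset.mem_filter.1 ha2).2.alive _) ?_
      rw [adj_iff]
      exact Or.inl ⟨h1, fun h => ha1 h.symm⟩
    have h5 := Finset.card_le_card h4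
    rw [Finset.card_image_of_injective _ (Prod.mk_right_injective i)] at h5
    have h6 := Finset.pred_card_le_card_erase
      (s := Finset.univ.filter fun a : Fin k => Surv F (i, a)) (a := u.2)
    have h7 := Finset.card_filter_add_card_filter_not (s := (Finset.univ : Finset (Fin k)))
      (fun a => Surv F (i, a))
    rw [Finset.card_univ, Fintype.card_fin] at h7
    have h8 := hF i
    exact_mod_cast (by omega : k - f - 1 ≤ _)
  · exact Finset.card_image_le.trans ((Finset.card_filter_le _ _).trans (by simp))

theorem prob_randomPhase (hr : Regime m k P s f e) (hF : FewFailures f F) :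
    (randomPhase (cliquePath m k) P F (afterRoundZero (cliquePath m k) F)).toOuterMeasure
      {c | ¬ PostRandom P s F c} ≤ (2 * ((m * k) * (m * k)) : ℕ) * e := by
  classical
  have hm : m ≤ m * k := Nat.le_mul_of_pos_right m hr.k_pos
  have hsq : m * k ≤ (m * k) * (m * k) := Nat.le_mul_self _
  have h1 := prob_exists_le (ι := Fin m × Fin k)
    (randomPhase (cliquePath m k) P F (afterRoundZero (cliquePath m k) F))
    (fun v => {c | Alive F v 0 ∧ ¬ AtLeast s fun a => v ∈ (c.st (v.1, a)).S ∧
      ∀ j, sep j v.1 ≤ 2 → Surv F (j, a)}) ((m * k) * (m * k)) e (by simpa using hsq) ?_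
  · have h2 := prob_exists_le (ι := Fin m × Fin m)
      (randomPhase (cliquePath m k) P F (afterRoundZero (cliquePath m k) F))
      (fun x => {c | sep x.1 x.2 = 1 ∧ ¬ (Finset.univ.filter
        fun b : Fin k => (x.2, b) ∈ (c.st (x.1, b)).S).card ≤ 2 * P.tau})
      ((m * k) * (m * k)) e (by simpa using Nat.mul_le_mul hm hm) ?_
    · refine le_trans (prob_mono _ fun c hc hbad => ?_)
        ((MeasureTheory.measure_union_le _ _).trans ((add_le_add h1 h2).trans (le_of_eq ?_)))
      · by_contra hgood
        rw [Set.mem_union, not_or] at hgood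
        obtain ⟨hg1, hg2⟩ := hgood
        have d := drawInv_randomPhase hc
        have hS0 : ∀ u, ∀ v ∈ (((afterRoundZero (cliquePath m k) F).locally
            fun _ _ => NodeState.startRandom).st u).S, v = u := by
          intro u v hv
          have hv : v ∈ ((afterRoundZero (cliquePath m k) F).st u).S := hv
          rw [afterRoundZero_S] at hv
          split_ifs at hv
          · exact Finset.mem_singleton.1 hv
          · simp at hv
        refine hbad ⟨d.sound, fun u => (d.sel_eq u).trans (afterRoundZero_sel u), ?_, ?_, ?_, ?_,
          ?_⟩
        · intro u v hv
          rcases d.S_le u v hv with hv | ⟨-, hv⟩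
          · exact Or.inl (hS0 u v hv)
          · rcases afterRoundZero_R (Finset.mem_sdiff.1 hv).1 with h3 | h3
            · exact Or.inl h3
            · exact Or.inr h3.1
        · intro u
          have h3 := d.S_card u
          have h4 := time_drawRounds (cliquePath m k) F _ _ c hc
          have h5 : (((afterRoundZero (cliquePath m k) F).locally
            fun _ _ => NodeState.startRandom).st u).S.card ≤ 1 :=
            Finset.card_le_one.2 fun a ha b hb => (hS0 u a ha).trans (hS0 u b hb).symm
          have h6 : ((afterRoundZero (cliquePath m k) F).locally
            fun _ _ => NodeState.startRandom).time = (afterRoundZero (cliquePath m k) F).time := rfl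
          omega
        · intro u v hv
          rcases d.R_le u v hv with hv | hv
          · rcases afterRoundZero_R hv with h3 | h3
            · exact Or.inl h3
            · exact Or.inr ⟨v, h3.1, d.sound.own v h3.2⟩
          · exact Or.inr hv
        · intro v hv
          by_contra hcon
          exact hg1 ⟨v, hv, hcon⟩
        · intro i j hij
          by_contra hcon
          exact hg2 ⟨(i, j), hij, hcon⟩
      · push_cast
        ring
    · intro x
      by_cases hx : sep x.1 x.2 = 1
      · exact (prob_mono _ fun c _ h => h.2).trans (prob_random_early hr hF x.1 x.2 hx)
      · exact (prob_mono _ (t := ∅) fun c _ h => hx h.1).trans (by simp)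
  · intro v
    by_cases hv : Alive F v 0
    · exact (prob_mono _ fun c _ h => h.2).trans (prob_random_lower hr hF v hv)
    · exact (prob_mono _ (t := ∅) fun c _ h => hv h.1).trans (by simp)

-- Nothing is selected yet, so the list is sorted by `cnt` and the fresh messages form its top.
open Classical in
theorem prob_rankingPhase_of_postRandom (hr : Regime m k P s f e) (h : PostRandom P s F c) :
    (rankingPhase (cliquePath m k) P ρ F c).toOuterMeasure
      {c' | ¬ ∃ X Y, Spread P s F 1 X Y c'} ≤ ((m * k) * (m * k) : ℕ) * e := by
  have h1 := prob_rankingPhase_missing (G := cliquePath m k) (F := F) P ρ c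
    (fun u => (c.st u).fresh P) (8 * P.tau) e (Finset.univ.filter (Surv F))
    (fun u hu => (Finset.mem_filter.1 hu).2.alive) (fun u hu => ⟨?_, ?_, ?_⟩) h.sound
    (by simpa using hr.ranking)
  · simp only [Fintype.card_prod, Fintype.card_fin] at h1
    refine le_trans (prob_mono _ fun c' hc' hbad => ?_) h1
    by_contra hgood
    obtain ⟨X, hX⟩ := h.spread (drawInv_rankingPhase h.sound hc') hr.thr hr.T_gt hr.tau_ge
      fun u hu => by_contra fun hcon =>
        hgood ⟨u, Finset.mem_filter.2 ⟨Finset.mem_univ _, hu⟩, hcon⟩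
    exact hbad ⟨X, ∅, hX⟩
  · simp only [NodeState.rankingBuffer, h.sel u]
    exact Finset.filter_subset _ _
  · exact h.card_fresh_le hr.thr hr.tau_ge ((Finset.mem_filter.1 hu).2.alive _)
  · intro key v hv v' hv' hprec
    have hv := (Finset.mem_filter.1 hv).2
    refine Finset.mem_filter.2 ⟨(c.st u).rankingBuffer_subset_B P hv', ?_⟩
    have h2 : (c.st u).cnt v' ≤ (c.st u).cnt v := by
      simp only [NodeState.Precedes, h.sel u, Option.getD_none, Finset.notMem_empty, if_false,
        lt_irrefl, false_or, true_and] at hprec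
      omega
    have h3 : ((c.st u).cnt v' : ℝ) ≤ (c.st u).cnt v := by exact_mod_cast h2
    exact h3.trans_lt hv

-- Now the selected messages form the top of the list.
open Classical in
theorem prob_rankingPhase_of_shuffled (hr : Regime m k P s f e) (h : Shuffled P s F p X c) :
    (rankingPhase (cliquePath m k) P ρ F c).toOuterMeasure
      {c' | ¬ ∃ X Y, Spread P s F (p + 1) X Y c'} ≤ ((m * k) * (m * k) : ℕ) * e := by
  have h1 := prob_rankingPhase_missing (G := cliquePath m k) (F := F) P ρ c
    (fun u => (c.st u).sel.getD ∅ ∩ (c.st u).B) (8 * P.tau) e (Finset.univ.filter (Surv F))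
    (fun u hu => (Finset.mem_filter.1 hu).2.alive) (fun u hu => ⟨?_, ?_, ?_⟩) h.sound
    (by simpa using hr.ranking)
  · simp only [Fintype.card_prod, Fintype.card_fin] at h1
    refine le_trans (prob_mono _ fun c' hc' hbad => ?_) h1
    by_contra hgood
    exact hbad ⟨X, X, h.spread (drawInv_rankingPhase h.sound hc') hr.thr hr.T_gt
      fun u hu => by_contra fun hcon =>
        hgood ⟨u, Finset.mem_filter.2 ⟨Finset.mem_univ _, hu⟩, hcon⟩⟩
  · intro v hv
    obtain ⟨A, hA, -⟩ := h.sel u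
    rw [hA] at hv
    simp only [NodeState.rankingBuffer, hA]
    exact Finset.mem_filter.2 ⟨(Finset.mem_inter.1 hv).2, Or.inl (Finset.mem_inter.1 hv).1⟩
  · have := (Finset.card_le_card (Finset.inter_subset_left (s₂ := (c.st u).B))).trans
      (h.card_sel_le u)
    omega
  · intro key v hv v' hv' hprec
    refine Finset.mem_inter.2 ⟨?_, (c.st u).rankingBuffer_subset_B P hv'⟩
    by_contra hcon
    simp only [NodeState.Precedes, if_pos (Finset.mem_inter.1 hv).1, if_neg hcon] at hprec
    omega

/-- The rounds of the phase are deterministic; the only randomness is in the final selections. -/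
theorem prob_shufflePhase (hr : Regime m k P s f e) (hF : FewFailures f F) (hp : 1 ≤ p)
    (h : Spread P s F p X Y c) :
    (shufflePhase (cliquePath m k) P ρ F c).toOuterMeasure
      {c' | ¬ Shuffled P s F p X c'} ≤ ((m * k) * (m * k) : ℕ) * e := by
  classical
  rw [shufflePhase, PMF.toOuterMeasure_map_apply]
  have E := shuffleEnd_of_iterate (G := cliquePath m k) (F := F) (ρ := ρ) P c
  set c' := (shuffleRound (cliquePath m k) ρ F)^[8 * P.tau]
    (c.locally fun _ _ => NodeState.startShuffle P)
  have hm : m ≤ m * k := Nat.le_mul_of_pos_right m hr.k_pos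
  have h1 := prob_exists_le (ι := Fin m × (Fin m × Fin k))
    (pmfPi fun u => selection P (c'.st u))
    (fun x => {A | (Alive F x.2 0 ∧ sep x.1 x.2.1 = p + 1) ∧ ¬ AtLeast s fun a =>
      (∀ j, sep x.1 j ≤ 1 → Surv F (j, a) ∧ (j, a) ∉ X) ∧ x.2 ∈ A (x.1, a)})
      ((m * k) * (m * k)) e (by simpa using Nat.mul_le_mul_right (m * k) hm) ?_
  · refine le_trans (prob_mono _ fun A hA hbad => ?_) h1
    by_contra hgood
    refine hbad (h.shuffled E hp hr.thr hr.cHat_mul A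
      (fun u => mem_support_selection (mem_support_of_mem_support_pmfPi hA u)) ?_)
    intro i v hv hsep
    by_contra hcon
    exact hgood ⟨(i, v), ⟨hv, hsep⟩, hcon⟩
  · rintro ⟨i, v⟩
    by_cases hv : Alive F v 0 ∧ sep i v.1 = p + 1
    swap
    · exact (prob_mono _ (t := ∅) fun c _ h => hv h.1).trans (by simp)
    let K : Finset (Fin m × Fin k) := (Finset.univ.filter fun a : Fin k =>
      ∀ j, sep i j ≤ 1 → Surv F (j, a) ∧ (j, a) ∉ X).image fun a => (i, a)
    have hK : ∀ u ∈ K, u.1 = i ∧ ∀ j, sep i j ≤ 1 → Surv F (j, u.2) ∧ (j, u.2) ∉ X := by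
      intro u hu
      obtain ⟨a, ha, rfl⟩ := Finset.mem_image.1 hu
      exact ⟨rfl, (Finset.mem_filter.1 ha).2⟩
    refine le_trans (prob_mono _ fun A _ hbad => ?_) ((prob_few_selected P c'.st K v (2 * k)
      (fun u hu => ?_) s).trans (hr.selection K.card ?_))
    · refine fun hgood => hbad.2 (hgood.map Prod.snd ?_ ?_)
      · intro u u' hu hu' h
        exact Prod.ext ((hK u hu.1).1.trans (hK u' hu'.1).1.symm) h
      · intro u hu
        obtain ⟨h2, h3⟩ := hK u hu.1
        refine ⟨h3, ?_⟩
        change v ∈ A (i, u.2)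
        rw [← h2]
        exact hu.2
    · obtain ⟨h2, h3⟩ := hK u hu
      have hu : Surv F u := by
        have := (h3 u.1 (by rw [h2, sep_self]; omega)).1
        exact this
      exact ⟨h.mem_filtered E hr.thr hr.T_gt hr.cHat_le (hu.alive _) hv.1 (h2 ▸ hv.2),
        h.card_filtered_le E hp hr.thr hr.cHat_mul (hu.alive _)⟩
    · rw [show K.card = _ from Finset.card_image_of_injective _ (Prod.mk_right_injective i)]
      have h2 := le_card_columns i 1 (f + 4 * P.tau)
        (fun j a => Surv F (j, a) ∧ (j, a) ∉ X) fun j => ?_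
      · convert h2
      · refine le_trans (Finset.card_le_card fun a ha => ?_) ((Finset.card_union_le
          (Finset.univ.filter fun a : Fin k => ¬ Surv F (j, a))
          (Finset.univ.filter fun a : Fin k => (j, a) ∈ X)).trans
            (add_le_add (hF j) ?_))
        · simp only [Finset.mem_union, Finset.mem_filter, Finset.mem_univ, true_and] at ha ⊢
          tauto
        · convert h.X_card j

theorem of_notMem_not {α : Type*} {q : α → Prop} {a : α} (h : a ∉ {a | ¬ q a}) : q a :=
  by_contra fun hn => h hn

/-- The random phase contributes two units of `(mk)²` failure events, and each ranking or shuffle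
phase one. Both bounds are proved together because each phase starts from the outcome of the other
kind. -/
theorem prob_beforeRanking (hr : Regime m k P s f e) (hF : FewFailures f F) (p : ℕ) :
    (beforeRanking (cliquePath m k) P ρ F p).toOuterMeasure
      {c | ¬ ((p = 0 ∧ PostRandom P s F c) ∨ (1 ≤ p ∧ ∃ X, Shuffled P s F p X c))} ≤
        ((2 * p + 2) * ((m * k) * (m * k)) : ℕ) * e ∧
    ((beforeRanking (cliquePath m k) P ρ F p).bind
      (rankingPhase (cliquePath m k) P ρ F)).toOuterMeasure
      {c | ¬ ∃ X Y, Spread P s F (p + 1) X Y c} ≤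
        ((2 * p + 3) * ((m * k) * (m * k)) : ℕ) * e := by
  have hrank : ∀ p, (beforeRanking (cliquePath m k) P ρ F p).toOuterMeasure
      {c | ¬ ((p = 0 ∧ PostRandom P s F c) ∨ (1 ≤ p ∧ ∃ X, Shuffled P s F p X c))} ≤
        ((2 * p + 2) * ((m * k) * (m * k)) : ℕ) * e →
      ((beforeRanking (cliquePath m k) P ρ F p).bind
      (rankingPhase (cliquePath m k) P ρ F)).toOuterMeasure
      {c | ¬ ∃ X Y, Spread P s F (p + 1) X Y c} ≤
        ((2 * p + 3) * ((m * k) * (m * k)) : ℕ) * e := by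
    intro p hp
    refine (prob_bind_le _ _ _ _ (((m * k) * (m * k) : ℕ) * e) fun c _ hc => ?_).trans
      ((add_le_add_left hp _).trans (le_of_eq ?_))
    · rcases of_notMem_not hc with ⟨rfl, h⟩ | ⟨-, X, h⟩
      · exact prob_rankingPhase_of_postRandom hr h
      · exact prob_rankingPhase_of_shuffled hr h
    · push_cast
      ring
  induction p with
  | zero =>
    have h0 : (beforeRanking (cliquePath m k) P ρ F 0).toOuterMeasure
      {c | ¬ ((0 = 0 ∧ PostRandom P s F c) ∨ (1 ≤ 0 ∧ ∃ X, Shuffled P s F 0 X c))} ≤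
        ((2 * 0 + 2) * ((m * k) * (m * k)) : ℕ) * e := by
      refine le_trans (prob_mono _ fun c _ h => ?_) (prob_randomPhase hr hF)
      exact fun h' => h (Or.inl ⟨rfl, h'⟩)
    exact ⟨h0, hrank 0 h0⟩
  | succ p ih =>
    have h0 : (beforeRanking (cliquePath m k) P ρ F (p + 1)).toOuterMeasure
      {c | ¬ ((p + 1 = 0 ∧ PostRandom P s F c) ∨
        (1 ≤ p + 1 ∧ ∃ X, Shuffled P s F (p + 1) X c))} ≤
        ((2 * (p + 1) + 2) * ((m * k) * (m * k)) : ℕ) * e := by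
      refine (prob_bind_le _ _ _ _ (((m * k) * (m * k) : ℕ) * e) fun c _ hc => ?_).trans
        ((add_le_add_left ih.2 _).trans (le_of_eq ?_))
      · obtain ⟨X, Y, hc⟩ := of_notMem_not hc
        refine le_trans (prob_mono _ fun c' _ h => ?_) (prob_shufflePhase hr hF (by omega) hc)
        exact fun h' => h (Or.inr ⟨by omega, X, h'⟩)
      · push_cast
        ring
    exact ⟨h0, hrank (p + 1) h0⟩

end Phases

/-! ### The whole execution -/

section Execution

variable {m k : ℕ} {N : ℕ} {F : Schedule (Fin m × Fin k) N} {P : Params} {s f p : ℕ} {e : ℝ≥0∞}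
  {X Y : Finset (Fin m × Fin k)} {c : Config (Fin m × Fin k)}

/-- All distances are at most `m`, so every counter is at least `T > 0`. A positive counter means
that a neighbour has sent the message, unless the message is the node's own. -/
theorem Spread.complete (h : Spread P s F m X Y c) (hs : P.T + 1 ≤ s) (hT : 3 < P.T) :
    SpreadComplete F c := by
  classical
  intro u v hu hv
  have hsep : sep u.1 v.1 ≤ m := by
    simp only [sep]
    omega
  have h1 := h.sound.le_cnt hu hs (h.known u.1 v hv hsep)
  by_cases hvu : v = u
  · rw [hvu]
    exact h.sound.self u
  · rw [h.sound.cnt u hu v, if_neg hvu, zero_add] at h1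
    have h2 : (0 : ℝ) < (Finset.univ.filter fun w => (cliquePath m k).Adj u w ∧
        v ∈ (c.st w).S).card := by linarith
    have h3 := Finset.card_pos.1 (Nat.cast_pos.1 h2)
    obtain ⟨w, hw⟩ := h3
    obtain ⟨-, hw, hvw⟩ := Finset.mem_filter.1 hw
    exact h.sound.known u hu w hw hvw

theorem prob_not_fewFailures (q : unitInterval) (θ : ℝ≥0∞) (hθ : N * ENNReal.ofReal q ≤ θ)
    (he : (2 ^ (f + 1))⁻¹ * (1 + θ) ^ k ≤ e) :
    (failures (Fin m × Fin k) q N).toOuterMeasure {F | ¬ FewFailures f F} ≤ m * e := by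
  classical
  refine le_trans (prob_mono _ fun F _ hF => ?_) (prob_exists_le (ι := Fin m) _
    (fun i => {F | AtLeast (f + 1) fun u => u ∈ Finset.univ.image (fun a : Fin k => (i, a)) ∧
      ∃ t, F u t = true}) m e (by simp) fun i => ?_)
  · have hF : ¬ FewFailures f F := hF
    simp only [FewFailures, not_forall, not_le] at hF
    obtain ⟨i, hi⟩ := hF
    refine ⟨i, (Finset.univ.filter fun a : Fin k => ¬ Surv F (i, a)).image fun a => (i, a),
      ?_, ?_⟩
    · rw [Finset.card_image_of_injective _ (Prod.mk_right_injective i)]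
      convert Nat.succ_le_of_lt hi
    · intro u hu
      obtain ⟨a, ha, rfl⟩ := Finset.mem_image.1 hu
      refine ⟨Finset.mem_image_of_mem _ (Finset.mem_univ a), ?_⟩
      have := (Finset.mem_filter.1 ha).2
      simpa only [Surv, not_forall, Bool.not_eq_false] using this
  · refine (prob_many_failures q N θ hθ _ (f + 1)).trans (le_trans (le_of_eq ?_) he)
    rw [Finset.card_image_of_injective _ (Prod.mk_right_injective i), Finset.card_univ,
      Fintype.card_fin]

theorem prob_not_spreadComplete (hr : Regime m k P s f e) (hm : 0 < m) (ρ : Rules (Fin m × Fin k))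
    (q : unitInterval) (θ : ℝ≥0∞) (hθ : endTime P m * ENNReal.ofReal q ≤ θ)
    (he : (2 ^ (f + 1))⁻¹ * (1 + θ) ^ k ≤ e) :
    (faultyExecution (cliquePath m k) P ρ q m).toOuterMeasure {x | SpreadComplete x.1 x.2}ᶜ ≤
      (m + (2 * m + 1) * ((m * k) * (m * k)) : ℕ) * e := by
  rw [faultyExecution]
  refine (prob_bind_le _ _ {F | ¬ FewFailures f F} _
    (((2 * m + 1) * ((m * k) * (m * k)) : ℕ) * e) fun F _ hF => ?_).trans
      ((add_le_add_left (prob_not_fewFailures q θ hθ he) _).trans (le_of_eq ?_))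
  · rw [PMF.toOuterMeasure_map_apply]
    obtain ⟨m', rfl⟩ : ∃ m', m = m' + 1 := ⟨m - 1, by omega⟩
    refine le_trans (prob_mono _ fun c hc hbad => ?_)
      (prob_beforeRanking hr (of_notMem_not hF) m').2
    rintro ⟨X, Y, h⟩
    exact hbad (h.complete hr.thr hr.T_gt)
  · push_cast
    ring

end Execution

/-! ### The choice of the parameters -/

section Numerics

theorem one_sub_le_ofReal_exp {x : ℝ} {a : ℝ≥0∞} (hx : 0 ≤ x) (h : ENNReal.ofReal x ≤ a) :
    1 - a ≤ ENNReal.ofReal (Real.exp (-x)) := by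
  refine (tsub_le_tsub_left h 1).trans ?_
  rw [← ENNReal.ofReal_one, ← ENNReal.ofReal_sub _ hx]
  exact ENNReal.ofReal_le_ofReal (by linarith [Real.add_one_le_exp (-x)])

theorem half_add_half_mul_le {y : ℝ} {θ : ℝ≥0∞}
    (h : θ ≤ ENNReal.ofReal (1 - y)) (hy1 : y ≤ 1) :
    2⁻¹ + 2⁻¹ * θ ≤ ENNReal.ofReal (Real.exp (-(y / 2))) := by
  have h2 : (2⁻¹ : ℝ≥0∞) = ENNReal.ofReal (1 / 2) := by
    rw [one_div, ENNReal.ofReal_inv_of_pos (by norm_num)]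
    simp
  calc 2⁻¹ + 2⁻¹ * θ ≤ ENNReal.ofReal (1 / 2) + ENNReal.ofReal (1 / 2) * ENNReal.ofReal (1 - y) := by
        rw [h2]
        gcongr
    _ = ENNReal.ofReal (1 / 2 + 1 / 2 * (1 - y)) := by
        rw [← ENNReal.ofReal_mul (by norm_num), ← ENNReal.ofReal_add (by norm_num)]
        exact mul_nonneg (by norm_num) (by linarith)
    _ ≤ _ := ENNReal.ofReal_le_ofReal (by linarith [Real.add_one_le_exp (-(y / 2))])

theorem two_pow_eq_ofReal (s : ℕ) : (2 : ℝ≥0∞) ^ s = ENNReal.ofReal (Real.exp (s * Real.log 2)) := by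
  rw [mul_comm, Real.exp_mul, Real.exp_log (by norm_num), Real.rpow_natCast,
    ENNReal.ofReal_pow (by norm_num)]
  simp

theorem two_pow_mul_pow_le {s K : ℕ} {b : ℝ≥0∞} {x E : ℝ} (hb : b ≤ ENNReal.ofReal (Real.exp (-x)))
    (h : Real.exp (s * Real.log 2 - K * x) ≤ E) : 2 ^ s * b ^ K ≤ ENNReal.ofReal E := by
  calc 2 ^ s * b ^ K ≤ ENNReal.ofReal (Real.exp (s * Real.log 2)) *
        ENNReal.ofReal (Real.exp (-x)) ^ K := by
        rw [two_pow_eq_ofReal]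
        gcongr
    _ = ENNReal.ofReal (Real.exp (s * Real.log 2 - K * x)) := by
        rw [← ENNReal.ofReal_pow (Real.exp_pos _).le, ← ENNReal.ofReal_mul (Real.exp_pos _).le,
          ← Real.exp_nat_mul, ← Real.exp_add]
        ring_nf
    _ ≤ _ := ENNReal.ofReal_le_ofReal h

theorem inv_two_pow_mul_pow_le {s K : ℕ} {b : ℝ≥0∞} {x E : ℝ} (hx : 0 ≤ x)
    (hb : b ≤ ENNReal.ofReal x)
    (h : Real.exp (K * x - s * Real.log 2) ≤ E) : (2 ^ s)⁻¹ * (1 + b) ^ K ≤ ENNReal.ofReal E := by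
  calc (2 ^ s)⁻¹ * (1 + b) ^ K ≤ ENNReal.ofReal (Real.exp (-(s * Real.log 2))) *
        ENNReal.ofReal (Real.exp x) ^ K := by
        rw [two_pow_eq_ofReal, ← ENNReal.ofReal_inv_of_pos (Real.exp_pos _), ← Real.exp_neg]
        gcongr
        rw [← ENNReal.ofReal_one]
        refine (add_le_add_right hb _).trans ?_
        rw [← ENNReal.ofReal_add zero_le_one hx]
        exact ENNReal.ofReal_le_ofReal (by linarith [Real.add_one_le_exp x])
    _ = ENNReal.ofReal (Real.exp (K * x - s * Real.log 2)) := by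
        rw [← ENNReal.ofReal_pow (Real.exp_pos _).le, ← ENNReal.ofReal_mul (Real.exp_pos _).le,
          ← Real.exp_nat_mul, ← Real.exp_add]
        ring_nf
    _ ≤ _ := ENNReal.ofReal_le_ofReal h

theorem harmonicSum_le (n : ℕ) : harmonicSum n ≤ ENNReal.ofReal (1 + Real.log n) := by
  have h : harmonicSum n = ENNReal.ofReal (harmonic n : ℝ) := by
    rw [harmonicSum, harmonic]
    push_cast
    rw [ENNReal.ofReal_sum_of_nonneg fun i _ => by positivity]
    refine Finset.sum_congr rfl fun i _ => ?_
    rw [ENNReal.ofReal_inv_of_pos (by positivity), ENNReal.ofReal_add (by positivity) zero_le_one]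
    simp
  rw [h]
  exact ENNReal.ofReal_le_ofReal (harmonic_le_one_add_log n)

theorem natCast_div_eq_ofReal (a b : ℕ) (hb : 0 < b) :
    (a : ℝ≥0∞) / b = ENNReal.ofReal ((a : ℝ) / b) := by
  rw [ENNReal.ofReal_div_of_pos (by exact_mod_cast hb)]
  simp

/-- The factor `2 ^ s` costs about `0.347 τ` in the exponent. Selection gains `0.75 τ` and the
random phase about `0.369 τ`. For `early`, `10τ/9` stands against `2τ log 2 ≈ 1.386 τ`. Each margin
exceeds `τ/100`. -/
theorem regime_of_bounds {m k : ℕ} {P : Params} {E : ℝ} (hk : 120 * P.tau ≤ k)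
    (hcτ : 8 < P.cHat * P.tau) (hc : P.cHat ≤ 1 / 2) (hlog : 1 ≤ Real.log (m * k : ℕ))
    (hE : 4 * Real.exp (-(P.tau / 100)) ≤ E)
    (hE' : Real.exp (-(P.tau' / (16 * P.tau * Real.log (m * k : ℕ)))) ≤ E) :
    Regime m k P (P.tau / 2 + 2) (k / 20) (ENNReal.ofReal E) := by
  have ht0 : (0 : ℝ) ≤ P.tau := Nat.cast_nonneg _
  have hτ : (16 : ℝ) < P.tau := by nlinarith
  have hτn : 16 < P.tau := by exact_mod_cast hτ
  have hkr : 120 * (P.tau : ℝ) ≤ k := by exact_mod_cast hk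
  have hk0 : (0 : ℝ) < k := by linarith
  have hs : ((P.tau / 2 + 2 : ℕ) : ℝ) ≤ P.tau / 2 + 2 := by
    push_cast
    linarith [Nat.cast_div_le (α := ℝ) (m := P.tau) (n := 2)]
  have hf : ((k / 20 : ℕ) : ℝ) ≤ k / 20 := by
    have := Nat.cast_div_le (α := ℝ) (m := k) (n := 20)
    exact_mod_cast this
  have hlog2 := Real.log_two_lt_d9
  have hlog2' := Real.log_two_gt_d9
  -- The factor 4 of `hE` pays for the summand 2 in `s = τ / 2 + 2`.
  have hfour : (4 : ℝ) = Real.exp (2 * Real.log 2) := by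
    rw [mul_comm, Real.exp_mul, Real.exp_log (by norm_num)]
    norm_num
  rw [hfour, ← Real.exp_add] at hE
  have hs2 : ((P.tau / 2 + 2 : ℕ) : ℝ) * Real.log 2 ≤
      P.tau / 2 * 0.6931471808 + 2 * Real.log 2 := by
    calc _ ≤ (P.tau / 2 + 2) * Real.log 2 := by gcongr
      _ ≤ _ := by nlinarith
  refine ⟨by exact_mod_cast hk0, ?_, ?_, by omega, by linarith, ?_, ?_, ?_, ?_, ?_⟩
  · rw [Params.T]
    have h1 : P.tau + 2 ≤ 2 * (P.tau / 2 + 2) := by omega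
    have h2 : (P.tau : ℝ) + 2 ≤ 2 * (P.tau / 2 + 2 : ℕ) := by exact_mod_cast h1
    linarith
  · rw [Params.T]
    linarith
  · rw [Params.T]
    linarith
  · have hx : (0 : ℝ) ≤ 1 / (16 * P.tau * Real.log (m * k : ℕ)) := by positivity
    refine (pow_le_pow_left' (one_sub_le_ofReal_exp hx ?_) P.tau').trans ?_
    · rw [← ENNReal.mul_inv (Or.inl (by exact_mod_cast (by omega : 8 * P.tau ≠ 0)))
        (Or.inl (ENNReal.natCast_ne_top _)), one_div,
        ENNReal.ofReal_inv_of_pos (by positivity)]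
      refine ENNReal.inv_le_inv.2 ((mul_le_mul_right (harmonicSum_le _) _).trans ?_)
      rw [← ENNReal.ofReal_natCast, ← ENNReal.ofReal_mul (by positivity)]
      refine ENNReal.ofReal_le_ofReal ?_
      push_cast at hlog ⊢
      nlinarith
    · rw [← ENNReal.ofReal_pow (Real.exp_pos _).le, ← Real.exp_nat_mul]
      refine ENNReal.ofReal_le_ofReal (le_trans (le_of_eq ?_) hE')
      congr 1
      ring
  · intro K hK
    have hK' : (3 / 4 : ℝ) * k ≤ K := by
      have h1 : k ≤ K + 3 * (k / 20) + 12 * P.tau := by omega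
      have h2 : (k : ℝ) ≤ K + 3 * (k / 20 : ℕ) + 12 * P.tau := by exact_mod_cast h1
      linarith
    refine two_pow_mul_pow_le (x := (P.tau : ℝ) / k) (le_trans (half_add_half_mul_le
      (y := 2 * (P.tau : ℝ) / k) ?_ ?_) (le_of_eq ?_)) (le_trans ?_ hE)
    · rw [natCast_div_eq_ofReal _ _ (by have : 0 < k := by exact_mod_cast hk0
                                        omega), ENNReal.ofReal_sub _ (by positivity),
        ENNReal.ofReal_one]
      refine tsub_le_tsub_left (ENNReal.ofReal_le_ofReal (le_of_eq ?_)) 1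
      push_cast
      field_simp
      norm_num
    · rw [div_le_one hk0]
      linarith
    · congr 3
      ring
    · refine Real.exp_le_exp.2 ?_
      have h1 : (3 / 4 : ℝ) * P.tau ≤ K * (P.tau / k) := by
        calc (3 / 4 : ℝ) * P.tau = (3 / 4 * k) * (P.tau / k) := by field_simp
          _ ≤ _ := by gcongr
      linarith
  · intro K hK
    have hK' : (149 / 200 : ℝ) * (k + 1) ≤ K := by
      have h1 : k ≤ K + 5 * (k / 20) + 1 := by omega
      have h2 : (k : ℝ) ≤ K + 5 * (k / 20 : ℕ) + 1 := by exact_mod_cast h1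
      linarith
    set x : ℝ := P.tau / (k + 1) with hx
    have hx0 : 0 ≤ x := by positivity
    have hx1 : x ≤ 1 / 100 := by
      rw [hx, div_le_iff₀ (by positivity)]
      linarith
    -- Uses `exp (-x) ≤ 1/(1+x) ≤ 1 - 99x/100` for `0 ≤ x ≤ 1/100`. The narrow margin of the random
    -- phase requires a factor this close to 1.
    have hpow : (1 - 1⁻¹ * ((k + 1 : ℕ) : ℝ≥0∞)⁻¹) ^ P.tau ≤
        ENNReal.ofReal (1 - 99 / 100 * x) := by
      refine (pow_le_pow_left' (one_sub_le_ofReal_exp (x := 1 / (k + 1)) (by positivity) ?_)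
        P.tau).trans ?_
      · rw [inv_one, one_mul, one_div, ENNReal.ofReal_inv_of_pos (by positivity),
          ENNReal.ofReal_add (by positivity) zero_le_one]
        simp
      · rw [← ENNReal.ofReal_pow (Real.exp_pos _).le, ← Real.exp_nat_mul]
        refine ENNReal.ofReal_le_ofReal ?_
        have h1 : (P.tau : ℝ) * -(1 / (k + 1)) = -x := by
          rw [hx]
          ring
        rw [h1, Real.exp_neg, inv_le_comm₀ (Real.exp_pos _) (by linarith)]
        refine le_trans ?_ (Real.add_one_le_exp x)
        rw [inv_le_iff_one_le_mul₀ (by linarith)]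
        nlinarith
    refine two_pow_mul_pow_le (half_add_half_mul_le (y := 99 / 100 * x) hpow
      (by linarith)) (le_trans ?_ hE)
    refine Real.exp_le_exp.2 ?_
    have h1 : (149 / 200 : ℝ) * P.tau ≤ K * x := by
      calc (149 / 200 : ℝ) * P.tau = (149 / 200 * (k + 1)) * x := by
            rw [hx]
            field_simp
        _ ≤ _ := by gcongr
    have h2 : (K : ℝ) * (99 / 100 * x / 2) = 99 / 200 * (K * x) := by ring
    rw [h2]
    linarith
  · intro K hK
    have hKr : (K : ℝ) ≤ k := by exact_mod_cast hK
    have hden : (9 / 10 : ℝ) * k ≤ (k - k / 20 - 1 : ℕ) := by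
      have h1 : k ≤ (k - k / 20 - 1) + k / 20 + 1 := by omega
      have h2 : (k : ℝ) ≤ (k - k / 20 - 1 : ℕ) + (k / 20 : ℕ) + 1 := by exact_mod_cast h1
      linarith
    refine inv_two_pow_mul_pow_le (x := P.tau / (9 / 10 * k)) (by positivity) ?_ (le_trans ?_ hE)
    · rw [← div_eq_mul_inv, natCast_div_eq_ofReal]
      · refine ENNReal.ofReal_le_ofReal ?_
        gcongr
      · have : (0 : ℝ) < (k - k / 20 - 1 : ℕ) := by linarith
        exact_mod_cast this
    · refine Real.exp_le_exp.2 ?_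
      have h1 : (K : ℝ) * (P.tau / (9 / 10 * k)) ≤ 10 / 9 * P.tau := by
        calc _ ≤ (k : ℝ) * (P.tau / (9 / 10 * k)) := by gcongr
          _ = _ := by field_simp
      push_cast
      nlinarith

/-- `(log 2)/20 ≈ 0.0347` exceeds `1/32 = 0.03125` by more than `3/1000`. -/
theorem failures_bound {k : ℕ} {E : ℝ} (hE : Real.exp (-(3 / 1000 * k)) ≤ E) :
    (2 ^ (k / 20 + 1))⁻¹ * (1 + ENNReal.ofReal (1 / 32)) ^ k ≤ ENNReal.ofReal E := by
  refine inv_two_pow_mul_pow_le (by norm_num) le_rfl (le_trans ?_ hE)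
  refine Real.exp_le_exp.2 ?_
  have hlog2' := Real.log_two_gt_d9
  have h1 : k ≤ 20 * (k / 20 + 1) := by omega
  have h2 : (k : ℝ) ≤ 20 * (k / 20 + 1 : ℕ) := by exact_mod_cast h1
  have hk : (0 : ℝ) ≤ k := Nat.cast_nonneg k
  have h3 : (k : ℝ) / 20 * 0.6931471803 ≤ (k / 20 + 1 : ℕ) * Real.log 2 := by
    gcongr
    linarith
  linarith

end Numerics

/-! ### Logarithmic bounds for `τ`, `τ'` and `τ_e`. -/

section Asymptotics

theorem params_tau_ge (α d cHat : ℝ) (hα : 0 < α) {n : ℕ} (hn : 1 ≤ Real.log n) :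
    α * Real.log n ≤ (params α d cHat n).tau := by
  have hlog2 := Real.log_two_lt_d9
  have hlog2' := Real.log_two_gt_d9
  refine le_trans ?_ (Nat.le_ceil (α * Real.logb 2 n))
  gcongr
  rw [Real.logb, le_div_iff₀ (by linarith)]
  nlinarith

theorem logb_two_le {n : ℕ} (hn : 1 ≤ Real.log n) : Real.logb 2 n ≤ 2 * Real.log n := by
  have hlog2' := Real.log_two_gt_d9
  rw [Real.logb, div_le_iff₀ (by linarith)]
  nlinarith

theorem le_logb_two {n : ℕ} (hn : 1 ≤ Real.log n) : Real.log n ≤ Real.logb 2 n := by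
  have hlog2 := Real.log_two_lt_d9
  have hlog2' := Real.log_two_gt_d9
  rw [Real.logb, le_div_iff₀ (by linarith)]
  nlinarith

theorem params_tau_le (α d cHat : ℝ) (hα : 1 ≤ α) {n : ℕ} (hn : 1 ≤ Real.log n) :
    ((params α d cHat n).tau : ℝ) ≤ 3 * α * Real.log n := by
  have h1 := logb_two_le hn
  have h2 := le_logb_two hn
  have h0 : 0 ≤ α * Real.logb 2 n := mul_nonneg (by linarith) (by linarith)
  refine (Nat.ceil_lt_add_one h0).le.trans ?_
  nlinarith

theorem params_tau'_ge (α d cHat : ℝ) (hd : 0 < d) {n : ℕ} (hn : 1 ≤ Real.log n) :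
    8 * d * (params α d cHat n).tau * Real.log n ^ 2 ≤ (params α d cHat n).tau' := by
  refine le_trans ?_ (Nat.le_ceil _)
  have h2 := le_logb_two hn
  change 8 * d * (⌈α * Real.logb 2 n⌉₊ : ℝ) * Real.log n ^ 2 ≤ _
  gcongr

theorem params_tau'_le (α d cHat : ℝ) (hα : 1 ≤ α) (hd : 0 < d) {n : ℕ} (hn : 1 ≤ Real.log n) :
    ((params α d cHat n).tau' : ℝ) ≤ 96 * α * d * Real.log n ^ 3 + 1 := by
  have h1 := logb_two_le hn
  have h2 := le_logb_two hn
  have h0 : 0 ≤ Real.logb 2 n := by linarith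
  have key : 8 * d * (⌈α * Real.logb 2 n⌉₊ : ℝ) * Real.logb 2 n ^ 2 ≤
      96 * α * d * Real.log n ^ 3 := calc
    8 * d * (⌈α * Real.logb 2 n⌉₊ : ℝ) * Real.logb 2 n ^ 2
      ≤ 8 * d * (3 * α * Real.log n) * (2 * Real.log n) ^ 2 := by
        gcongr
        exact params_tau_le α d cHat hα hn
    _ = _ := by ring
  exact (Nat.ceil_lt_add_one (by positivity)).le.trans (by linarith)

theorem endTime_le (α d cHat : ℝ) (hα : 1 ≤ α) (hd : 0 < d) {n m : ℕ} (hm : 1 ≤ m)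
    (hn : 1 ≤ Real.log n) :
    (endTime (params α d cHat n) m : ℝ) ≤
      (2 + 27 * α + 96 * α * d) * (m * Real.log n ^ 3) := by
  have h1 := params_tau_le α d cHat hα hn
  have h2 := params_tau'_le α d cHat hα hd hn
  have h3 : endTime (params α d cHat n) m ≤
      m * (1 + 9 * (params α d cHat n).tau + (params α d cHat n).tau') := by
    obtain ⟨m, rfl⟩ : ∃ m', m = m' + 1 := ⟨m - 1, by omega⟩
    rw [endTime, Nat.add_sub_cancel]
    ring_nf
    nlinarith [Nat.zero_le (m * (params α d cHat n).tau)]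
  -- The coefficient collects round 0 and the rounding of `τ'` (2), nine times `τ ≤ 3α log n`
  -- (`27α`), and `τ'` (`96αd`).
  have h4 : Real.log n ≤ Real.log n ^ 3 := le_self_pow₀ hn (by norm_num)
  have h5 : (1 : ℝ) ≤ Real.log n ^ 3 := one_le_pow₀ hn
  have h6 : (endTime (params α d cHat n) m : ℝ) ≤
      m * (1 + 9 * (params α d cHat n).tau + (params α d cHat n).tau') := by exact_mod_cast h3
  refine h6.trans ?_
  rw [mul_left_comm]
  gcongr
  have h7 : α * Real.log n ≤ α * Real.log n ^ 3 := by gcongr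
  linarith

end Asymptotics

end VertexCongest

/-! ### Choice of the constants and final union bound. -/

theorem mainTheorem1 (c : ℝ) (hc : 1 ≤ c) :
    ∃ α₀ d₀ : ℝ, ∀ α d cHat : ℝ, α₀ ≤ α → d₀ ≤ d → 0 < cHat → cHat ≤ 1 / 2 →
      ∃ C : ℝ, 0 < C ∧
        ∀ k : ℕ → ℕ, Tendsto (fun n : ℕ => (k n : ℝ) / Real.log n ^ 3) atTop atTop →
          ∀ᶠ n : ℕ in atTop, k n ∣ n →
            (VertexCongest.endTime (VertexCongest.params α d cHat n) (n / k n) : ℝ)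
                ≤ C * ((n : ℝ) * Real.log n ^ 3 / (k n : ℝ)) ∧
            ∀ q : unitInterval,
              (q : ℝ) ≤ 1 / (32 *
                (VertexCongest.endTime (VertexCongest.params α d cHat n) (n / k n) : ℝ)) →
              ∀ ρ : VertexCongest.Rules (Fin (n / k n) × Fin (k n)),
                ENNReal.ofReal (1 - (n : ℝ) ^ (-c)) ≤
                  (VertexCongest.faultyExecution
                    (VertexCongest.cliquePath (n / k n) (k n))
                    (VertexCongest.params α d cHat n) ρ q (n / k n)).toOuterMeasure
                    {x | VertexCongest.SpreadComplete x.1 x.2} := by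
  open VertexCongest in
  -- `α₀` gives `τ/100 ≥ (c+6) log n`, where one `log n` absorbs the factor `4 ≤ n`. `d₀` gives
  -- `τ'/(16 τ log n) ≥ (d/2) log n ≥ (c+5) log n`.
  refine ⟨100 * (c + 6), 2 * (c + 5), fun α d cHat hα hd hc0 hc1 =>
    ⟨2 + 27 * α + 96 * α * d, ?_, fun k hk => ?_⟩⟩
  · have : 0 < α := by linarith
    have : 0 < d := by linarith
    positivity
  have hα1 : 1 ≤ α := by linarith
  have hd0 : 0 < d := by linarith
  have hlogt : Tendsto (fun n : ℕ => Real.log n) atTop atTop :=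
    Real.tendsto_log_atTop.comp tendsto_natCast_atTop_atTop
  -- The second bound gives `ĉτ ≥ 9`, hence `ĉT > 4`. In the third, `360α` provides `k ≥ 120τ` and
  -- `1000(c+5)` provides `3k/1000 ≥ (c+5) log n`.
  filter_upwards [hlogt.eventually_ge_atTop 1, hlogt.eventually_ge_atTop (9 / (cHat * α)),
    hk.eventually_ge_atTop (360 * α + 1000 * (c + 5)), eventually_ge_atTop 4]
    with n hlog hlogc hkn hn4 hdvd
  set ℓ := Real.log n with hℓ
  have hn0 : (0 : ℝ) < n := by exact_mod_cast (by omega : 0 < n)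
  rw [le_div_iff₀ (by positivity)] at hkn
  have hkℓ : (360 * α + 1000 * (c + 5)) * ℓ ≤ k n := by
    refine le_trans ?_ hkn
    gcongr
    exact le_self_pow₀ hlog (by norm_num)
  obtain ⟨m, hm⟩ := hdvd
  have hk0 : 0 < k n := by
    rcases Nat.eq_zero_or_pos (k n) with h | h
    · rw [h] at hm
      omega
    · exact h
  have hdiv : n / k n = m := Nat.div_eq_of_eq_mul_right hk0 hm
  have hm0 : 0 < m := by
    rcases Nat.eq_zero_or_pos m with h | h
    · rw [h] at hm
      omega
    · exact h
  have hnm : m * k n = n := by rw [mul_comm, ← hm]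
  rw [hdiv]
  have htime := endTime_le α d cHat hα1 hd0 hm0 hlog
  refine ⟨htime.trans (le_of_eq ?_), fun q hq ρ => ?_⟩
  · congr 1
    have h1 : (n : ℝ) = m * k n := by exact_mod_cast hnm.symm
    have h2 : (k n : ℝ) ≠ 0 := by exact_mod_cast hk0.ne'
    rw [eq_div_iff h2]
    calc (m : ℝ) * ℓ ^ 3 * k n = m * k n * ℓ ^ 3 := by ring
      _ = n * ℓ ^ 3 := by rw [← h1]
  have hτ1 := params_tau_ge α d cHat (by linarith) hlog
  have hτ2 := params_tau_le α d cHat hα1 hlog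
  have hτ' := params_tau'_ge α d cHat hd0 hlog
  have hτ0 : (0 : ℝ) < (params α d cHat n).tau := by nlinarith
  have hE : ∀ x : ℝ, (c + 5) * ℓ ≤ x → Real.exp (-x) ≤ (n : ℝ) ^ (-(c + 5)) := by
    intro x hx
    rw [Real.rpow_def_of_pos hn0]
    refine Real.exp_le_exp.2 ?_
    linarith
  have hreg : Regime m (k n) (params α d cHat n) ((params α d cHat n).tau / 2 + 2) (k n / 20)
      (ENNReal.ofReal ((n : ℝ) ^ (-(c + 5)))) := by
    refine regime_of_bounds ?_ ?_ hc1 (by rwa [hnm]) ?_ ?_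
    · have : (120 : ℝ) * (params α d cHat n).tau ≤ k n := by nlinarith
      exact_mod_cast this
    · change 8 < cHat * _
      rw [div_le_iff₀ (by positivity)] at hlogc
      nlinarith
    · have h4 : (4 : ℝ) ≤ Real.exp ℓ := by
        rw [hℓ, Real.exp_log hn0]
        exact_mod_cast hn4
      refine le_trans (mul_le_mul_of_nonneg_right h4 (Real.exp_pos _).le) ?_
      rw [← Real.exp_add, show ℓ + -((params α d cHat n).tau / 100 : ℝ) =
        -((params α d cHat n).tau / 100 - ℓ) by ring]
      refine hE _ ?_
      nlinarith
    · rw [hnm]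
      refine hE _ ?_
      rw [le_div_iff₀ (by positivity)]
      refine le_trans ?_ hτ'
      have h1 : (c + 5) * 2 ≤ d := by linarith
      calc (c + 5) * ℓ * (16 * (params α d cHat n).tau * ℓ)
          = 8 * ((c + 5) * 2) * (params α d cHat n).tau * ℓ ^ 2 := by ring
        _ ≤ _ := by gcongr
  have hfail := failures_bound (k := k n) (hE (3 / 1000 * k n) (by nlinarith))
  have hθ : (endTime (params α d cHat n) m : ℝ≥0∞) * ENNReal.ofReal q ≤
      ENNReal.ofReal (1 / 32) := by
    rw [← ENNReal.ofReal_natCast, ← ENNReal.ofReal_mul (Nat.cast_nonneg _)]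
    refine ENNReal.ofReal_le_ofReal ?_
    have h1 : (0 : ℝ) < endTime (params α d cHat n) m := by
      have : 0 < endTime (params α d cHat n) m := by
        rw [endTime]
        omega
      exact_mod_cast this
    rw [le_div_iff₀ (by positivity)] at hq
    linarith
  refine prob_le_of_compl_le _ _ _ (by positivity)
    ((prob_not_spreadComplete hreg hm0 ρ q _ hθ hfail).trans ?_)
  rw [hnm, ← ENNReal.ofReal_natCast, ← ENNReal.ofReal_mul (Nat.cast_nonneg _)]
  refine ENNReal.ofReal_le_ofReal ?_
  have hmn : m ≤ n := by
    rw [← hnm]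
    exact Nat.le_mul_of_pos_right m hk0
  -- The number of elementary failure events; this is why their probability is taken as `n ^ (-(c +
  -- 5))`.
  have hcount : m + (2 * m + 1) * (n * n) ≤ n ^ 5 := by
    calc m + (2 * m + 1) * (n * n) ≤ n + (2 * n + 1) * (n * n) := by gcongr
      _ ≤ 4 * 4 * n ^ 3 := by nlinarith [Nat.zero_le (n ^ 2)]
      _ ≤ n * n * n ^ 3 := by gcongr
      _ = n ^ 5 := by ring
  calc ((m + (2 * m + 1) * (n * n) : ℕ) : ℝ) * (n : ℝ) ^ (-(c + 5))
      ≤ (n : ℝ) ^ (5 : ℝ) * (n : ℝ) ^ (-(c + 5)) := by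
        gcongr
        rw [show (5 : ℝ) = ((5 : ℕ) : ℝ) by norm_num, Real.rpow_natCast]
        exact_mod_cast hcount
    _ = (n : ℝ) ^ (-c) := by
        rw [← Real.rpow_add hn0]
        congr 1
        ring
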